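/- Let $V:(0,\infty)\to\mathbb C$ be a bounded measurable function with $\int_0^\infty x|V(x)|\,dx<\infty$. In $\mathcal H=L_2(0,\infty)$ let $L_0=-d^2/dx^2$ with the Dirichlet condition at zero, i.e. with domain $\{f\in\mathcal H: f'\text{ locally absolutely continuous on }[0,\infty),\ f''\in\mathcal H,\ f(0)=0\}$, and let $L_V=L_0+V$ on the same domain. For $k\in\mathbb C$ with $\operatorname{Im}k\ge 0$ let $e(x,k)$ be the Jost solution, i.e. the solution of $-y''+V(x)y=k^2y$ on $[0,\infty)$ with $e(x,k)e^{-ikx}\to 1$ as $x\to\infty$, and let $e(k)=e(0,k)$ be the Jost function; the points $\lambda=k^2$, where $k$ is a real zero (possibly $0$) of $e$, are called spectral singularities of $L_V$. Suppose that $L_V$ has neither eigenvalues nor spectral singularities. Then the propagators $e^{itL_0}$ and $e^{itL_V}$ (the strongly continuous one-parameter groups generated by $iL_0$ and $iL_V$) are defined, the direct and inverse wave operators $$\Omega_\pm=\operatorname*{s-lim}_{t\to\pm\infty}e^{itL_V}e^{-itL_0},\qquad \widetilde\Omega_\pm=\operatorname*{s-lim}_{t\to\pm\infty}e^{itL_0}e^{-itL_V}$$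 exist as bounded operators on $\mathcal H$, and they implement the similarity of $L_V$ and $L_0$: $\widetilde\Omega_\pm=\Omega_\pm^{-1}$ and $L_V=\Omega_\pm L_0\widetilde\Omega_\pm$ (including equality of domains). -/

import Mathlib

open MeasureTheory Set Filter Topology
open scoped ENNReal

noncomputable section

namespace HalfLine

/-- Lebesgue measure on the half-line `(0, ∞)`. -/
abbrev halfLine : Measure ℝ := volume.restrict (Ioi (0 : ℝ))

/-- The Hilbert space `L²(0, ∞)` of complex-valued functions. -/
abbrev H : Type := Lp ℂ 2 halfLine

lemma intervalIntegrable_coe (h : H) {x : ℝ} (hx : 0 ≤ x) :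
    IntervalIntegrable (h : ℝ → ℂ) volume 0 x := by
  rw [intervalIntegrable_iff_integrableOn_Ioc_of_le hx]
  have h1 : MemLp (h : ℝ → ℂ) 2 (volume.restrict (Ioc 0 x)) :=
    (Lp.memLp h).mono_measure (Measure.restrict_mono Ioc_subset_Ioi_self le_rfl)
  exact h1.integrable (by norm_num)

lemma integral_congr_coe {f g : ℝ → ℂ} (hfg : f =ᵐ[halfLine] g) {x : ℝ} (hx : 0 ≤ x) :
    ∫ t in (0 : ℝ)..x, f t = ∫ t in (0 : ℝ)..x, g t := by
  rw [intervalIntegral.integral_of_le hx, intervalIntegral.integral_of_le hx]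
  exact integral_congr_ae (ae_mono (Measure.restrict_mono Ioc_subset_Ioi_self le_rfl) hfg)

/-- `IsDirichletPair f h` says that `f` has a representative `u` on `[0, ∞)` that is continuously
differentiable with absolutely continuous derivative `v`, such that `u 0 = 0` and `-u'' = h`. -/
def IsDirichletPair (f h : H) : Prop :=
  ∃ u v : ℝ → ℂ, (f : ℝ → ℂ) =ᵐ[halfLine] u ∧ u 0 = 0 ∧
    (∀ x, 0 ≤ x → HasDerivWithinAt u (v x) (Ici 0) x) ∧
    (∀ x, 0 ≤ x → v x = v 0 - ∫ t in (0 : ℝ)..x, h t)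

/-- The graph of `L₀ = -d²/dx²` on `L²(0, ∞)` with the Dirichlet condition at zero. -/
def dirichletGraph : Submodule ℂ (H × H) where
  carrier := {p | IsDirichletPair p.1 p.2}
  zero_mem' := by
    refine ⟨0, 0, Lp.coeFn_zero _ _ _, rfl, fun x _ => hasDerivWithinAt_const _ _ _, ?_⟩
    intro x hx
    simp only [Prod.snd_zero]
    rw [integral_congr_coe (Lp.coeFn_zero ℂ 2 halfLine) hx]
    simp
  add_mem' := by
    rintro ⟨f, h⟩ ⟨f', h'⟩ ⟨u, v, e, e0, d, i⟩ ⟨u', v', e', e0', d', i'⟩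
    refine ⟨u + u', v + v', (Lp.coeFn_add f f').trans (e.add e'), by simp [e0, e0'],
      fun x hx => (d x hx).add (d' x hx), ?_⟩
    intro x hx
    simp only at i i'
    simp only [Prod.mk_add_mk]
    rw [integral_congr_coe (Lp.coeFn_add h h') hx]
    simp only [Pi.add_apply]
    rw [intervalIntegral.integral_add (intervalIntegrable_coe h hx)
      (intervalIntegrable_coe h' hx), i x hx, i' x hx]
    ring
  smul_mem' := by
    rintro c ⟨f, h⟩ ⟨u, v, e, e0, d, i⟩
    refine ⟨c • u, c • v, (Lp.coeFn_smul c f).trans (e.const_smul c), by simp [e0],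
      fun x hx => (d x hx).const_smul c, ?_⟩
    intro x hx
    simp only at i
    simp only [Prod.smul_mk]
    rw [integral_congr_coe (Lp.coeFn_smul c h) hx]
    simp only [Pi.smul_apply]
    rw [intervalIntegral.integral_smul, i x hx, smul_sub]

lemma dirichletGraph_functional (p : H × H) (hp : p ∈ dirichletGraph) (h0 : p.1 = 0) :
    p.2 = 0 := by
  obtain ⟨f, h⟩ := p
  obtain ⟨u, v, e, e0, d, i⟩ := hp
  simp only at h0 e i ⊢
  subst h0
  have hu : u =ᵐ[volume.restrict (Ioi 0)] 0 := e.symm.trans (Lp.coeFn_zero ℂ 2 halfLine)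
  have hc : ContinuousOn u (Ici 0) := fun x hx => (d x hx).continuousWithinAt
  have hz : EqOn u 0 (Ioi 0) :=
    Measure.eqOn_open_of_ae_eq hu isOpen_Ioi (hc.mono Ioi_subset_Ici_self) continuousOn_const
  have hz' : ∀ x, 0 ≤ x → u x = 0 := by
    intro x hx
    rcases hx.eq_or_lt with rfl | hx
    · exact e0
    · exact hz hx
  have hv : ∀ x, 0 ≤ x → v x = 0 := by
    intro x hx
    have h1 : HasDerivWithinAt u 0 (Ici 0) x :=
      (hasDerivWithinAt_const x (Ici 0) (0 : ℂ)).congr (fun y hy => hz' y hy) (hz' x hx)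
    exact (uniqueDiffOn_Ici (0 : ℝ) x hx).eq_deriv _ (d x hx) h1
  have hI : ∀ x, 0 ≤ x → ∫ t in (0 : ℝ)..x, h t = 0 := by
    intro x hx
    have := i x hx
    rw [hv x hx, hv 0 le_rfl] at this
    simpa using this.symm
  have hn : ∀ n : ℕ, ∀ᵐ x ∂(volume : Measure ℝ), x ∈ Ioo (0 : ℝ) n → h x = 0 := by
    intro n
    have hn0 : (0 : ℝ) ≤ n := n.cast_nonneg
    filter_upwards [(intervalIntegrable_coe h hn0).ae_hasDerivAt_integral] with x hx hxn
    have hx' := hx (by rw [uIcc_of_le hn0]; exact Ioo_subset_Icc_self hxn) 0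
      (by rw [uIcc_of_le hn0]; exact ⟨le_rfl, hn0⟩)
    have h2 : HasDerivAt (fun y => ∫ t in (0 : ℝ)..y, h t) 0 x := by
      refine (hasDerivAt_const x (0 : ℂ)).congr_of_eventuallyEq ?_
      filter_upwards [Ioi_mem_nhds hxn.1] with y hy
      exact hI y (le_of_lt hy)
    exact hx'.unique h2
  have hae : (h : ℝ → ℂ) =ᵐ[halfLine] 0 := by
    rw [EventuallyEq, ae_restrict_iff' measurableSet_Ioi]
    filter_upwards [ae_all_iff.2 hn] with x hx hx0
    obtain ⟨n, hn⟩ := exists_nat_gt x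
    exact hx n ⟨hx0, hn⟩
  exact Lp.ext (hae.trans (Lp.coeFn_zero ℂ 2 halfLine).symm)

/-- The operator `L₀ = -d²/dx²` in `L²(0, ∞)` with the Dirichlet boundary condition at zero. -/
def dirichletLaplacian : H →ₗ.[ℂ] H := dirichletGraph.toLinearPMap

lemma mem_graph_dirichletLaplacian (f h : H) :
    (f, h) ∈ dirichletLaplacian.graph ↔ IsDirichletPair f h := by
  rw [dirichletLaplacian, Submodule.toLinearPMap_graph_eq _ dirichletGraph_functional]
  rfl

/-- The bounded operator of multiplication by an essentially bounded function `V`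
on `L²(0, ∞)`. -/
def mulOp {V : ℝ → ℂ} (hV : MemLp V ∞ halfLine) : H →L[ℂ] H :=
  (ContinuousLinearMap.mul ℂ ℂ).holderL halfLine ∞ 2 2 (hV.toLp V)

lemma mulOp_coe {V : ℝ → ℂ} (hV : MemLp V ∞ halfLine) (f : H) :
    (mulOp hV f : ℝ → ℂ) =ᵐ[halfLine] fun x => V x * f x := by
  have h1 := (ContinuousLinearMap.mul ℂ ℂ).coeFn_holder (r := 2) (hV.toLp V) f
  refine EventuallyEq.trans h1 ?_
  filter_upwards [hV.coeFn_toLp] with x hx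
  simp [hx]

/-- The Schrödinger operator `L_V = L₀ + V` on the domain of `L₀`, for a bounded complex-valued
potential `V`. -/
def schrodinger {V : ℝ → ℂ} (hV : MemLp V ∞ halfLine) : H →ₗ.[ℂ] H :=
  (mulOp hV : H →ₗ[ℂ] H) +ᵥ dirichletLaplacian

/-- `lam` is an eigenvalue of the (unbounded) operator `L`. -/
def IsEigenvalue (L : H →ₗ.[ℂ] H) (lam : ℂ) : Prop :=
  ∃ f : L.domain, (f : H) ≠ 0 ∧ L f = lam • (f : H)

/-- `y` is the Jost solution of `-y'' + V y = k² y` on `[0, ∞)`: it is continuously differentiable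
with absolutely continuous derivative, solves the equation almost everywhere, and
`y x ∼ exp (i k x)` as `x → ∞`. (It is used for `0 ≤ k.im`, where it is unique on `[0, ∞)`.) -/
def IsJostSolution (V : ℝ → ℂ) (k : ℂ) (y : ℝ → ℂ) : Prop :=
  ∃ v : ℝ → ℂ,
    (∀ x, 0 ≤ x → HasDerivWithinAt y (v x) (Ici 0) x) ∧
    (∀ x, 0 ≤ x → v x = v 0 + ∫ t in (0 : ℝ)..x, (V t - k ^ 2) * y t) ∧
    Tendsto (fun x : ℝ => y x * Complex.exp (-(Complex.I * k * x))) atTop (𝓝 1)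

/-- A spectral singularity of `L_V`: a point `lam = k²`, with `k` real (possibly zero), such that
the Jost function `e(k) = e(0, k)`, the value at `0` of the Jost solution, vanishes at `k`. -/
def IsSpectralSingularity (V : ℝ → ℂ) (lam : ℝ) : Prop :=
  ∃ k : ℝ, lam = k ^ 2 ∧ ∃ y : ℝ → ℂ, IsJostSolution V (k : ℂ) y ∧ y 0 = 0

/-- `U` is the propagator `U t = exp (i t L)`: the strongly continuous one-parameter group of
bounded operators whose generator is `i L`. (Such a group is determined by `L`.) -/
structure IsPropagator (L : H →ₗ.[ℂ] H) (U : ℝ → H →L[ℂ] H) : Prop where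
  zero : U 0 = ContinuousLinearMap.id ℂ H
  add : ∀ s t, U (s + t) = (U s).comp (U t)
  continuous : ∀ f, Continuous fun t => U t f
  generator : ∀ f h : H,
    (f, h) ∈ L.graph ↔ HasDerivAt (fun t : ℝ => U t f) (Complex.I • h) 0

/-- `S` is the strong limit of the operators `T t` along the filter `l`. -/
def IsStrongLimit (T : ℝ → H →L[ℂ] H) (l : Filter ℝ) (S : H →L[ℂ] H) : Prop :=
  ∀ f, Tendsto (fun t => T t f) l (𝓝 (S f))

/-- The product `W L W'` of the unbounded operator `L` with bounded operators `W` and `W'`, on its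
natural domain `{f | W' f ∈ D(L)}`. -/
def sandwich (W : H →L[ℂ] H) (L : H →ₗ.[ℂ] H) (W' : H →L[ℂ] H) : H →ₗ.[ℂ] H where
  domain := L.domain.comap (W' : H →ₗ[ℂ] H)
  toFun := (W : H →ₗ[ℂ] H) ∘ₗ L.toFun ∘ₗ
    (W' : H →ₗ[ℂ] H).restrict (p := L.domain.comap (W' : H →ₗ[ℂ] H)) (q := L.domain)
      (fun _ hx => hx)

/-- `L = W L' W'`, where `W` and `W'` are bounded operators inverse to each other. -/
def ImplementsSimilarity (L : H →ₗ.[ℂ] H) (W : H →L[ℂ] H) (L' : H →ₗ.[ℂ] H) (W' : H →L[ℂ] H) :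
    Prop :=
  W.comp W' = ContinuousLinearMap.id ℂ H ∧ W'.comp W = ContinuousLinearMap.id ℂ H ∧
    L = sandwich W L' W'

end HalfLine

end

/-! The proof is Kato's theory of smooth perturbations, fed by explicit resolvent bounds for the
half-line. Write `V = A · (V/|V|) · A` with `A = |V|^{1/2}`. If `A` is smooth for the free group `G`
and for the perturbed groups with potentials `V` and `conj V`, meaning that `∫ ‖A U(t) f‖² dt ≤ D
‖f‖²` over the half-line, then Duhamel's formula and Cauchy–Schwarz show that `U(-t) G(t) f` and
`G(-t) U(t) f` are Cauchy. Their limits are bounded, inverse to each other, and intertwine the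
groups; differentiating the intertwining relation at time zero gives the similarity, domains
included.

Smoothness comes from a bound on `A (L_V - k²)⁻¹ A` uniform in `Im k > 0`. The kernel of the
resolvent is `φ(x) e(y) / e(0)` for `x ≤ y`, with `φ` the regular and `e` the Jost solution, and
symmetrically for `x ≥ y`. A zero of the Jost function is an eigenvalue if `Im k > 0` and a spectral
singularity if `k` is real, so there are none. Continuity on the closed half-plane and the limit 1
at infinity then bound it away from zero. The kernel is therefore at most a constant times `√(1+x)
√(1+y)`, and finiteness of `∫ (1+x)|V|` makes the compressed resolvent bounded
(`HasUniformSolutions.exists_norm_le`).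

For the unitary group, Plancherel turns this bound into smoothness. For the perturbed group only
exponential growth is known beforehand, and Plancherel is available only to the right of a growth
rate `ω`. It does give weighted smoothness with constants independent of `ω`. A Datko-type argument
then lowers the growth rate from `ω` to `(1 - θ) ω` with a fixed `θ`; iterating sends it to zero and
the weight disappears (`IsPerturbation.exists_integral_sq_le`).

The free group is built by a version of Stone's theorem, the perturbed one from the interaction
picture, and the two solutions from Volterra equations. Taking `c = ± I` throughout covers both
directions of time. -/

set_option linter.unusedSectionVars false

noncomputable section

namespace HalfLine

/-! ### The L² Fourier transform agrees with the Fourier integral -/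

section Plancherel

open scoped FourierTransform SchwartzMap

variable {E : Type*} [NormedAddCommGroup E] [InnerProductSpace ℂ E] [CompleteSpace E]

/-- The `L²` Fourier transform of an integrable function is given by the Fourier integral. -/
theorem coeFn_fourier_toLp {f : ℝ → E} (hf : Integrable f) (hf2 : MemLp f 2) :
    (𝓕 (hf2.toLp f) : Lp E 2 (volume : Measure ℝ)) =ᵐ[volume] 𝓕 f := by
  have hcont : Continuous (𝓕 f) := 
    VectorFourier.fourierIntegral_continuous Real.continuous_fourierChar (by fun_prop) hf
  refine ae_eq_of_integral_contDiff_smul_eq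
    ((Lp.memLp _).locallyIntegrable (by norm_num)) hcont.locallyIntegrable ?_
  intro g hg hgc
  -- Seen as a Schwartz function, the test function can be moved under the transform on both sides:
  -- on the left because the L² transform is the distributional one, on the right by Fubini. Both
  -- sides become `∫ 𝓕 φ • f`.
  let φ : 𝓢(ℝ, ℂ) := (hgc.comp_left (g := fun x : ℝ => (x : ℂ)) (by simp)).toSchwartzMap
    (Complex.ofRealCLM.contDiff.comp hg)
  have hφ : ∀ x, φ x = (g x : ℂ) := fun x => rfl
  have h1 := congrArg (fun T => T φ) (Lp.fourier_toTemperedDistribution_eq (hf2.toLp f))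
  simp only [TemperedDistribution.fourier_apply, Lp.toTemperedDistribution_apply] at h1
  have h2 : ∫ x, g x • (𝓕 (hf2.toLp f) : Lp E 2 (volume : Measure ℝ)) x
      = ∫ x, φ x • (𝓕 (hf2.toLp f) : Lp E 2 (volume : Measure ℝ)) x := by
    simp only [hφ, Complex.coe_smul]
  have h3 : ∫ x, g x • 𝓕 f x = ∫ x, φ x • 𝓕 f x := by
    simp only [hφ, Complex.coe_smul]
  rw [h2, h3, ← h1]
  have h4 : ∫ x, (𝓕 φ) x • (hf2.toLp f : Lp E 2 (volume : Measure ℝ)) x = ∫ x, (𝓕 φ) x • f x := by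
    refine integral_congr_ae ?_
    filter_upwards [hf2.coeFn_toLp] with x hx
    rw [hx]
  rw [h4]
  have := VectorFourier.integral_fourierIntegral_smul_eq_flip (μ := volume) (ν := volume)
    (L := innerₗ ℝ) (f := φ) (g := f) Real.continuous_fourierChar
    (by fun_prop) φ.integrable hf
  rw [flip_innerₗ] at this
  simp only [SchwartzMap.fourier_coe]
  exact this

theorem eLpNorm_fourier {f : ℝ → E} (hf : Integrable f) (hf2 : MemLp f 2) :
    eLpNorm (𝓕 f) 2 volume = eLpNorm f 2 volume := by
  have h := Lp.norm_fourier_eq (hf2.toLp f)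
  rw [Lp.norm_def, Lp.norm_def, ENNReal.toReal_eq_toReal_iff' (Lp.eLpNorm_ne_top _)
    (Lp.eLpNorm_ne_top _), eLpNorm_congr_ae (coeFn_fourier_toLp hf hf2),
    eLpNorm_congr_ae hf2.coeFn_toLp] at h
  exact h

end Plancherel

/-! ### One-parameter groups and bounded perturbations of unitary groups -/

section Groups

open scoped BoundedContinuousFunction

variable {E : Type*} [NormedAddCommGroup E] [InnerProductSpace ℂ E] [CompleteSpace E]

/-- Strongly continuous one-parameter groups with an exponential growth bound. -/
structure IsC0Group (G : ℝ → E →L[ℂ] E) : Prop where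
  zero : G 0 = ContinuousLinearMap.id ℂ E
  add : ∀ s t, G (s + t) = (G s).comp (G t)
  continuous : ∀ f, Continuous fun t => G t f
  growth : ∃ K M : ℝ, 0 ≤ K ∧ 0 ≤ M ∧ ∀ t f, ‖G t f‖ ≤ K * Real.exp (M * |t|) * ‖f‖

/-- Strongly continuous one-parameter groups of isometries. -/
structure IsUnitaryGroup (G : ℝ → E →L[ℂ] E) : Prop where
  zero : G 0 = ContinuousLinearMap.id ℂ E
  add : ∀ s t, G (s + t) = (G s).comp (G t)
  continuous : ∀ f, Continuous fun t => G t f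
  norm_map : ∀ t f, ‖G t f‖ = ‖f‖

variable {G U U' : ℝ → E →L[ℂ] E}

lemma IsUnitaryGroup.isC0Group (hG : IsUnitaryGroup G) : IsC0Group G :=
  ⟨hG.zero, hG.add, hG.continuous, 1, 0, zero_le_one, le_rfl, fun t f => by simp [hG.norm_map]⟩

namespace IsC0Group

lemma comp_neg (hG : IsC0Group G) : IsC0Group fun t => G (-t) := by
  refine ⟨by simp [hG.zero], fun s t => by rw [neg_add, hG.add],
    fun f => (hG.continuous f).comp continuous_neg, ?_⟩
  obtain ⟨K, M, hK, hM, h⟩ := hG.growth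
  exact ⟨K, M, hK, hM, fun t f => by simpa using h (-t) f⟩

lemma zero_apply (hG : IsC0Group G) (f : E) : G 0 f = f := by simp [hG.zero]

lemma add_apply (hG : IsC0Group G) (s t : ℝ) (f : E) : G (s + t) f = G s (G t f) := by
  simp [hG.add]

lemma neg_apply_apply (hG : IsC0Group G) (t : ℝ) (f : E) : G (-t) (G t f) = f := by
  rw [← hG.add_apply, neg_add_cancel, hG.zero_apply]

lemma apply_neg_apply (hG : IsC0Group G) (t : ℝ) (f : E) : G t (G (-t) f) = f := by
  rw [← hG.add_apply, add_neg_cancel, hG.zero_apply]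

/-- Strong continuity becomes joint continuity because the growth bound is locally uniform in time.
-/
lemma tendsto_apply (hG : IsC0Group G) {α : Type*} {l : Filter α} {a : α → ℝ} {x : α → E}
    {a₀ : ℝ} {x₀ : E} (ha : Tendsto a l (𝓝 a₀)) (hx : Tendsto x l (𝓝 x₀)) :
    Tendsto (fun s => G (a s) (x s)) l (𝓝 (G a₀ x₀)) := by
  obtain ⟨K, M, hK, hM, h⟩ := hG.growth
  have h1 : Tendsto (fun s => G (a s) x₀) l (𝓝 (G a₀ x₀)) :=
    ((hG.continuous x₀).tendsto a₀).comp ha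
  have h2 : Tendsto (fun s => G (a s) (x s - x₀)) l (𝓝 0) := by
    refine squeeze_zero_norm (fun s => h (a s) (x s - x₀)) ?_
    have h3 : Tendsto (fun s => K * Real.exp (M * |a s|) * ‖x s - x₀‖) l
        (𝓝 (K * Real.exp (M * |a₀|) * ‖x₀ - x₀‖)) := by
      refine Tendsto.mul ?_ (hx.sub_const x₀).norm
      exact ((Real.continuous_exp.tendsto _).comp (ha.abs.const_mul M)).const_mul K
    simpa using h3
  simpa using h1.add h2

lemma continuous_apply (hG : IsC0Group G) {α : Type*} [TopologicalSpace α] {a : α → ℝ} {x : α → E}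
    (ha : Continuous a) (hx : Continuous x) : Continuous fun s => G (a s) (x s) :=
  continuous_iff_continuousAt.2 fun s => hG.tendsto_apply (ha.tendsto s) (hx.tendsto s)

end IsC0Group

lemma IsUnitaryGroup.comp_neg (hG : IsUnitaryGroup G) : IsUnitaryGroup fun t => G (-t) :=
  ⟨by simp [hG.zero], fun s t => by rw [neg_add, hG.add],
    fun f => (hG.continuous f).comp continuous_neg, fun t f => hG.norm_map _ _⟩

lemma IsUnitaryGroup.inner_map (hG : IsUnitaryGroup G) (t : ℝ) (f g : E) :
    inner ℂ (G t f) (G t g) = inner ℂ f g :=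
  (LinearIsometry.mk (G t : E →ₗ[ℂ] E) (hG.norm_map t)).inner_map_map f g

lemma IsUnitaryGroup.inner_left (hG : IsUnitaryGroup G) (t : ℝ) (f g : E) :
    inner ℂ (G (-t) f) g = inner ℂ f (G t g) := by
  rw [← hG.inner_map t (G (-t) f), hG.isC0Group.apply_neg_apply]

/-- The generator is skew-symmetric, as `⟨G t x, G t y⟩` is constant in `t`. -/
lemma IsUnitaryGroup.inner_generator (hG : IsUnitaryGroup G) {x y x' y' : E}
    (hx : HasDerivAt (fun t => G t x) x' 0) (hy : HasDerivAt (fun t => G t y) y' 0) :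
    inner ℂ x y' = - inner ℂ x' y := by
  have h1 := hx.inner ℂ hy
  have h2 : HasDerivAt (fun t => inner ℂ (G t x) (G t y)) (0 : ℂ) 0 := by
    simp only [hG.inner_map]
    exact hasDerivAt_const _ _
  have := h1.unique h2
  simp only [hG.zero, ContinuousLinearMap.id_apply] at this
  exact eq_neg_of_add_eq_zero_left this

/-- `U` is the one-parameter group whose generator is the generator of `G` plus the bounded
operator `Q`. -/
structure IsPerturbation (G : ℝ → E →L[ℂ] E) (Q : E →L[ℂ] E) (U : ℝ → E →L[ℂ] E) : Prop where
  isC0Group : IsC0Group U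
  deriv : ∀ t f, HasDerivAt (fun s => G (-s) (U s f)) (G (-t) (Q (U t f))) t

lemma IsPerturbation.comp_neg {Q : E →L[ℂ] E} (h : IsPerturbation G Q U) :
    IsPerturbation (fun t => G (-t)) (-Q) (fun t => U (-t)) := by
  refine ⟨h.isC0Group.comp_neg, fun t f => ?_⟩
  have := HasDerivAt.scomp (h := fun s : ℝ => -s) t (h.deriv (-t) f) (hasDerivAt_neg t)
  simpa [Function.comp_def] using this

/-- With `Q' = -Q*` the pairing `⟨U t f, U' t g⟩` is constant, so `U' (-t)` is the adjoint of `U t`.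
Conjugating by `G (-s)` makes both factors differentiable for all `f` and `g`, without domain
conditions. -/
lemma IsPerturbation.inner_left (hG : IsUnitaryGroup G) {Q Q' : E →L[ℂ] E}
    (h : IsPerturbation G Q U) (h' : IsPerturbation G Q' U')
    (hQ : ∀ x y, inner ℂ (Q x) y = - inner ℂ x (Q' y)) (t : ℝ) (f g : E) :
    inner ℂ (U t f) g = inner ℂ f (U' (-t) g) := by
  have key : ∀ g, inner ℂ (U t f) (U' t g) = inner ℂ f g := by
    intro g
    have hd : ∀ s, HasDerivAt (fun s => inner ℂ (G (-s) (U s f)) (G (-s) (U' s g))) (0 : ℂ) s := by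
      intro s
      have := (h.deriv s f).inner ℂ (h'.deriv s g)
      rwa [hG.inner_map, hG.inner_map, hQ, add_neg_cancel] at this
    have hc := is_const_of_deriv_eq_zero (fun s => (hd s).differentiableAt)
      (fun s => (hd s).deriv) t 0
    simpa [hG.inner_map, hG.zero, h.isC0Group.zero, h'.isC0Group.zero] using hc
  rw [← key, h'.isC0Group.apply_neg_apply]

/-- For every `f`, in the domain or not, `U t f - G t f` has derivative `Q f` at zero. Hence the
generators have the same domain and differ by `Q`. -/
lemma IsPerturbation.hasDerivAt_iff (hG : IsUnitaryGroup G) {Q : E →L[ℂ] E}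
    (h : IsPerturbation G Q U) {f g : E} :
    HasDerivAt (fun t => U t f) g 0 ↔ HasDerivAt (fun t => G t f) (g - Q f) 0 := by
  have key : HasDerivAt (fun t => U t f - G t f) (Q f) 0 := by
    have h0 := h.deriv 0 f
    simp only [neg_zero, hG.zero, h.isC0Group.zero, ContinuousLinearMap.id_apply] at h0
    rw [hasDerivAt_iff_tendsto_slope_zero] at h0 ⊢
    have h1 := hG.isC0Group.tendsto_apply (a := fun t : ℝ => t) (tendsto_id.mono_left
      nhdsWithin_le_nhds) h0
    simp only [hG.zero, ContinuousLinearMap.id_apply] at h1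
    refine h1.congr fun t => ?_
    simp only [zero_add, hG.zero, h.isC0Group.zero, ContinuousLinearMap.id_apply, neg_zero,
      sub_self, sub_zero]
    rw [ContinuousLinearMap.map_smul_of_tower, map_sub, hG.isC0Group.apply_neg_apply]
  constructor
  · intro hU
    refine (hU.sub key).congr_of_eventuallyEq (Eventually.of_forall fun t => ?_)
    simp
  · intro hU
    refine ((hU.add key).congr_of_eventuallyEq (Eventually.of_forall fun t => ?_)).congr_deriv ?_
    · simp
    · simp

lemma abs_integral_exp_abs_le {c : ℝ} (hc : 0 < c) (t : ℝ) :
    |∫ s in (0 : ℝ)..t, Real.exp (c * |s|)| ≤ Real.exp (c * |t|) / c := by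
  have key : ∀ t : ℝ, 0 ≤ t →
      |∫ s in (0 : ℝ)..t, Real.exp (c * |s|)| ≤ Real.exp (c * |t|) / c := by
    intro t ht
    have h1 : ∫ s in (0 : ℝ)..t, Real.exp (c * |s|) = ∫ s in (0 : ℝ)..t, Real.exp (c * s) := by
      refine intervalIntegral.integral_congr fun s hs => ?_
      rw [uIcc_of_le ht] at hs
      simp only [abs_of_nonneg hs.1]
    rw [h1, intervalIntegral.integral_comp_mul_left (fun x => Real.exp x) hc.ne', integral_exp,
      abs_of_nonneg ht, smul_eq_mul, abs_of_nonneg]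
    · rw [inv_mul_eq_div]
      gcongr
      simp
    · have : Real.exp (c * 0) ≤ Real.exp (c * t) := by gcongr
      have := sub_nonneg.2 this
      positivity
  rcases le_total 0 t with ht | ht
  · exact key t ht
  · have := key (-t) (by linarith)
    rw [abs_neg] at this
    have e := intervalIntegral.integral_comp_neg (a := t) (b := 0) fun s => Real.exp (c * |s|)
    simp only [abs_neg, neg_zero] at e
    rwa [← e, intervalIntegral.integral_symm, abs_neg] at this

lemma exists_rightInverse_one_sub {F : Type*} [NormedAddCommGroup F] [NormedSpace ℂ F]
    [CompleteSpace F] {Φ : F →L[ℂ] F} (hΦ : ‖Φ‖ < 1) : ∃ Ψ : F →L[ℂ] F, ∀ x, Ψ x - Φ (Ψ x) = x := by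
  obtain ⟨Ψ, hΨ⟩ := (isUnit_one_sub_of_norm_lt_one hΦ).exists_right_inv
  exact ⟨Ψ, fun x => by simpa using congrArg (fun T => T x) hΨ⟩

section Construction

variable (Q : E →L[ℂ] E)

lemma IsUnitaryGroup.continuous_interaction (hG : IsUnitaryGroup G) {x : ℝ → E}
    (hx : Continuous x) : Continuous fun s => G (-s) (Q (G s (x s))) :=
  hG.isC0Group.continuous_apply continuous_neg
    (Q.continuous.comp (hG.isC0Group.continuous_apply continuous_id hx))

/-- The weight `exp (-c|t|)` makes the Dyson integral a contraction on the whole line: integrating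
`exp (c|s|)` costs `exp (c|t|) / c`, which leaves the factor `‖Q‖ / c ≤ 1/2`. -/
lemma norm_dyson_integral_le (hG : IsUnitaryGroup G) {c : ℝ} (hc : 0 < c) (hQ : 2 * ‖Q‖ ≤ c)
    (n : ℝ →ᵇ E) (t : ℝ) : ‖Real.exp (-(c * |t|)) •
      ∫ s in (0 : ℝ)..t, G (-s) (Q (G s (Real.exp (c * |s|) • n s)))‖ ≤ 1 / 2 * ‖n‖ := by
  have h1 : ‖∫ s in (0 : ℝ)..t, G (-s) (Q (G s (Real.exp (c * |s|) • n s)))‖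
      ≤ |∫ s in (0 : ℝ)..t, (‖Q‖ * ‖n‖) * Real.exp (c * |s|)| := by
    refine intervalIntegral.norm_integral_le_abs_of_norm_le (Eventually.of_forall fun s => ?_)
      (Continuous.intervalIntegrable (by fun_prop) _ _)
    rw [hG.norm_map]
    refine (Q.le_opNorm _).trans ?_
    rw [hG.norm_map, norm_smul, Real.norm_eq_abs, Real.abs_exp]
    have := n.norm_coe_le_norm s
    calc ‖Q‖ * (Real.exp (c * |s|) * ‖n s‖) ≤ ‖Q‖ * (Real.exp (c * |s|) * ‖n‖) := by gcongr
      _ = _ := by ring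
  rw [intervalIntegral.integral_const_mul, abs_mul, abs_of_nonneg (by positivity)] at h1
  have h2 := abs_integral_exp_abs_le hc t
  rw [norm_smul, Real.norm_eq_abs, Real.abs_exp]
  calc Real.exp (-(c * |t|)) * _
      ≤ Real.exp (-(c * |t|)) * (‖Q‖ * ‖n‖ * (Real.exp (c * |t|) / c)) := by
        gcongr
        exact h1.trans (mul_le_mul_of_nonneg_left h2 (by positivity))
    _ = (Real.exp (-(c * |t|)) * Real.exp (c * |t|)) * (‖Q‖ / c) * ‖n‖ := by ring
    _ = ‖Q‖ / c * ‖n‖ := by rw [← Real.exp_add]; simp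
    _ ≤ 1 / 2 * ‖n‖ := by
        have : ‖Q‖ / c ≤ 1 / 2 := by
          rw [div_le_div_iff₀ hc two_pos]
          linarith
        gcongr

/-- The integral operator of the interaction picture equation, with exponential weights. -/
def dysonMap (hG : IsUnitaryGroup G) {c : ℝ} (hc : 0 < c) (hQ : 2 * ‖Q‖ ≤ c) :
    (ℝ →ᵇ E) →L[ℂ] (ℝ →ᵇ E) :=
  have hcont : ∀ n : ℝ →ᵇ E, Continuous fun s =>
      G (-s) (Q (G s (Real.exp (c * |s|) • n s))) := fun n =>
    hG.continuous_interaction Q (by fun_prop)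
  have hcont' : ∀ n : ℝ →ᵇ E, Continuous fun t => Real.exp (-(c * |t|)) •
      ∫ s in (0 : ℝ)..t, G (-s) (Q (G s (Real.exp (c * |s|) • n s))) := fun n => by
    have h1 : Continuous fun t : ℝ => Real.exp (-(c * |t|)) := by fun_prop
    exact h1.smul
      (intervalIntegral.continuous_primitive (fun a b => (hcont n).intervalIntegrable a b) 0)
  LinearMap.mkContinuous
    { toFun := fun n => BoundedContinuousFunction.ofNormedAddCommGroup
        (fun t => Real.exp (-(c * |t|)) •
          ∫ s in (0 : ℝ)..t, G (-s) (Q (G s (Real.exp (c * |s|) • n s))))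
        (hcont' n)
        (1 / 2 * ‖n‖)
        (norm_dyson_integral_le Q hG hc hQ n)
      map_add' := by
        intro n m
        ext t
        simp only [BoundedContinuousFunction.coe_ofNormedAddCommGroup,
          BoundedContinuousFunction.coe_add, Pi.add_apply, smul_add, map_add]
        rw [intervalIntegral.integral_add ((hcont n).intervalIntegrable _ _)
          ((hcont m).intervalIntegrable _ _), smul_add]
      map_smul' := by
        intro k n
        ext t
        simp only [BoundedContinuousFunction.coe_ofNormedAddCommGroup,
          BoundedContinuousFunction.coe_smul, RingHom.id_apply]
        simp_rw [smul_comm _ k, map_smul]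
        rw [intervalIntegral.integral_smul, smul_comm] } (1 / 2)
    fun n => BoundedContinuousFunction.norm_ofNormedAddCommGroup_le _ (by positivity)
      (norm_dyson_integral_le Q hG hc hQ n)

lemma norm_dysonMap_le (hG : IsUnitaryGroup G) {c : ℝ} (hc : 0 < c) (hQ : 2 * ‖Q‖ ≤ c) :
    ‖dysonMap Q hG hc hQ‖ ≤ 1 / 2 :=
  ContinuousLinearMap.opNorm_le_bound _ (by norm_num) fun n =>
    BoundedContinuousFunction.norm_ofNormedAddCommGroup_le _ (by positivity)
      (norm_dyson_integral_le Q hG hc hQ n)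

/-- In the interaction picture `W t = G (-t) (U t)` the equation has the bounded coefficient `G (-t)
Q G t`, so the unbounded generator never appears. -/
lemma exists_interaction (hG : IsUnitaryGroup G) :
    ∃ (W : ℝ → E →L[ℂ] E) (K M : ℝ), 0 ≤ K ∧ 0 ≤ M ∧
      (∀ t f, ‖W t f‖ ≤ K * Real.exp (M * |t|) * ‖f‖) ∧
      (∀ f, W 0 f = f) ∧ ∀ f t, HasDerivAt (fun s => W s f) (G (-t) (Q (G t (W t f)))) t := by
  -- The summand 1 keeps `c` positive when `Q = 0`.
  set c := 2 * ‖Q‖ + 1 with hcdef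
  have hc : 0 < c := by positivity
  have hQ : 2 * ‖Q‖ ≤ c := by linarith
  set Φ := dysonMap Q hG hc hQ with hΦ
  have hΦn : ‖Φ‖ < 1 := 
    lt_of_le_of_lt (norm_dysonMap_le Q hG hc hQ) (by norm_num)
  obtain ⟨Ψ, hΨ⟩ := exists_rightInverse_one_sub hΦn
  have hbd : ∀ (f : E) (t : ℝ), ‖Real.exp (-(c * |t|)) • f‖ ≤ 1 * ‖f‖ := by
    intro f t
    rw [norm_smul, Real.norm_eq_abs, Real.abs_exp]
    gcongr
    rw [Real.exp_le_one_iff]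
    have := mul_nonneg hc.le (abs_nonneg t)
    linarith
  let ι : E →L[ℂ] (ℝ →ᵇ E) := LinearMap.mkContinuous
    { toFun := fun f => BoundedContinuousFunction.ofNormedAddCommGroup
        (fun t => Real.exp (-(c * |t|)) • f) (by fun_prop) (1 * ‖f‖) (hbd f)
      map_add' := by intro f g; ext t; simp
      map_smul' := by intro k f; ext t; exact smul_comm _ _ _ } 1
    fun f => BoundedContinuousFunction.norm_ofNormedAddCommGroup_le _ (by positivity) (hbd f)
  have hι : ∀ f t, ι f t = Real.exp (-(c * |t|)) • f := fun f t => rfl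
  have hΦa : ∀ n t, Φ n t = Real.exp (-(c * |t|)) •
      ∫ s in (0 : ℝ)..t, G (-s) (Q (G s (Real.exp (c * |s|) • n s))) := fun n t => rfl
  let n : E → (ℝ →ᵇ E) := fun f => Ψ (ι f)
  have hn : ∀ f t, Real.exp (c * |t|) • n f t =
      f + ∫ s in (0 : ℝ)..t, G (-s) (Q (G s (Real.exp (c * |s|) • n f s))) := by
    intro f t
    have h1 := congrArg (fun n => n t) (hΨ (ι f))
    simp only [BoundedContinuousFunction.coe_sub, Pi.sub_apply, hι, hΦa] at h1
    rw [sub_eq_iff_eq_add] at h1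
    change Real.exp (c * |t|) • (Ψ (ι f)) t = _
    rw [h1, smul_add, smul_smul, smul_smul, ← Real.exp_add, add_neg_cancel, Real.exp_zero,
      one_smul, one_smul]
  let W : ℝ → E →L[ℂ] E := fun t => Real.exp (c * |t|) •
    ((BoundedContinuousFunction.evalCLM ℂ t).comp (Ψ.comp ι))
  have hW : ∀ t f, W t f = Real.exp (c * |t|) • n f t := fun t f => rfl
  refine ⟨W, ‖Ψ.comp ι‖, c, by positivity, hc.le, ?_, ?_, ?_⟩
  · intro t f
    rw [hW, norm_smul, Real.norm_eq_abs, Real.abs_exp]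
    calc Real.exp (c * |t|) * ‖n f t‖ ≤ Real.exp (c * |t|) * (‖Ψ.comp ι‖ * ‖f‖) := by
          gcongr
          exact ((n f).norm_coe_le_norm t).trans ((Ψ.comp ι).le_opNorm f)
      _ = _ := by ring
  · intro f
    rw [hW, hn]
    simp
  · intro f t
    simp only [hW]
    have hcont : Continuous fun s =>
        G (-s) (Q (G s (Real.exp (c * |s|) • n f s))) :=
      hG.continuous_interaction Q (by fun_prop)
    have h1 := (hcont.integral_hasStrictDerivAt 0 t).hasDerivAt.const_add f
    refine h1.congr_of_eventuallyEq (Eventually.of_forall fun s => ?_)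
    exact hn f s

lemma interaction_unique (hG : IsUnitaryGroup G) {x y : ℝ → E}
    (hx : ∀ t, HasDerivAt x (G (-t) (Q (G t (x t)))) t)
    (hy : ∀ t, HasDerivAt y (G (-t) (Q (G t (y t)))) t) (h0 : x 0 = y 0) : x = y := by
  refine ODE_solution_unique_univ (v := fun t x => G (-t) (Q (G t x))) (s := fun _ => univ)
    (K := ‖Q‖₊) (t₀ := 0) (fun t => ?_) (fun t => ⟨hx t, mem_univ _⟩) (fun t => ⟨hy t, mem_univ _⟩)
    h0
  refine (LipschitzWith.of_dist_le_mul fun u v => ?_).lipschitzOnWith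
  rw [dist_eq_norm, ← map_sub, ← map_sub, ← map_sub, hG.norm_map, dist_eq_norm]
  refine (Q.le_opNorm _).trans ?_
  rw [hG.norm_map]
  rfl

theorem exists_perturbation (hG : IsUnitaryGroup G) : ∃ U, IsPerturbation G Q U := by
  obtain ⟨W, K, M, hK, hM, hb, h0, hd⟩ := exists_interaction Q hG
  have hc : ∀ f, Continuous fun t => W t f := fun f =>
    continuous_iff_continuousAt.2 fun t => (hd f t).continuousAt
  refine ⟨fun t => (G t).comp (W t), ⟨?_, ?_, ?_, K, M, hK, hM, ?_⟩, ?_⟩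
  · ext f
    simp [h0, hG.zero]
  · intro s t
    ext f
    -- This cocycle identity is the group law of `G t (W t)`. Both sides solve the same linear
    -- equation with the same value at `s = 0`.
    have key : (fun s => G t (W (s + t) f)) = fun s => W s (G t (W t f)) := by
      refine interaction_unique Q hG (fun s => ?_) (fun s => hd _ s) (by simp [h0])
      have h1 : HasDerivAt (fun s => W (s + t) f) _ s := (hd f (s + t)).comp_add_const s t
      have h2 := ((G t).restrictScalars ℝ).hasFDerivAt.comp_hasDerivAt s h1
      refine h2.congr_deriv ?_
      simp only [ContinuousLinearMap.coe_restrictScalars']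
      rw [← hG.isC0Group.add_apply, ← hG.isC0Group.add_apply]
      congr 3
      ring
    have := congrFun key s
    simp only [ContinuousLinearMap.comp_apply]
    rw [← this, ← hG.isC0Group.add_apply]
  · intro f
    exact hG.isC0Group.continuous_apply continuous_id (hc f)
  · intro t f
    simp only [ContinuousLinearMap.comp_apply, hG.norm_map]
    exact hb t f
  · intro t f
    simp only [ContinuousLinearMap.comp_apply, hG.isC0Group.neg_apply_apply]
    exact hd f t

end Construction

end Groups

/-! ### Laplace transforms of groups as resolvents -/

section Laplace

open scoped FourierTransform ComplexConjugate

variable {E : Type*} [NormedAddCommGroup E] [InnerProductSpace ℂ E] [CompleteSpace E]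

lemma lintegral_enorm_sq_eq {α F : Type*} [MeasurableSpace α] [NormedAddCommGroup F]
    (μ : Measure α) (f : α → F) : ∫⁻ x, ‖f x‖ₑ ^ 2 ∂μ = eLpNorm f 2 μ ^ 2 := by
  have := eLpNorm_nnreal_pow_eq_lintegral (f := f) (μ := μ) (p := 2) two_ne_zero
  simpa using this.symm

theorem lintegral_fourier {f : ℝ → E} (hf : Integrable f) (hf2 : MemLp f 2) :
    ∫⁻ x, ‖𝓕 f x‖ₑ ^ 2 = ∫⁻ x, ‖f x‖ₑ ^ 2 := by
  rw [lintegral_enorm_sq_eq, lintegral_enorm_sq_eq, eLpNorm_fourier hf hf2]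

lemma memLp_two_of_norm_le_exp {f : ℝ → E} {s : Set ℝ} (hs : MeasurableSet s)
    (hf : AEStronglyMeasurable f (volume.restrict s)) {C : ℝ} {r : ℝ → ℝ}
    (h : ∀ t ∈ s, ‖f t‖ ≤ C * Real.exp (r t)) (hr : IntegrableOn (fun t => Real.exp (2 * r t)) s) :
    MemLp f 2 (volume.restrict s) := by
  rw [memLp_two_iff_integrable_sq_norm hf]
  refine (hr.const_mul (C ^ 2)).mono' (hf.norm.pow 2) ?_
  refine (ae_restrict_iff' hs).2 (Eventually.of_forall fun t ht => ?_)
  rw [Real.norm_eq_abs, abs_of_nonneg (by positivity)]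
  calc ‖f t‖ ^ 2 ≤ (C * Real.exp (r t)) ^ 2 := by gcongr; exact h t ht
    _ = _ := by rw [mul_pow, ← Real.exp_nat_mul]; simp

/-- The Laplace transform of a one-parameter group. -/
def laplace (U : ℝ → E →L[ℂ] E) (p : ℂ) (f : E) : E :=
  ∫ t in Ioi (0 : ℝ), Complex.exp (-(p * t)) • U t f

/-- `ω` is an exponential growth rate of `U` at `+∞`. -/
def HasGrowth (U : ℝ → E →L[ℂ] E) (ω : ℝ) : Prop :=
  ∃ K : ℝ, 0 ≤ K ∧ ∀ t, 0 ≤ t → ∀ f, ‖U t f‖ ≤ K * Real.exp (ω * t) * ‖f‖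

lemma IsUnitaryGroup.hasGrowth {G : ℝ → E →L[ℂ] E} (hG : IsUnitaryGroup G) : HasGrowth G 0 :=
  ⟨1, zero_le_one, fun t _ f => by simp [hG.norm_map]⟩

variable {G U : ℝ → E →L[ℂ] E} {ω : ℝ} {p : ℂ}

lemma IsC0Group.continuous_exp_smul (hU : IsC0Group U) (p : ℂ) (f : E) :
    Continuous fun t : ℝ => Complex.exp (-(p * t)) • U t f :=
  Continuous.smul (by fun_prop) (hU.continuous f)

lemma HasGrowth.norm_exp_smul_le (h : HasGrowth U ω) (p : ℂ) :
    ∃ K : ℝ, 0 ≤ K ∧ ∀ t : ℝ, 0 ≤ t → ∀ f,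
      ‖Complex.exp (-(p * t)) • U t f‖ ≤ K * ‖f‖ * Real.exp ((ω - p.re) * t) := by
  obtain ⟨K, hK, h⟩ := h
  refine ⟨K, hK, fun t ht f => ?_⟩
  rw [norm_smul, Complex.norm_exp]
  have h1 : (-(p * t)).re = -(p.re * t) := by simp
  rw [h1]
  calc Real.exp (-(p.re * t)) * ‖U t f‖
      ≤ Real.exp (-(p.re * t)) * (K * Real.exp (ω * t) * ‖f‖) := by gcongr; exact h t ht f
    _ = K * ‖f‖ * (Real.exp (-(p.re * t)) * Real.exp (ω * t)) := by ring
    _ = _ := by rw [← Real.exp_add]; ring_nf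

lemma IsC0Group.integrableOn_laplace (hU : IsC0Group U) (h : HasGrowth U ω) (hp : ω < p.re)
    (f : E) : IntegrableOn (fun t : ℝ => Complex.exp (-(p * t)) • U t f) (Ioi 0) := by
  obtain ⟨K, -, hK⟩ := h.norm_exp_smul_le p
  refine ((integrableOn_exp_mul_Ioi (a := ω - p.re) (by linarith) 0).const_mul (K * ‖f‖)).mono'
    (hU.continuous_exp_smul p f).aestronglyMeasurable ?_
  exact (ae_restrict_iff' measurableSet_Ioi).2
    (Eventually.of_forall fun t ht => hK t (le_of_lt ht) f)

lemma IsC0Group.memLp_laplace (hU : IsC0Group U) (h : HasGrowth U ω) (hp : ω < p.re)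
    (f : E) : MemLp (fun t : ℝ => Complex.exp (-(p * t)) • U t f) 2 (volume.restrict (Ioi 0)) := by
  obtain ⟨K, -, hK⟩ := h.norm_exp_smul_le p
  refine memLp_two_of_norm_le_exp (C := K * ‖f‖) (r := fun t => (ω - p.re) * t) measurableSet_Ioi
    (hU.continuous_exp_smul p f).aestronglyMeasurable (fun t ht => hK t (le_of_lt ht) f) ?_
  have := integrableOn_exp_mul_Ioi (a := 2 * (ω - p.re)) (by linarith) 0
  simpa only [mul_assoc] using this

/-- Applying `U s` shifts the integral to `e^{ps} ∫_s^∞`, which is differentiable in `s`. With `Z`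
the generator this says `(p - Z) (laplace U p f) = f`. -/
lemma IsC0Group.hasDerivAt_laplace (hU : IsC0Group U) (h : HasGrowth U ω) (hp : ω < p.re)
    (f : E) : HasDerivAt (fun s => U s (laplace U p f)) (p • laplace U p f - f) 0 := by
  set F : ℝ → E := fun t => Complex.exp (-(p * t)) • U t f with hF
  have hFc : Continuous F := hU.continuous_exp_smul p f
  have hFi : IntegrableOn F (Ioi 0) := hU.integrableOn_laplace h hp f
  have key : ∀ s : ℝ, U s (laplace U p f) =
      Complex.exp (p * s) • (laplace U p f - ∫ t in (0 : ℝ)..s, F t) := by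
    intro s
    have h1 : U s (laplace U p f) = ∫ t in Ioi (0 : ℝ), Complex.exp (p * s) • F (t + s) := by
      rw [laplace, ← ContinuousLinearMap.integral_comp_comm _ hFi]
      refine integral_congr_ae (Eventually.of_forall fun t => ?_)
      simp only [hF, map_smul, smul_smul, ← Complex.exp_add, ← hU.add_apply]
      push_cast
      ring_nf
    have hFi' : IntegrableOn F (Ioi s) := by
      rcases le_total 0 s with hs | hs
      · exact hFi.mono_set (Ioi_subset_Ioi hs)
      · rw [← Ioc_union_Ioi_eq_Ioi hs]
        exact ((hFc.intervalIntegrable s 0).1).union hFi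
    have h2 : ∫ t in Ioi (0 : ℝ), F (t + s) = ∫ t in Ioi s, F t := by
      have := (measurePreserving_add_right volume s).setIntegral_preimage_emb
        (measurableEmbedding_addRight s) F (Ioi s)
      simpa using this
    rw [h1, integral_smul, h2]
    congr 1
    rw [eq_sub_iff_add_eq', intervalIntegral.integral_interval_add_Ioi hFi hFi']
    rfl
  have h1 : HasDerivAt (fun s : ℝ => laplace U p f - ∫ t in (0 : ℝ)..s, F t) (-F 0) 0 :=
    ((hFc.integral_hasStrictDerivAt 0 0).hasDerivAt).const_sub _
  have h2 : HasDerivAt (fun s : ℝ => Complex.exp (p * s)) p 0 := by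
    have := ((hasDerivAt_id (0 : ℝ)).ofReal_comp.const_mul p).cexp
    simpa using this
  have h3 := h2.smul h1
  refine (h3.congr_of_eventuallyEq (Eventually.of_forall key)).congr_deriv ?_
  simp [hF, hU.zero_apply]
  abel

/-- Along the line `Re p = ε` the Laplace transform is the Fourier transform of the damped orbit cut
off at positive times; Plancherel therefore links resolvent bounds to time integrals. -/
lemma fourier_indicator_Ioi (hU : IsC0Group U) (h : HasGrowth U ω) {ε : ℝ} (hε : ω < ε)
    (T : E →L[ℂ] E) (f : E) (ξ : ℝ) :
    𝓕 ((Ioi (0 : ℝ)).indicator fun t => Complex.exp (-((ε : ℂ) * t)) • T (U t f)) ξ =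
      T (laplace U (ε + 2 * Real.pi * ξ * Complex.I) f) := by
  rw [Real.fourier_real_eq_integral_exp_smul, laplace, ← ContinuousLinearMap.integral_comp_comm _
    (hU.integrableOn_laplace h (by simpa using hε) f), ← integral_indicator measurableSet_Ioi]
  refine integral_congr_ae (Eventually.of_forall fun t => ?_)
  by_cases ht : t ∈ Ioi (0 : ℝ)
  · simp only [indicator_of_mem ht, map_smul, smul_smul, ← Complex.exp_add]
    congr 2
    push_cast
    ring
  · simp only [indicator_of_notMem ht, smul_zero]

lemma lintegral_laplace (hU : IsC0Group U) (h : HasGrowth U ω) {ε : ℝ} (hε : ω < ε)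
    (T : E →L[ℂ] E) (f : E) :
    ∫⁻ ξ : ℝ, ‖T (laplace U (ε + 2 * Real.pi * ξ * Complex.I) f)‖ₑ ^ 2 =
      ∫⁻ t in Ioi (0 : ℝ), ‖Complex.exp (-((ε : ℂ) * t)) • T (U t f)‖ₑ ^ 2 := by
  have e : (fun t : ℝ => Complex.exp (-((ε : ℂ) * t)) • T (U t f)) =
      fun t : ℝ => T (Complex.exp (-((ε : ℂ) * t)) • U t f) := by
    ext t
    rw [map_smul]
  have h1 : Integrable ((Ioi (0 : ℝ)).indicator fun t => Complex.exp (-((ε : ℂ) * t)) •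
      T (U t f)) := by
    rw [integrable_indicator_iff measurableSet_Ioi, e]
    exact T.integrable_comp (hU.integrableOn_laplace h (by simpa using hε) f)
  have h2 : MemLp ((Ioi (0 : ℝ)).indicator fun t => Complex.exp (-((ε : ℂ) * t)) •
      T (U t f)) 2 := by
    rw [memLp_indicator_iff_restrict measurableSet_Ioi, e]
    exact T.comp_memLp' (hU.memLp_laplace h (by simpa using hε) f)
  have h3 := lintegral_fourier h1 h2
  simp_rw [fourier_indicator_Ioi hU h hε] at h3
  rw [h3, ← lintegral_indicator measurableSet_Ioi]
  refine lintegral_congr fun t => ?_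
  by_cases ht : t ∈ Ioi (0 : ℝ)
  · simp only [indicator_of_mem ht]
  · simp only [indicator_of_notMem ht]
    simp

lemma integrableOn_Iic_of_comp_neg {F' : Type*} [NormedAddCommGroup F'] {F : ℝ → F'}
    (hF' : IntegrableOn (fun t => F (-t)) (Ioi 0)) : IntegrableOn F (Iic 0) := by
  rw [integrableOn_Iic_iff_integrableOn_Iio]
  have := ((Measure.measurePreserving_neg (volume : Measure ℝ)).integrableOn_comp_preimage
    (MeasurableEquiv.neg ℝ).measurableEmbedding (f := F) (s := Iio 0)).1
  refine this ?_
  simpa [Function.comp_def] using hF'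

lemma integral_eq_add_integral_comp_neg {F : ℝ → E} (hF : IntegrableOn F (Ioi 0))
    (hF' : IntegrableOn (fun t => F (-t)) (Ioi 0)) :
    ∫ t, F t = ∫ t in Ioi (0 : ℝ), (F t + F (-t)) := by
  rw [integral_add hF hF', integral_comp_neg_Ioi, neg_zero, add_comm, ← setIntegral_union
    (Iic_disjoint_Ioi le_rfl) measurableSet_Ioi (integrableOn_Iic_of_comp_neg hF') hF,
    Iic_union_Ioi, setIntegral_univ]

end Laplace

/-! ### Smoothness for unitary groups from a resolvent bound -/

section Smooth

open scoped FourierTransform ComplexConjugate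

variable {E : Type*} [NormedAddCommGroup E] [InnerProductSpace ℂ E] [CompleteSpace E]
variable {G U : ℝ → E →L[ℂ] E}

lemma integrable_exp_neg_mul_abs {c : ℝ} (hc : 0 < c) :
    Integrable fun t : ℝ => Real.exp (-(c * |t|)) := by
  have h := integrableOn_exp_mul_Ioi (a := -c) (by linarith) 0
  have h1 : IntegrableOn (fun t : ℝ => Real.exp (-(c * |t|))) (Ioi 0) := by
    refine h.congr_fun (fun t ht => ?_) measurableSet_Ioi
    simp only [abs_of_pos (show 0 < t from ht), neg_mul]
  rw [← integrableOn_univ, ← Iic_union_Ioi (a := (0 : ℝ))]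
  exact (integrableOn_Iic_of_comp_neg (by simpa using h1)).union h1

/-- Plancherel for the orbit on the whole line, damped by `exp (-ε|t|)`. Negative times contribute
the reversed group at the conjugate point, so that the sum is of the form `R + R*`. -/
lemma IsUnitaryGroup.lintegral_two_sided (hG : IsUnitaryGroup G) {ε : ℝ} (hε : 0 < ε)
    (T : E →L[ℂ] E) (f : E) :
    ∫⁻ ξ : ℝ, ‖T (laplace G (ε + 2 * Real.pi * ξ * Complex.I) f +
        laplace (fun t => G (-t)) (ε - 2 * Real.pi * ξ * Complex.I) f)‖ₑ ^ 2 =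
      ∫⁻ t : ℝ, ‖Complex.exp (-((ε : ℂ) * |t|)) • T (G t f)‖ₑ ^ 2 := by
  set ψ : ℝ → E := fun t => Complex.exp (-((ε : ℂ) * |t|)) • T (G t f) with hψ
  have hc : Continuous ψ := by
    refine Continuous.smul ?_ (T.continuous.comp (hG.continuous f))
    have : Continuous fun t : ℝ => ((|t| : ℝ) : ℂ) := Complex.continuous_ofReal.comp continuous_abs
    fun_prop
  have hb : ∀ t, ‖ψ t‖ ≤ ‖T‖ * ‖f‖ * Real.exp (-(ε * |t|)) := by
    intro t
    have h1 : (-((ε : ℂ) * |t|)).re = -(ε * |t|) := by simp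
    rw [hψ, norm_smul, Complex.norm_exp, h1, mul_comm]
    gcongr
    refine (T.le_opNorm _).trans ?_
    rw [hG.norm_map]
  have h1 : Integrable ψ := ((integrable_exp_neg_mul_abs hε).const_mul _).mono'
    hc.aestronglyMeasurable (Eventually.of_forall hb)
  have h2 : MemLp ψ 2 := by
    have h3 : IntegrableOn (fun t : ℝ => Real.exp (2 * -(ε * |t|))) univ := by
      rw [integrableOn_univ]
      refine (integrable_exp_neg_mul_abs (c := 2 * ε) (by linarith)).congr
        (Eventually.of_forall fun t => ?_)
      ring_nf
    have := memLp_two_of_norm_le_exp (f := ψ) MeasurableSet.univ hc.aestronglyMeasurable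
      (fun t _ => hb t) h3
    simpa using this
  rw [← lintegral_fourier h1 h2]
  refine lintegral_congr fun ξ => ?_
  congr 2
  have hp : ∀ z : ℂ, z.re = 0 → (0 : ℝ) < (ε + z).re ∧ (0 : ℝ) < (ε - z).re := by
    intro z hz
    simp [hz, hε]
  obtain ⟨hp1, hp2⟩ := hp (2 * Real.pi * ξ * Complex.I) (by simp)
  have hi1 := hG.isC0Group.integrableOn_laplace hG.hasGrowth hp1 f
  have hi2 := hG.comp_neg.isC0Group.integrableOn_laplace hG.comp_neg.hasGrowth hp2 f
  have hF := Real.fourier_real_eq_integral_exp_smul ψ ξ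
  have e1 : ∀ t ∈ Ioi (0 : ℝ), Complex.exp (↑(-2 * Real.pi * t * ξ) * Complex.I) • ψ t =
      T (Complex.exp (-((ε + 2 * Real.pi * ξ * Complex.I) * t)) • G t f) := by
    intro t ht
    simp only [hψ, abs_of_pos (show 0 < t from ht), map_smul, smul_smul, ← Complex.exp_add]
    congr 2
    push_cast
    ring
  have e2 : ∀ t ∈ Ioi (0 : ℝ), Complex.exp (↑(-2 * Real.pi * (-t) * ξ) * Complex.I) • ψ (-t) =
      T (Complex.exp (-((ε - 2 * Real.pi * ξ * Complex.I) * t)) • G (-t) f) := by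
    intro t ht
    simp only [hψ, abs_neg, abs_of_pos (show 0 < t from ht), map_smul, smul_smul,
      ← Complex.exp_add]
    congr 2
    push_cast
    ring
  rw [hF, integral_eq_add_integral_comp_neg]
  · rw [laplace, laplace, ← integral_add hi1 hi2, ← ContinuousLinearMap.integral_comp_comm T
      (φ := fun t => _ + _) (hi1.add hi2)]
    refine setIntegral_congr_fun measurableSet_Ioi fun t ht => ?_
    simp only [map_add]
    rw [← e1 t ht, ← e2 t ht]
  · exact Integrable.congr (T.integrable_comp hi1)
      ((ae_restrict_iff' measurableSet_Ioi).2 (Eventually.of_forall fun t ht => (e1 t ht).symm))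
  · exact Integrable.congr (T.integrable_comp hi2)
      ((ae_restrict_iff' measurableSet_Ioi).2 (Eventually.of_forall fun t ht => (e2 t ht).symm))

/-- The resolvent estimate behind smoothness of `A` with respect to a unitary group. -/
lemma IsUnitaryGroup.norm_laplace_add_sq_le (hG : IsUnitaryGroup G) {A : E →L[ℂ] E} {C : ℝ}
    (hC : 0 ≤ C) (hA : ∀ x y, inner ℂ (A x) y = inner ℂ x (A y))
    (hres : ∀ p : ℂ, 0 < p.re → ∀ w h, HasDerivAt (fun t => G t w) (p • w - A h) 0 →
      ‖A w‖ ≤ C * ‖h‖) {p : ℂ} (hp : 0 < p.re) (f : E) :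
    ‖A (laplace G p f + laplace (fun t => G (-t)) (conj p) f)‖ ^ 2 ≤
      4 * C * p.re * ‖laplace G p f‖ ^ 2 := by
  set u := laplace G p f with hu
  set v := laplace (fun t => G (-t)) (conj p) f with hv
  set h := A (u + v) with hh
  set w := laplace G p (A h) with hw
  have du : HasDerivAt (fun t => G t u) (p • u - f) 0 :=
    hG.isC0Group.hasDerivAt_laplace hG.hasGrowth hp f
  have dw : HasDerivAt (fun t => G t w) (p • w - A h) 0 :=
    hG.isC0Group.hasDerivAt_laplace hG.hasGrowth hp _
  have dv : HasDerivAt (fun t => G t v) (-(conj p • v - f)) 0 := by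
    have h1 : HasDerivAt (fun t => G (-t) v) (conj p • v - f) (-0) := by
      rw [neg_zero]
      exact hG.comp_neg.isC0Group.hasDerivAt_laplace hG.comp_neg.hasGrowth (by simpa using hp) f
    have := HasDerivAt.scomp (h := fun s : ℝ => -s) 0 h1 (hasDerivAt_neg 0)
    simpa [Function.comp_def] using this
  have hAw : ‖A w‖ ≤ C * ‖h‖ := hres p hp w h dw
  -- the skew-symmetry of the generator bounds `w`
  have hww : p.re * ‖w‖ ^ 2 ≤ C * ‖h‖ ^ 2 := by
    have h1 := hG.inner_generator dw dw
    have h2 : (inner ℂ w (p • w - A h)).re = 0 := by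
      have h3 := congrArg Complex.re h1
      rw [← inner_conj_symm, Complex.neg_re, Complex.conj_re] at h3
      have h4 := congrArg Complex.re (inner_conj_symm w (p • w - A h))
      rw [Complex.conj_re] at h4
      linarith
    rw [inner_sub_right, inner_smul_right, inner_self_eq_norm_sq_to_K, Complex.sub_re,
      ← hA] at h2
    have h3 : (p * ((‖w‖ : ℂ)) ^ 2).re = p.re * ‖w‖ ^ 2 := by
      rw [← Complex.ofReal_pow, Complex.re_mul_ofReal]
    have h4 : (inner ℂ (A w) h).re ≤ ‖A w‖ * ‖h‖ :=
      (Complex.re_le_norm _).trans (norm_inner_le_norm _ _)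
    have h5 : ‖A w‖ * ‖h‖ ≤ C * ‖h‖ * ‖h‖ := by gcongr
    have h6 : (p * ((‖w‖ : ℂ)) ^ 2).re - (inner ℂ (A w) h).re = 0 := h2
    nlinarith
  -- With `Z` the skew-adjoint generator and `R = (p - Z)⁻¹` one has `u = R f`, `v = R* f`, `w = R A
  -- h`. The identity is the resolvent formula `R + R* = 2 Re p · R* R` paired with `A h`.
  have key : inner ℂ (u + v) (A h) = (2 * p.re : ℝ) * inner ℂ u w := by
    have h1 := hG.inner_generator du dw
    have h2 := hG.inner_generator dv dw
    have h3 : (p + conj p) = ((2 * p.re : ℝ) : ℂ) := by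
      rw [Complex.add_conj]
    simp only [inner_sub_right, inner_sub_left, inner_smul_right, inner_smul_left, inner_neg_left,
      Complex.conj_conj] at h1 h2
    rw [inner_add_left, ← h3]
    linear_combination -h1 - h2
  have hn : ‖h‖ ^ 2 ≤ 2 * p.re * (‖u‖ * ‖w‖) := by
    have h1 : ((‖h‖ : ℂ)) ^ 2 = inner ℂ (u + v) (A h) := by
      rw [← hA, ← hh]
      exact (inner_self_eq_norm_sq_to_K (𝕜 := ℂ) h).symm
    have h2 := congrArg norm (h1.trans key)
    rw [norm_pow, norm_mul, Complex.norm_real, Complex.norm_real, norm_norm,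
      Real.norm_of_nonneg (by positivity)] at h2
    rw [h2]
    gcongr
    exact norm_inner_le_norm _ _
  have h0 : 0 ≤ ‖h‖ ^ 2 := by positivity
  rcases h0.eq_or_lt with h0 | h0
  · rw [← h0]
    positivity
  · have h1 : (‖h‖ ^ 2) ^ 2 ≤ 4 * p.re * ‖u‖ ^ 2 * (p.re * ‖w‖ ^ 2) := by
      calc (‖h‖ ^ 2) ^ 2 ≤ (2 * p.re * (‖u‖ * ‖w‖)) ^ 2 := by gcongr
        _ = _ := by ring
    have h2 : 4 * p.re * ‖u‖ ^ 2 * (p.re * ‖w‖ ^ 2) ≤ 4 * p.re * ‖u‖ ^ 2 * (C * ‖h‖ ^ 2) := by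
      gcongr
    have h3 : ‖h‖ ^ 2 * ‖h‖ ^ 2 ≤ (4 * C * p.re * ‖u‖ ^ 2) * ‖h‖ ^ 2 := by nlinarith
    exact le_of_mul_le_mul_right h3 h0

lemma IsUnitaryGroup.lintegral_exp_smul_le (hG : IsUnitaryGroup G) {A : E →L[ℂ] E} {C : ℝ}
    (hC : 0 ≤ C) (hA : ∀ x y, inner ℂ (A x) y = inner ℂ x (A y))
    (hres : ∀ p : ℂ, 0 < p.re → ∀ w h, HasDerivAt (fun t => G t w) (p • w - A h) 0 →
      ‖A w‖ ≤ C * ‖h‖) {ε : ℝ} (hε : 0 < ε) (f : E) :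
    ∫⁻ t : ℝ, ‖Complex.exp (-((ε : ℂ) * |t|)) • A (G t f)‖ₑ ^ 2 ≤
      ENNReal.ofReal (2 * C * ‖f‖ ^ 2) := by
  have h1 : ∀ ξ : ℝ, ‖A (laplace G (ε + 2 * Real.pi * ξ * Complex.I) f +
        laplace (fun t => G (-t)) (ε - 2 * Real.pi * ξ * Complex.I) f)‖ₑ ^ 2 ≤
      ENNReal.ofReal (4 * C * ε) * ‖laplace G (ε + 2 * Real.pi * ξ * Complex.I) f‖ₑ ^ 2 := by
    intro ξ
    have e1 : ((ε : ℂ) + 2 * Real.pi * ξ * Complex.I).re = ε := by simp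
    have e2 : (ε : ℂ) - 2 * Real.pi * ξ * Complex.I =
        conj ((ε : ℂ) + 2 * Real.pi * ξ * Complex.I) := by
      simp [sub_eq_add_neg, map_ofNat]
    have := hG.norm_laplace_add_sq_le hC hA hres (p := (ε : ℂ) + 2 * Real.pi * ξ * Complex.I)
      (by rw [e1]; exact hε) f
    rw [e1] at this
    rw [e2, ← ofReal_norm, ← ofReal_norm, ← ENNReal.ofReal_pow (norm_nonneg _),
      ← ENNReal.ofReal_pow (norm_nonneg _), ← ENNReal.ofReal_mul (by positivity)]
    exact ENNReal.ofReal_le_ofReal this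
  have h2 := lintegral_laplace hG.isC0Group hG.hasGrowth hε (ContinuousLinearMap.id ℂ E) f
  simp only [ContinuousLinearMap.id_apply] at h2
  -- Since `G` is isometric this integral is exactly of order `1/ε`, which cancels the factor `ε` in
  -- `h1` and leaves a bound independent of `ε`.
  have h3 : ∫⁻ t in Ioi (0 : ℝ), ‖Complex.exp (-((ε : ℂ) * t)) • G t f‖ₑ ^ 2 =
      ENNReal.ofReal (‖f‖ ^ 2 / (2 * ε)) := by
    have h4 : ∀ t : ℝ, ‖Complex.exp (-((ε : ℂ) * t)) • G t f‖ₑ ^ 2 =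
        ENNReal.ofReal (‖f‖ ^ 2 * Real.exp (-(2 * ε) * t)) := by
      intro t
      rw [← ofReal_norm, ← ENNReal.ofReal_pow (norm_nonneg _), norm_smul, hG.norm_map,
        Complex.norm_exp, mul_pow, ← Real.exp_nat_mul, mul_comm]
      congr 3
      simp
      ring
    simp_rw [h4]
    rw [← ofReal_integral_eq_lintegral_ofReal
      ((integrableOn_exp_mul_Ioi (by linarith) 0).const_mul _)
      (Eventually.of_forall fun t => by positivity), integral_const_mul,
      integral_exp_mul_Ioi (by linarith)]
    congr 1
    simp
    field_simp
  rw [← hG.lintegral_two_sided hε]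
  calc _ ≤ ∫⁻ ξ : ℝ, ENNReal.ofReal (4 * C * ε) *
        ‖laplace G (ε + 2 * Real.pi * ξ * Complex.I) f‖ₑ ^ 2 := lintegral_mono h1
    _ = ENNReal.ofReal (4 * C * ε) * ENNReal.ofReal (‖f‖ ^ 2 / (2 * ε)) := by
        rw [lintegral_const_mul' _ _ ENNReal.ofReal_ne_top, h2, h3]
    _ = ENNReal.ofReal (2 * C * ‖f‖ ^ 2) := by
        rw [← ENNReal.ofReal_mul (by positivity)]
        congr 1
        field_simp
        ring
    _ ≤ _ := le_rfl

end Smooth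

/-! ### Smoothness for the perturbed group by lowering its growth rate -/

section Growth

variable {E : Type*} [NormedAddCommGroup E] [InnerProductSpace ℂ E] [CompleteSpace E]
variable {G U : ℝ → E →L[ℂ] E}

lemma intervalIntegral_sq_le_of_lintegral {F : Type*} [NormedAddCommGroup F] {ψ : ℝ → F}
    (hψ : Continuous ψ) {s : Set ℝ} {a b c : ℝ} (hab : a ≤ b) (hs : Ioc a b ⊆ s) (hc : 0 ≤ c)
    (h : ∫⁻ t in s, ‖ψ t‖ₑ ^ 2 ≤ ENNReal.ofReal c) : ∫ t in a..b, ‖ψ t‖ ^ 2 ≤ c := by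
  rw [intervalIntegral.integral_of_le hab, integral_eq_lintegral_of_nonneg_ae
    (Eventually.of_forall fun t => by positivity) (by fun_prop)]
  refine ENNReal.toReal_le_of_le_ofReal hc (le_trans ?_ h)
  refine (lintegral_mono_set hs).trans' (lintegral_mono fun t => ?_)
  rw [ENNReal.ofReal_pow (norm_nonneg _), ofReal_norm]

lemma le_of_forall_le_exp_mul {x y c a : ℝ}
    (h : ∀ ε, a < ε → x ≤ Real.exp (c * (ε - a)) * y) : x ≤ y := by
  have h1 : Tendsto (fun ε : ℝ => Real.exp (c * (ε - a)) * y) (𝓝[>] a)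
      (𝓝 (Real.exp (c * (a - a)) * y)) :=
    (Continuous.tendsto (by fun_prop) a).mono_left nhdsWithin_le_nhds
  rw [sub_self, mul_zero, Real.exp_zero, one_mul] at h1
  exact ge_of_tendsto h1 (eventually_mem_nhdsWithin.mono h)

lemma sq_intervalIntegral_mul_le {α β : ℝ → ℝ} (hα : Continuous α) (hβ : Continuous β) {a b : ℝ}
    (hab : a ≤ b) :
    (∫ t in a..b, α t * β t) ^ 2 ≤ (∫ t in a..b, α t ^ 2) * ∫ t in a..b, β t ^ 2 := by
  have hi : ∀ φ : ℝ → ℝ, Continuous φ → IntervalIntegrable φ volume a b :=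
    fun φ hφ => hφ.intervalIntegrable _ _
  -- The quadratic `∫ (αx + β)²` is nonnegative, so its discriminant is not positive; this is
  -- Cauchy–Schwarz.
  have key : ∀ x : ℝ, 0 ≤ (∫ t in a..b, α t ^ 2) * (x * x) + 2 * (∫ t in a..b, α t * β t) * x +
      ∫ t in a..b, β t ^ 2 := by
    intro x
    have h1 : 0 ≤ ∫ t in a..b, (α t * x + β t) ^ 2 :=
      intervalIntegral.integral_nonneg hab fun t _ => by positivity
    have h2 : ∫ t in a..b, (α t * x + β t) ^ 2 =
        ∫ t in a..b, (α t ^ 2 * (x * x) + (α t * β t) * (2 * x) + β t ^ 2) :=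
      intervalIntegral.integral_congr fun t _ => by ring
    rw [h2, intervalIntegral.integral_add (hi _ (by fun_prop)) (hi _ (by fun_prop)),
      intervalIntegral.integral_add (hi _ (by fun_prop)) (hi _ (by fun_prop)),
      intervalIntegral.integral_mul_const, intervalIntegral.integral_mul_const] at h1
    linarith
  have := discrim_le_zero key
  rw [discrim] at this
  nlinarith

/-- `A` is smooth with respect to a unitary group, if its resolvent compressed by `A` is bounded. -/
theorem IsUnitaryGroup.integral_sq_le (hG : IsUnitaryGroup G) {A : E →L[ℂ] E} {C : ℝ}
    (hC : 0 ≤ C) (hA : ∀ x y, inner ℂ (A x) y = inner ℂ x (A y))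
    (hres : ∀ p : ℂ, 0 < p.re → ∀ w h, HasDerivAt (fun t => G t w) (p • w - A h) 0 →
      ‖A w‖ ≤ C * ‖h‖) {b : ℝ} (hb : 0 ≤ b) (f : E) :
    ∫ t in (0 : ℝ)..b, ‖A (G t f)‖ ^ 2 ≤ 2 * C * ‖f‖ ^ 2 := by
  -- On `[0, b]` removing the damping costs at most `exp (2bε)`, which tends to 1 as `ε` decreases
  -- to 0.
  refine le_of_forall_le_exp_mul (c := 2 * b) (a := 0) fun ε hε => ?_
  have hcA : Continuous fun t => A (G t f) := A.continuous.comp (hG.continuous f)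
  have hcont : Continuous fun t : ℝ => Complex.exp (-((ε : ℂ) * |t|)) • A (G t f) := by
    refine Continuous.smul ?_ hcA
    have : Continuous fun t : ℝ => ((|t| : ℝ) : ℂ) := Complex.continuous_ofReal.comp continuous_abs
    fun_prop
  have h1 := intervalIntegral_sq_le_of_lintegral hcont hb (subset_univ _)
    (by positivity : 0 ≤ 2 * C * ‖f‖ ^ 2)
    (by simpa using hG.lintegral_exp_smul_le hC hA hres hε f)
  refine le_trans ?_ (mul_le_mul_of_nonneg_left h1 (Real.exp_pos _).le)
  rw [← intervalIntegral.integral_const_mul]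
  refine intervalIntegral.integral_mono_on hb ((hcA.norm.pow 2).intervalIntegrable _ _)
    (Continuous.intervalIntegrable (by fun_prop) _ _) fun t ht => ?_
  have h2 : (-((ε : ℂ) * |t|)).re = -(ε * t) := by simp [abs_of_nonneg ht.1]
  rw [norm_smul, Complex.norm_exp, h2, mul_pow, ← mul_assoc, ← Real.exp_nat_mul, ← Real.exp_add]
  refine le_mul_of_one_le_left (by positivity) (Real.one_le_exp ?_)
  push_cast
  nlinarith [ht.2]

/-- Weighted smoothness for the perturbed group above its growth rate, with uniform constants. -/
lemma IsPerturbation.integral_exp_mul_sq_le (hG : IsUnitaryGroup G) {A Q : E →L[ℂ] E} {C C' : ℝ}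
    (hU : IsPerturbation G Q U)
    (hC : 0 ≤ C) (hA : ∀ x y, inner ℂ (A x) y = inner ℂ x (A y))
    (hres : ∀ p : ℂ, 0 < p.re → ∀ w h, HasDerivAt (fun t => G t w) (p • w - A h) 0 →
      ‖A w‖ ≤ C * ‖h‖)
    (hC' : 0 ≤ C')
    (hres' : ∀ p : ℂ, 0 < p.re → ∀ w h, HasDerivAt (fun t => U t w) (p • w - Q h) 0 →
      ‖A w‖ ≤ C' * ‖A h‖)
    {ω : ℝ} (hω : 0 ≤ ω) (hg : HasGrowth U ω) {b : ℝ} (hb : 0 ≤ b) (f : E) :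
    ∫ t in (0 : ℝ)..b, Real.exp (-(2 * ω * t)) * ‖A (U t f)‖ ^ 2 ≤
      (C' + 1) ^ 2 * (2 * C) * ‖f‖ ^ 2 := by
  refine le_of_forall_le_exp_mul (c := 2 * b) (a := ω) fun ε hε => ?_
  have hε0 : 0 < ε := hω.trans_lt hε
  have hcA : Continuous fun t => A (U t f) := A.continuous.comp (hU.isC0Group.continuous f)
  have hcont : Continuous fun t : ℝ => Complex.exp (-((ε : ℂ) * t)) • A (U t f) :=
    Continuous.smul (by fun_prop) hcA
  have hle : ∀ ξ : ℝ, ‖A (laplace U (ε + 2 * Real.pi * ξ * Complex.I) f)‖ₑ ^ 2 ≤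
      ENNReal.ofReal ((C' + 1) ^ 2) *
        ‖A (laplace G (ε + 2 * Real.pi * ξ * Complex.I) f)‖ₑ ^ 2 := by
    intro ξ
    set p : ℂ := ε + 2 * Real.pi * ξ * Complex.I with hp
    have hpre : p.re = ε := by simp [hp]
    have h1 := hU.isC0Group.hasDerivAt_laplace hg (p := p) (by rw [hpre]; exact hε) f
    have h2 := hG.isC0Group.hasDerivAt_laplace hG.hasGrowth (p := p) (by rw [hpre]; exact hε0) f
    -- Second resolvent identity: the difference of the two Laplace transforms is the perturbed
    -- resolvent applied to `Q (laplace G p f)`. Thus `hres'` bounds it by `C' ‖A (laplace G p f)‖`.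
    -- The rate `ω` only ensures convergence of the Laplace integral and does not enter the
    -- constants.
    have h3 : HasDerivAt (fun t => U t (laplace G p f))
        (p • laplace G p f - f + Q (laplace G p f)) 0 := by
      rw [hU.hasDerivAt_iff hG]
      simpa using h2
    have h4 := h1.sub h3
    have h5 : HasDerivAt (fun t => U t (laplace U p f - laplace G p f))
        (p • (laplace U p f - laplace G p f) - Q (laplace G p f)) 0 := by
      refine (h4.congr_of_eventuallyEq (Eventually.of_forall fun t => ?_)).congr_deriv ?_
      · simp
      · rw [smul_sub]
        abel
    have h6 := hres' p (by rw [hpre]; exact hε0) _ _ h5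
    have h7 : ‖A (laplace U p f)‖ ≤ (C' + 1) * ‖A (laplace G p f)‖ := by
      have h8 := norm_add_le (A (laplace U p f - laplace G p f)) (A (laplace G p f))
      rw [← map_add, sub_add_cancel] at h8
      linarith
    rw [← ofReal_norm, ← ofReal_norm, ← ENNReal.ofReal_pow (norm_nonneg _),
      ← ENNReal.ofReal_pow (norm_nonneg _), ← ENNReal.ofReal_mul (by positivity), ← mul_pow]
    exact ENNReal.ofReal_le_ofReal (by gcongr)
  have h0 : ∫⁻ t in Ioi (0 : ℝ), ‖Complex.exp (-((ε : ℂ) * t)) • A (G t f)‖ₑ ^ 2 ≤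
      ENNReal.ofReal (2 * C * ‖f‖ ^ 2) := by
    refine le_trans ?_ (hG.lintegral_exp_smul_le hC hA hres hε0 f)
    refine le_trans (le_of_eq ?_) (setLIntegral_le_lintegral (Ioi (0 : ℝ)) _)
    refine setLIntegral_congr_fun measurableSet_Ioi fun t ht => ?_
    simp only [abs_of_pos (show 0 < t from ht)]
  have h1 : ∫⁻ t in Ioi (0 : ℝ), ‖Complex.exp (-((ε : ℂ) * t)) • A (U t f)‖ₑ ^ 2 ≤
      ENNReal.ofReal ((C' + 1) ^ 2 * (2 * C) * ‖f‖ ^ 2) := by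
    rw [← lintegral_laplace hU.isC0Group hg hε]
    refine (lintegral_mono hle).trans ?_
    rw [lintegral_const_mul' _ _ ENNReal.ofReal_ne_top,
      lintegral_laplace hG.isC0Group hG.hasGrowth hε0]
    refine (mul_le_mul_right h0 _).trans ?_
    rw [← ENNReal.ofReal_mul (by positivity), ← mul_assoc]
  have h2 := intervalIntegral_sq_le_of_lintegral hcont hb Ioc_subset_Ioi_self
    (by positivity) h1
  refine le_trans ?_ (mul_le_mul_of_nonneg_left h2 (Real.exp_pos _).le)
  rw [← intervalIntegral.integral_const_mul]
  refine intervalIntegral.integral_mono_on hb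
    (Continuous.intervalIntegrable (Continuous.mul (by fun_prop) (hcA.norm.pow 2)) _ _)
    (Continuous.intervalIntegrable (by fun_prop) _ _) fun t ht => ?_
  have h2 : (-((ε : ℂ) * t)).re = -(ε * t) := by simp
  rw [norm_smul, Complex.norm_exp, h2, mul_pow, ← mul_assoc, ← Real.exp_nat_mul, ← Real.exp_add]
  gcongr
  push_cast
  nlinarith [ht.2, ht.1]

lemma IsPerturbation.inner_interaction_sub (hG : IsUnitaryGroup G) {Q : E →L[ℂ] E}
    (hU : IsPerturbation G Q U) (s t : ℝ) (f g : E) :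
    inner ℂ g (G (-t) (U t f) - G (-s) (U s f)) = ∫ τ in s..t, inner ℂ (G τ g) (Q (U τ f)) := by
  have hd : ∀ τ, HasDerivAt (fun τ => inner ℂ g (G (-τ) (U τ f))) (inner ℂ (G τ g) (Q (U τ f)))
      τ := by
    intro τ
    have h1 := (innerSL ℂ g).restrictScalars ℝ |>.hasFDerivAt.comp_hasDerivAt τ (hU.deriv τ f)
    refine h1.congr_deriv ?_
    simp only [ContinuousLinearMap.coe_restrictScalars', innerSL_apply_apply]
    rw [← hG.inner_map τ g, hG.isC0Group.apply_neg_apply]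
  rw [inner_sub_right]
  refine (intervalIntegral.integral_eq_sub_of_hasDerivAt (fun τ _ => hd τ) ?_).symm
  refine Continuous.intervalIntegrable ?_ _ _
  exact (hG.continuous g).inner (Q.continuous.comp (hU.isC0Group.continuous f))

/-- Duhamel's formula is tested against the difference `g` itself. Cauchy–Schwarz and smoothness of
`A` for `G` produce `‖g‖⁴ ≤ D ‖g‖² ∫ ‖A (U τ f)‖²`, and one factor `‖g‖²` cancels. -/
lemma IsPerturbation.norm_sq_interaction_sub_le (hG : IsUnitaryGroup G) {A Q : E →L[ℂ] E}
    (hU : IsPerturbation G Q U) (hQ : ∀ x y, ‖inner ℂ y (Q x)‖ ≤ ‖A x‖ * ‖A y‖) {D : ℝ}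
    (hD0 : 0 ≤ D) (hD : ∀ b, 0 ≤ b → ∀ g, ∫ t in (0 : ℝ)..b, ‖A (G t g)‖ ^ 2 ≤ D * ‖g‖ ^ 2)
    {s t : ℝ} (hs : 0 ≤ s) (hst : s ≤ t) (f : E) :
    ‖G (-t) (U t f) - G (-s) (U s f)‖ ^ 2 ≤ D * ∫ τ in s..t, ‖A (U τ f)‖ ^ 2 := by
  set g := G (-t) (U t f) - G (-s) (U s f) with hg
  have hcU : Continuous fun τ => ‖A (U τ f)‖ :=
    (A.continuous.comp (hU.isC0Group.continuous f)).norm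
  have hcG : Continuous fun τ => ‖A (G τ g)‖ := (A.continuous.comp (hG.continuous g)).norm
  have h1 : ‖g‖ ^ 2 ≤ ∫ τ in s..t, ‖A (U τ f)‖ * ‖A (G τ g)‖ := by
    have h2 : ((‖g‖ : ℂ)) ^ 2 = ∫ τ in s..t, inner ℂ (G τ g) (Q (U τ f)) := by
      rw [← hU.inner_interaction_sub hG]
      exact (inner_self_eq_norm_sq_to_K (𝕜 := ℂ) g).symm
    have h3 := congrArg norm h2
    rw [norm_pow, Complex.norm_real, norm_norm] at h3
    rw [h3]
    exact intervalIntegral.norm_integral_le_of_norm_le hst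
      (Eventually.of_forall fun τ _ => hQ _ _) ((hcU.mul hcG).intervalIntegrable _ _)
  have h4 := sq_intervalIntegral_mul_le hcU hcG hst
  have h5 : ∫ τ in s..t, ‖A (G τ g)‖ ^ 2 ≤ D * ‖g‖ ^ 2 := by
    refine le_trans ?_ (hD t (hs.trans hst) g)
    have h6 := intervalIntegral.integral_add_adjacent_intervals (μ := volume)
      ((hcG.pow 2).intervalIntegrable 0 s) ((hcG.pow 2).intervalIntegrable s t)
    have h7 : 0 ≤ ∫ τ in (0 : ℝ)..s, ‖A (G τ g)‖ ^ 2 :=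
      intervalIntegral.integral_nonneg hs fun _ _ => by positivity
    simp only [Pi.pow_apply] at h6
    linarith
  have h8 : 0 ≤ ∫ τ in s..t, ‖A (U τ f)‖ ^ 2 :=
    intervalIntegral.integral_nonneg hst fun _ _ => by positivity
  have h0 : 0 ≤ ‖g‖ ^ 2 := by positivity
  have h9 : (‖g‖ ^ 2) * ‖g‖ ^ 2 ≤ (D * ∫ τ in s..t, ‖A (U τ f)‖ ^ 2) * ‖g‖ ^ 2 := by
    calc (‖g‖ ^ 2) * ‖g‖ ^ 2 = (‖g‖ ^ 2) ^ 2 := by ring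
      _ ≤ (∫ τ in s..t, ‖A (U τ f)‖ * ‖A (G τ g)‖) ^ 2 := by gcongr
      _ ≤ _ := h4
      _ ≤ (∫ τ in s..t, ‖A (U τ f)‖ ^ 2) * (D * ‖g‖ ^ 2) := by gcongr
      _ = _ := by ring
  rcases h0.eq_or_lt with h0 | h0
  · rw [← h0]
    positivity
  · exact le_of_mul_le_mul_right h9 h0

/-- A perturbed group with growth rate `ω` and uniform smoothness constants contracts to half of
`exp (ω t)` at a time proportional to `1 / ω`. -/
lemma IsPerturbation.exists_norm_le_half (hG : IsUnitaryGroup G) {A Q : E →L[ℂ] E}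
    (hU : IsPerturbation G Q U) (hQ : ∀ x y, ‖inner ℂ y (Q x)‖ ≤ ‖A x‖ * ‖A y‖) {D D' : ℝ}
    (hD0 : 0 ≤ D) (hD : ∀ b, 0 ≤ b → ∀ g, ∫ t in (0 : ℝ)..b, ‖A (G t g)‖ ^ 2 ≤ D * ‖g‖ ^ 2)
    (hD0' : 0 ≤ D') {ω : ℝ} (hω : 0 < ω)
    (hD' : ∀ b, 0 ≤ b → ∀ f, ∫ t in (0 : ℝ)..b, Real.exp (-(2 * ω * t)) * ‖A (U t f)‖ ^ 2 ≤
      D' * ‖f‖ ^ 2) :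
    (∀ t, 0 ≤ t → ∀ f, ‖U t f‖ ^ 2 ≤ (2 + 2 * D * D') * Real.exp (2 * ω * t) * ‖f‖ ^ 2) ∧
    ∀ f, ‖U (2 * (2 + 2 * D * D') ^ 2 / ω) f‖ ≤
      1 / 2 * Real.exp (ω * (2 * (2 + 2 * D * D') ^ 2 / ω)) * ‖f‖ := by
  have hcA : ∀ f, Continuous fun τ => ‖A (U τ f)‖ ^ 2 := fun f =>
    (A.continuous.comp (hU.isC0Group.continuous f)).norm.pow 2
  have hcI : ∀ f, Continuous fun t => ∫ τ in (0 : ℝ)..t, ‖A (U τ f)‖ ^ 2 := fun f =>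
    intervalIntegral.continuous_primitive (fun a b => (hcA f).intervalIntegrable a b) 0
  have hcU : ∀ f, Continuous fun τ => ‖U τ f‖ ^ 2 := fun f =>
    (hU.isC0Group.continuous f).norm.pow 2
  -- the Duhamel bound
  have h1 : ∀ t, 0 ≤ t → ∀ f, ‖U t f‖ ^ 2 ≤
      2 * ‖f‖ ^ 2 + 2 * D * ∫ τ in (0 : ℝ)..t, ‖A (U τ f)‖ ^ 2 := by
    intro t ht f
    have h2 := hU.norm_sq_interaction_sub_le hG hQ hD0 hD le_rfl ht f
    rw [neg_zero, hG.isC0Group.zero_apply, hU.isC0Group.zero_apply] at h2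
    have h3 : ‖U t f‖ ≤ ‖G (-t) (U t f) - f‖ + ‖f‖ := by
      have := norm_add_le (G (-t) (U t f) - f) f
      rwa [sub_add_cancel, hG.norm_map] at this
    have h4 : ‖U t f‖ ^ 2 ≤ (‖G (-t) (U t f) - f‖ + ‖f‖) ^ 2 := by gcongr
    nlinarith [sq_nonneg (‖G (-t) (U t f) - f‖ - ‖f‖)]
  have h2 : ∀ t, 0 ≤ t → ∀ f, ∫ τ in (0 : ℝ)..t, ‖A (U τ f)‖ ^ 2 ≤
      Real.exp (2 * ω * t) * (D' * ‖f‖ ^ 2) := by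
    intro t ht f
    refine le_trans ?_ (mul_le_mul_of_nonneg_left (hD' t ht f) (Real.exp_pos _).le)
    rw [← intervalIntegral.integral_const_mul]
    refine intervalIntegral.integral_mono_on ht ((hcA f).intervalIntegrable _ _)
      (Continuous.intervalIntegrable (continuous_const.mul (Continuous.mul (by fun_prop) (hcA f)))
        _ _) fun s hs => ?_
    rw [← mul_assoc, ← Real.exp_add]
    refine le_mul_of_one_le_left (by positivity) (Real.one_le_exp ?_)
    nlinarith [hs.2]
  set κ := 2 + 2 * D * D' with hκ
  have hκ0 : 2 ≤ κ := by
    have : 0 ≤ 2 * D * D' := by positivity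
    linarith
  have h3 : ∀ t, 0 ≤ t → ∀ f, ‖U t f‖ ^ 2 ≤ κ * Real.exp (2 * ω * t) * ‖f‖ ^ 2 := by
    intro t ht f
    have h4 : 1 ≤ Real.exp (2 * ω * t) := Real.one_le_exp (by positivity)
    calc ‖U t f‖ ^ 2 ≤ 2 * ‖f‖ ^ 2 + 2 * D * ∫ τ in (0 : ℝ)..t, ‖A (U τ f)‖ ^ 2 := h1 t ht f
      _ ≤ 2 * (Real.exp (2 * ω * t) * ‖f‖ ^ 2) +
          2 * D * (Real.exp (2 * ω * t) * (D' * ‖f‖ ^ 2)) := by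
          gcongr
          · exact le_mul_of_one_le_left (by positivity) h4
          · exact h2 t ht f
      _ = _ := by rw [hκ]; ring
  -- square integrability of the weighted orbit
  have h4 : ∀ t, 0 ≤ t → ∀ f, ∫ s in (0 : ℝ)..t, Real.exp (-(2 * ω * s)) * ‖U s f‖ ^ 2 ≤
      κ / (2 * ω) * ‖f‖ ^ 2 := by
    intro t ht f
    set I : ℝ → ℝ := fun t => ∫ τ in (0 : ℝ)..t, ‖A (U τ f)‖ ^ 2 with hI
    -- Integration by parts of the Duhamel bound `h1` against `exp (-2ωs)`. The boundary term at `t`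
    -- has a favourable sign and is dropped, and the remaining integral is controlled by `hD'`.
    have hder : ∀ s, HasDerivAt (fun s => -(1 / (2 * ω)) * (Real.exp (-(2 * ω * s)) *
        (2 * ‖f‖ ^ 2 + 2 * D * I s)))
        (Real.exp (-(2 * ω * s)) * (2 * ‖f‖ ^ 2 + 2 * D * I s) -
          D / ω * (Real.exp (-(2 * ω * s)) * ‖A (U s f)‖ ^ 2)) s := by
      intro s
      have e1 : HasDerivAt I (‖A (U s f)‖ ^ 2) s :=
        ((hcA f).integral_hasStrictDerivAt 0 s).hasDerivAt
      have e2 : HasDerivAt (fun s : ℝ => Real.exp (-(2 * ω * s)))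
          (Real.exp (-(2 * ω * s)) * -(2 * ω)) s := by
        have := ((hasDerivAt_id s).const_mul (2 * ω)).neg.exp
        simpa using this
      refine ((e2.mul ((e1.const_mul (2 * D)).const_add _)).const_mul _).congr_deriv ?_
      field_simp
      ring
    have hc1 : Continuous fun s => Real.exp (-(2 * ω * s)) * (2 * ‖f‖ ^ 2 + 2 * D * I s) :=
      Continuous.mul (by fun_prop) (continuous_const.add (continuous_const.mul (hcI f)))
    have hc2 : Continuous fun s => D / ω * (Real.exp (-(2 * ω * s)) * ‖A (U s f)‖ ^ 2) :=
      continuous_const.mul (Continuous.mul (by fun_prop) (hcA f))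
    have e3 := intervalIntegral.integral_eq_sub_of_hasDerivAt (a := 0) (b := t)
      (fun s _ => hder s) ((hc1.sub hc2).intervalIntegrable _ _)
    rw [intervalIntegral.integral_sub (hc1.intervalIntegrable _ _) (hc2.intervalIntegrable _ _),
      intervalIntegral.integral_const_mul] at e3
    have e4 : ∫ s in (0 : ℝ)..t, Real.exp (-(2 * ω * s)) * ‖U s f‖ ^ 2 ≤
        ∫ s in (0 : ℝ)..t, Real.exp (-(2 * ω * s)) * (2 * ‖f‖ ^ 2 + 2 * D * I s) := by
      refine intervalIntegral.integral_mono_on ht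
        (Continuous.intervalIntegrable (Continuous.mul (by fun_prop) (hcU f)) _ _)
        (hc1.intervalIntegrable _ _) fun s hs => ?_
      gcongr
      exact h1 s hs.1 f
    have e5 := hD' t ht f
    have e6 : 0 ≤ I t := intervalIntegral.integral_nonneg ht fun _ _ => by positivity
    have e7 : I 0 = 0 := intervalIntegral.integral_same
    have e8 : 0 ≤ 1 / (2 * ω) * (Real.exp (-(2 * ω * t)) * (2 * ‖f‖ ^ 2 + 2 * D * I t)) := by
      positivity
    have e9 : D / ω * ∫ s in (0 : ℝ)..t, Real.exp (-(2 * ω * s)) * ‖A (U s f)‖ ^ 2 ≤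
        D / ω * (D' * ‖f‖ ^ 2) := by gcongr
    rw [e7] at e3
    simp only [mul_zero, neg_zero, Real.exp_zero, one_mul, add_zero] at e3
    have e10 : κ / (2 * ω) * ‖f‖ ^ 2 =
        D / ω * (D' * ‖f‖ ^ 2) + 1 / (2 * ω) * (2 * ‖f‖ ^ 2) := by
      rw [hκ]
      field_simp
      ring
    rw [e10]
    linarith
  -- Datko's argument: write `U t = U (t - s) U s`, bound the first factor by `h3`, and integrate
  -- over `s` in `[0, t]` with the help of `h4`.
  have h5 : ∀ t, 0 ≤ t → ∀ f, t * ‖U t f‖ ^ 2 ≤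
      Real.exp (2 * ω * t) * (κ ^ 2 / (2 * ω) * ‖f‖ ^ 2) := by
    intro t ht f
    have e1 : ∫ _ in (0 : ℝ)..t, ‖U t f‖ ^ 2 ≤ ∫ s in (0 : ℝ)..t, (κ * Real.exp (2 * ω * t)) *
        (Real.exp (-(2 * ω * s)) * ‖U s f‖ ^ 2) := by
      refine intervalIntegral.integral_mono_on ht (by simp)
        (Continuous.intervalIntegrable (continuous_const.mul
          (Continuous.mul (by fun_prop) (hcU f))) _ _) fun s hs => ?_
      have e2 := h3 (t - s) (by linarith [hs.2]) (U s f)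
      rw [← hU.isC0Group.add_apply, sub_add_cancel] at e2
      refine e2.trans (le_of_eq ?_)
      have e3 : Real.exp (2 * ω * (t - s)) = Real.exp (2 * ω * t) * Real.exp (-(2 * ω * s)) := by
        rw [← Real.exp_add]
        ring_nf
      rw [e3]
      ring
    rw [intervalIntegral.integral_const, intervalIntegral.integral_const_mul, sub_zero,
      smul_eq_mul] at e1
    refine e1.trans ?_
    calc _ ≤ κ * Real.exp (2 * ω * t) * (κ / (2 * ω) * ‖f‖ ^ 2) := by
          gcongr
          exact h4 t ht f
      _ = _ := by ring
  refine ⟨h3, fun f => ?_⟩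
  -- This time makes `κ² / (2ω)` equal to `t / 4`, so `h5` yields the factor `1/2` after taking
  -- roots.
  set t := 2 * κ ^ 2 / ω with ht
  have ht0 : 0 < t := by positivity
  have e1 := h5 t ht0.le f
  have e2 : κ ^ 2 / (2 * ω) = t * (1 / 2) ^ 2 := by
    rw [ht]
    field_simp
  have e3 : Real.exp (2 * ω * t) = Real.exp (ω * t) ^ 2 := by
    rw [← Real.exp_nat_mul]
    push_cast
    ring_nf
  rw [e2, e3] at e1
  have e4 : ‖U t f‖ ^ 2 ≤ (1 / 2 * Real.exp (ω * t) * ‖f‖) ^ 2 := by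
    refine le_of_mul_le_mul_left (e1.trans (le_of_eq ?_)) ht0
    ring
  exact le_of_sq_le_sq e4 (by positivity)

/-- Every block of length `t₀` gains a factor `1/2 = exp (-log 2)`, which lowers the rate by `log 2
/ t₀`. The incomplete block costs at most a factor 2 in the constant. -/
lemma IsC0Group.hasGrowth_sub (hU : IsC0Group U) {K ω t₀ : ℝ} (ht₀ : 0 < t₀) (hK : 0 ≤ K)
    (h : ∀ t, 0 ≤ t → ∀ f, ‖U t f‖ ≤ K * Real.exp (ω * t) * ‖f‖)
    (h₀ : ∀ f, ‖U t₀ f‖ ≤ 1 / 2 * Real.exp (ω * t₀) * ‖f‖) :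
    HasGrowth U (ω - Real.log 2 / t₀) := by
  set ω' := ω - Real.log 2 / t₀ with hω'
  have hd : 0 ≤ Real.log 2 / t₀ := div_nonneg (Real.log_nonneg one_le_two) ht₀.le
  have e0 : 1 / 2 * Real.exp (ω * t₀) = Real.exp (ω' * t₀) := by
    have : ω' * t₀ = ω * t₀ - Real.log 2 := by
      rw [hω']
      field_simp
    rw [this, Real.exp_sub, Real.exp_log two_pos]
    ring
  have key : ∀ n : ℕ, ∀ t, 0 ≤ t → t ≤ n * t₀ → ∀ f,
      ‖U t f‖ ≤ 2 * K * Real.exp (ω' * t) * ‖f‖ := by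
    have base : ∀ t, 0 ≤ t → t ≤ t₀ → ∀ f, ‖U t f‖ ≤ 2 * K * Real.exp (ω' * t) * ‖f‖ := by
      intro t ht ht' f
      refine (h t ht f).trans ?_
      have : Real.exp (ω * t) ≤ 2 * Real.exp (ω' * t) := by
        have e2 : 2 * Real.exp (ω' * t) = Real.exp (Real.log 2 + ω' * t) := by
          rw [Real.exp_add, Real.exp_log two_pos]
        rw [e2]
        refine Real.exp_le_exp.2 ?_
        have h1 : Real.log 2 / t₀ * t ≤ Real.log 2 / t₀ * t₀ := by gcongr
        rw [div_mul_cancel₀ _ ht₀.ne'] at h1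
        rw [hω', sub_mul]
        linarith
      calc K * Real.exp (ω * t) * ‖f‖ ≤ K * (2 * Real.exp (ω' * t)) * ‖f‖ := by gcongr
        _ = _ := by ring
    intro n
    induction n with
    | zero =>
      intro t ht ht' f
      exact base t ht (ht'.trans (by simpa using ht₀.le)) f
    | succ n ih =>
      intro t ht ht' f
      rcases le_total t t₀ with h1 | h1
      · exact base t ht h1 f
      · push_cast at ht'
        have h2 := ih (t - t₀) (by linarith) (by linarith) (U t₀ f)
        rw [← hU.add_apply, sub_add_cancel] at h2
        refine h2.trans ?_
        have h3 := h₀ f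
        rw [e0] at h3
        calc 2 * K * Real.exp (ω' * (t - t₀)) * ‖U t₀ f‖
            ≤ 2 * K * Real.exp (ω' * (t - t₀)) * (Real.exp (ω' * t₀) * ‖f‖) := by gcongr
          _ = 2 * K * (Real.exp (ω' * (t - t₀)) * Real.exp (ω' * t₀)) * ‖f‖ := by ring
          _ = _ := by rw [← Real.exp_add]; ring_nf
  refine ⟨2 * K, by positivity, fun t ht f => ?_⟩
  obtain ⟨n, hn⟩ := exists_nat_gt (t / t₀)
  exact key n t ht (by rw [div_lt_iff₀ ht₀] at hn; exact hn.le) f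

/-- **Kato smoothness**: if the resolvents of the unitary group `G` and of its perturbation `U`,
compressed by `A`, are bounded in the right half-plane, then `A` is smooth with respect
to `U`. -/
theorem IsPerturbation.exists_integral_sq_le (hG : IsUnitaryGroup G) {A Q : E →L[ℂ] E} {C C' : ℝ}
    (hU : IsPerturbation G Q U) (hC : 0 ≤ C) (hA : ∀ x y, inner ℂ (A x) y = inner ℂ x (A y))
    (hQ : ∀ x y, ‖inner ℂ y (Q x)‖ ≤ ‖A x‖ * ‖A y‖)
    (hres : ∀ p : ℂ, 0 < p.re → ∀ w h, HasDerivAt (fun t => G t w) (p • w - A h) 0 →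
      ‖A w‖ ≤ C * ‖h‖)
    (hC' : 0 ≤ C')
    (hres' : ∀ p : ℂ, 0 < p.re → ∀ w h, HasDerivAt (fun t => U t w) (p • w - Q h) 0 →
      ‖A w‖ ≤ C' * ‖A h‖) :
    ∃ D, 0 ≤ D ∧ ∀ b, 0 ≤ b → ∀ f, ∫ t in (0 : ℝ)..b, ‖A (U t f)‖ ^ 2 ≤ D * ‖f‖ ^ 2 := by
  have hD := fun b (hb : 0 ≤ b) g => hG.integral_sq_le hC hA hres hb g
  have hD' := fun ω (hω : 0 ≤ ω) hg b (hb : 0 ≤ b) f =>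
    hU.integral_exp_mul_sq_le hG hC hA hres hC' hres' (ω := ω) hω hg hb f
  have hD0 : 0 ≤ 2 * C := by positivity
  set D' := (C' + 1) ^ 2 * (2 * C) with hD'def
  have hD0' : 0 ≤ D' := by positivity
  set κ := 2 + 2 * (2 * C) * D' with hκ
  have hκ0 : 2 ≤ κ := by
    have : 0 ≤ 2 * (2 * C) * D' := by positivity
    linarith
  set θ := Real.log 2 / (2 * κ ^ 2) with hθ
  have hθ0 : 0 < θ := div_pos (Real.log_pos one_lt_two) (by positivity)
  have hθ1 : θ < 1 := by
    rw [hθ, div_lt_one (by positivity)]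
    nlinarith [Real.log_two_lt_d9]
  -- Because the halving time is `2κ²/ω`, the gain `log 2 / t₀` is `θ ω` with `θ` independent of
  -- `ω`. The rates thus decrease geometrically to zero; the constants `K` in `HasGrowth` may
  -- deteriorate, but they never enter the smoothness bound.
  have step : ∀ ω, 0 < ω → HasGrowth U ω → HasGrowth U ((1 - θ) * ω) := by
    intro ω hω hg
    obtain ⟨h1, h2⟩ := hU.exists_norm_le_half hG hQ hD0 hD hD0' hω (hD' ω hω.le hg)
    have h3 := hU.isC0Group.hasGrowth_sub (K := κ) (ω := ω) (t₀ := 2 * κ ^ 2 / ω) (by positivity)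
      (by positivity) (fun t ht f => ?_) h2
    · convert h3 using 1
      rw [hθ]
      field_simp
    · refine le_of_sq_le_sq ((h1 t ht f).trans ?_) (by positivity)
      have e3 : Real.exp (2 * ω * t) = Real.exp (ω * t) ^ 2 := by
        rw [← Real.exp_nat_mul]
        push_cast
        ring_nf
      rw [e3, mul_pow, mul_pow]
      gcongr
      nlinarith
  obtain ⟨K, M, hK, hM, hKM⟩ := hU.isC0Group.growth
  have h0 : HasGrowth U (M + 1) := by
    refine ⟨K, hK, fun t ht f => (hKM t f).trans ?_⟩
    rw [abs_of_nonneg ht]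
    gcongr
    linarith
  have hn : ∀ n : ℕ, HasGrowth U ((1 - θ) ^ n * (M + 1)) := by
    intro n
    induction n with
    | zero => simpa using h0
    | succ n ih =>
      rw [pow_succ', mul_assoc]
      exact step _ (mul_pos (pow_pos (by linarith) _) (by linarith)) ih
  refine ⟨D', hD0', fun b hb f => ?_⟩
  have hcA : Continuous fun τ => ‖A (U τ f)‖ ^ 2 :=
    (A.continuous.comp (hU.isC0Group.continuous f)).norm.pow 2
  have h1 : ∀ n : ℕ, ∫ t in (0 : ℝ)..b, ‖A (U t f)‖ ^ 2 ≤
      Real.exp (2 * b * ((1 - θ) ^ n * (M + 1))) * (D' * ‖f‖ ^ 2) := by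
    intro n
    set ω := (1 - θ) ^ n * (M + 1) with hω
    have hω0 : 0 < ω := mul_pos (pow_pos (by linarith) _) (by linarith)
    refine le_trans ?_ (mul_le_mul_of_nonneg_left (hD' _ hω0.le (hn n) b hb f) (Real.exp_pos _).le)
    rw [← intervalIntegral.integral_const_mul]
    refine intervalIntegral.integral_mono_on hb (hcA.intervalIntegrable _ _)
      (Continuous.intervalIntegrable (continuous_const.mul (Continuous.mul (by fun_prop) hcA))
        _ _) fun s hs => ?_
    rw [← mul_assoc, ← Real.exp_add]
    refine le_mul_of_one_le_left (by positivity) (Real.one_le_exp ?_)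
    nlinarith [hs.2]
  have h2 : Tendsto (fun n : ℕ => Real.exp (2 * b * ((1 - θ) ^ n * (M + 1))) * (D' * ‖f‖ ^ 2))
      atTop (𝓝 (Real.exp (2 * b * (0 * (M + 1))) * (D' * ‖f‖ ^ 2))) := by
    refine Tendsto.mul_const _ ((Real.continuous_exp.tendsto _).comp ?_)
    exact ((tendsto_pow_atTop_nhds_zero_of_lt_one (by linarith) (by linarith)).mul_const
      _).const_mul _
  simp only [zero_mul, mul_zero, Real.exp_zero, one_mul] at h2
  exact ge_of_tendsto' h2 h1

end Growth

/-! ### Wave operators from smoothness -/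

section Wave

variable {E : Type*} [NormedAddCommGroup E] [InnerProductSpace ℂ E] [CompleteSpace E]
variable {G U U' : ℝ → E →L[ℂ] E} {A Q Q' : E →L[ℂ] E}

/-- Square integrability of `A U(t) f` over the positive half-line, uniformly in `f`. -/
def IsSmooth (A : E →L[ℂ] E) (U : ℝ → E →L[ℂ] E) (D : ℝ) : Prop :=
  0 ≤ D ∧ ∀ b, 0 ≤ b → ∀ f, ∫ t in (0 : ℝ)..b, ‖A (U t f)‖ ^ 2 ≤ D * ‖f‖ ^ 2

lemma IsSmooth.integral_le (hU : IsC0Group U) {D : ℝ} (h : IsSmooth A U D) {s t : ℝ} (hs : 0 ≤ s)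
    (hst : s ≤ t) (f : E) : ∫ τ in s..t, ‖A (U τ f)‖ ^ 2 ≤ D * ‖f‖ ^ 2 := by
  have hc : Continuous fun τ => ‖A (U τ f)‖ ^ 2 :=
    (A.continuous.comp (hU.continuous f)).norm.pow 2
  have h6 := intervalIntegral.integral_add_adjacent_intervals (μ := volume)
    (hc.intervalIntegrable 0 s) (hc.intervalIntegrable s t)
  have h7 : 0 ≤ ∫ τ in (0 : ℝ)..s, ‖A (U τ f)‖ ^ 2 :=
    intervalIntegral.integral_nonneg hs fun _ _ => by positivity
  linarith [h.2 t (hs.trans hst) f]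

/-- Cauchy criterion through a bound by a convergent integral. -/
lemma exists_tendsto_of_norm_sq_sub_le {x : ℝ → E} {φ : ℝ → ℝ} {D M : ℝ} (hφ : Continuous φ)
    (hφ0 : ∀ t, 0 ≤ φ t) (hM : ∀ t, 0 ≤ t → ∫ τ in (0 : ℝ)..t, φ τ ≤ M)
    (hx : ∀ s t, 0 ≤ s → s ≤ t → ‖x t - x s‖ ^ 2 ≤ D * ∫ τ in s..t, φ τ) :
    ∃ y, Tendsto x atTop (𝓝 y) := by
  set I : ℝ → ℝ := fun t => ∫ τ in (0 : ℝ)..t, φ τ with hI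
  have hsub : ∀ s t, ∫ τ in s..t, φ τ = I t - I s := fun s t =>
    (intervalIntegral.integral_interval_sub_left (hφ.intervalIntegrable _ _)
      (hφ.intervalIntegrable _ _)).symm
  have hmono : Monotone I := by
    intro s t hst
    have := intervalIntegral.integral_nonneg (μ := volume) hst fun τ _ => hφ0 τ
    rw [hsub] at this
    linarith
  have hbdd : BddAbove (range I) := by
    refine ⟨M, ?_⟩
    rintro _ ⟨t, rfl⟩
    exact (hmono (le_max_left t 0)).trans (hM _ (le_max_right t 0))
  have hlim := tendsto_atTop_ciSup hmono hbdd
  have hC : CauchySeq I := hlim.cauchySeq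
  refine cauchySeq_tendsto_of_complete (Metric.cauchySeq_iff'.2 fun ε hε => ?_)
  obtain ⟨N, hN⟩ := Metric.cauchySeq_iff'.1 hC (ε ^ 2 / (|D| + 1)) (by positivity)
  refine ⟨max N 0, fun t ht => ?_⟩
  have hN' : dist (I t) (I (max N 0)) < ε ^ 2 / (|D| + 1) := by
    have h1 := hN t ((le_max_left _ _).trans ht)
    rw [Real.dist_eq, abs_of_nonneg (sub_nonneg.2 (hmono ((le_max_left _ _).trans ht)))] at h1
    rw [Real.dist_eq, abs_of_nonneg (sub_nonneg.2 (hmono ht))]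
    have := hmono (le_max_left N 0)
    linarith
  rw [Real.dist_eq, abs_of_nonneg (sub_nonneg.2 (hmono ht)), lt_div_iff₀ (by positivity)] at hN'
  have h1 := hx (max N 0) t (le_max_right _ _) ht
  rw [hsub] at h1
  rw [dist_eq_norm]
  refine lt_of_pow_lt_pow_left₀ 2 hε.le (h1.trans_lt ?_)
  have h2 : 0 ≤ I t - I (max N 0) := sub_nonneg.2 (hmono ht)
  nlinarith [le_abs_self D]

/-- The mirror image of `IsPerturbation.norm_sq_interaction_sub_le`. The group `U` is moved to the
other side of the inner product, where it becomes its adjoint group `U'`; this is why smoothness is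
needed for the conjugate potential as well. -/
lemma IsPerturbation.norm_sq_wave_sub_le (hG : IsUnitaryGroup G) (hU : IsPerturbation G Q U)
    (hU' : IsPerturbation G Q' U') (hQQ : ∀ x y, inner ℂ (Q' x) y = - inner ℂ x (Q y))
    (hQ' : ∀ x y, ‖inner ℂ y (Q' x)‖ ≤ ‖A x‖ * ‖A y‖) {D : ℝ} (hD : IsSmooth A U' D)
    {s t : ℝ} (hs : 0 ≤ s) (hst : s ≤ t) (f : E) :
    ‖U (-t) (G t f) - U (-s) (G s f)‖ ^ 2 ≤ D * ∫ τ in s..t, ‖A (G τ f)‖ ^ 2 := by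
  set g := U (-t) (G t f) - U (-s) (G s f) with hg
  have hcU : Continuous fun τ => ‖A (U' τ g)‖ :=
    (A.continuous.comp (hU'.isC0Group.continuous g)).norm
  have hcG : Continuous fun τ => ‖A (G τ f)‖ := (A.continuous.comp (hG.continuous f)).norm
  have h0 : ∀ t, inner ℂ g (U (-t) (G t f)) = inner ℂ (G (-t) (U' t g)) f := by
    intro t
    rw [← hU'.inner_left hG hU hQQ, hG.inner_left]
  have h1 : ‖g‖ ^ 2 ≤ ∫ τ in s..t, ‖A (U' τ g)‖ * ‖A (G τ f)‖ := by
    have h2 : ((‖g‖ : ℂ)) ^ 2 = starRingEnd ℂ (∫ τ in s..t, inner ℂ (G τ f) (Q' (U' τ g))) := by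
      rw [← hU'.inner_interaction_sub hG, inner_conj_symm, inner_sub_left, ← h0, ← h0,
        ← inner_sub_right]
      exact (inner_self_eq_norm_sq_to_K (𝕜 := ℂ) g).symm
    have h3 := congrArg norm h2
    rw [norm_pow, Complex.norm_real, norm_norm, RCLike.norm_conj] at h3
    rw [h3]
    exact intervalIntegral.norm_integral_le_of_norm_le hst
      (Eventually.of_forall fun τ _ => hQ' _ _) ((hcU.mul hcG).intervalIntegrable _ _)
  have h4 := sq_intervalIntegral_mul_le hcU hcG hst
  have h5 := hD.integral_le hU'.isC0Group hs hst g
  have h8 : 0 ≤ ∫ τ in s..t, ‖A (G τ f)‖ ^ 2 :=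
    intervalIntegral.integral_nonneg hst fun _ _ => by positivity
  have h0 : 0 ≤ ‖g‖ ^ 2 := by positivity
  have h9 : (‖g‖ ^ 2) * ‖g‖ ^ 2 ≤ (D * ∫ τ in s..t, ‖A (G τ f)‖ ^ 2) * ‖g‖ ^ 2 := by
    calc (‖g‖ ^ 2) * ‖g‖ ^ 2 = (‖g‖ ^ 2) ^ 2 := by ring
      _ ≤ (∫ τ in s..t, ‖A (U' τ g)‖ * ‖A (G τ f)‖) ^ 2 := by gcongr
      _ ≤ _ := h4
      _ ≤ (D * ‖g‖ ^ 2) * ∫ τ in s..t, ‖A (G τ f)‖ ^ 2 := by gcongr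
      _ = _ := by ring
  rcases h0.eq_or_lt with h0 | h0
  · rw [← h0]
    exact mul_nonneg hD.1 h8
  · exact le_of_mul_le_mul_right h9 h0

lemma norm_le_of_norm_sub_sq_le {x y : E} {c : ℝ} (hc : 0 ≤ c)
    (h : ‖x - y‖ ^ 2 ≤ c * ‖y‖ ^ 2) : ‖x‖ ≤ (Real.sqrt c + 1) * ‖y‖ := by
  have h1 : ‖x - y‖ ≤ Real.sqrt c * ‖y‖ := by
    refine le_of_sq_le_sq ?_ (by positivity)
    rw [mul_pow, Real.sq_sqrt hc]
    exact h
  have := norm_add_le (x - y) y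
  rw [sub_add_cancel] at this
  linarith

/-- Existence of the direct and inverse wave operators under two-sided smoothness, for a
perturbation `U` of `G` whose adjoint is the perturbation `U'`. -/
theorem IsPerturbation.exists_wave_operators (hG : IsUnitaryGroup G) (hU : IsPerturbation G Q U)
    (hU' : IsPerturbation G Q' U') (hQQ : ∀ x y, inner ℂ (Q' x) y = - inner ℂ x (Q y))
    (hQ : ∀ x y, ‖inner ℂ y (Q x)‖ ≤ ‖A x‖ * ‖A y‖)
    (hQ' : ∀ x y, ‖inner ℂ y (Q' x)‖ ≤ ‖A x‖ * ‖A y‖)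
    {D₀ D D' : ℝ} (hD₀ : IsSmooth A G D₀) (hD : IsSmooth A U D) (hD' : IsSmooth A U' D') :
    ∃ Ω Ω' : E →L[ℂ] E, (∀ f, Tendsto (fun t => U (-t) (G t f)) atTop (𝓝 (Ω f))) ∧
      (∀ f, Tendsto (fun t => G (-t) (U t f)) atTop (𝓝 (Ω' f))) ∧
      (∀ f, Ω (Ω' f) = f) ∧ (∀ f, Ω' (Ω f) = f) ∧ ∀ s f, U s (Ω f) = Ω (G s f) := by
  have hcU : ∀ f, Continuous fun τ => ‖A (U τ f)‖ ^ 2 := fun f =>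
    (A.continuous.comp (hU.isC0Group.continuous f)).norm.pow 2
  have hcG : ∀ f, Continuous fun τ => ‖A (G τ f)‖ ^ 2 := fun f =>
    (A.continuous.comp (hG.continuous f)).norm.pow 2
  have hx : ∀ f s t, 0 ≤ s → s ≤ t → ‖U (-t) (G t f) - U (-s) (G s f)‖ ^ 2 ≤
      D' * ∫ τ in s..t, ‖A (G τ f)‖ ^ 2 := fun f s t hs hst =>
    hU.norm_sq_wave_sub_le hG hU' hQQ hQ' hD' hs hst f
  have hy : ∀ f s t, 0 ≤ s → s ≤ t → ‖G (-t) (U t f) - G (-s) (U s f)‖ ^ 2 ≤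
      D₀ * ∫ τ in s..t, ‖A (U τ f)‖ ^ 2 := fun f s t hs hst =>
    hU.norm_sq_interaction_sub_le hG hQ hD₀.1 hD₀.2 hs hst f
  have hX : ∀ f, ∃ y, Tendsto (fun t => U (-t) (G t f)) atTop (𝓝 y) := fun f =>
    exists_tendsto_of_norm_sq_sub_le (hcG f) (fun t => by positivity)
      (fun t ht => hD₀.2 t ht f) (hx f)
  have hY : ∀ f, ∃ y, Tendsto (fun t => G (-t) (U t f)) atTop (𝓝 y) := fun f =>
    exists_tendsto_of_norm_sq_sub_le (hcU f) (fun t => by positivity)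
      (fun t ht => hD.2 t ht f) (hy f)
  have hXb : ∀ t, 0 ≤ t → ∀ f, ‖U (-t) (G t f)‖ ≤ (Real.sqrt (D' * D₀) + 1) * ‖f‖ := by
    intro t ht f
    refine norm_le_of_norm_sub_sq_le (mul_nonneg hD'.1 hD₀.1) ?_
    have h1 := hx f 0 t le_rfl ht
    rw [neg_zero, hG.isC0Group.zero_apply, hU.isC0Group.zero_apply] at h1
    refine h1.trans ?_
    rw [mul_assoc]
    exact mul_le_mul_of_nonneg_left (hD₀.2 t ht f) hD'.1
  have hYb : ∀ t, 0 ≤ t → ∀ f, ‖G (-t) (U t f)‖ ≤ (Real.sqrt (D₀ * D) + 1) * ‖f‖ := by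
    intro t ht f
    refine norm_le_of_norm_sub_sq_le (mul_nonneg hD₀.1 hD.1) ?_
    have h1 := hy f 0 t le_rfl ht
    rw [neg_zero, hU.isC0Group.zero_apply, hG.isC0Group.zero_apply] at h1
    refine h1.trans ?_
    rw [mul_assoc]
    exact mul_le_mul_of_nonneg_left (hD.2 t ht f) hD₀.1
  choose Ω hΩ using hX
  choose Ω' hΩ' using hY
  have build : ∀ (T : ℝ → E →L[ℂ] E) (S : E → E) (K : ℝ),
      (∀ f, Tendsto (fun t => T t f) atTop (𝓝 (S f))) → (∀ t, 0 ≤ t → ∀ f, ‖T t f‖ ≤ K * ‖f‖) →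
      ∃ S' : E →L[ℂ] E, ∀ f, S' f = S f := by
    intro T S K hT hK
    refine ⟨LinearMap.mkContinuous
      { toFun := S
        map_add' := fun f g => tendsto_nhds_unique (hT (f + g))
          (((hT f).add (hT g)).congr fun t => (map_add _ _ _).symm)
        map_smul' := fun c f => tendsto_nhds_unique (hT (c • f))
          (((hT f).const_smul c).congr fun t => (map_smul _ _ _).symm) } K fun f => ?_,
      fun f => rfl⟩
    exact le_of_tendsto (hT f).norm ((eventually_ge_atTop 0).mono fun t ht => hK t ht f)
  obtain ⟨S, hS⟩ := build (fun t => (U (-t)).comp (G t)) Ω _ hΩ hXb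
  obtain ⟨S', hS'⟩ := build (fun t => (G (-t)).comp (U t)) Ω' _ hΩ' hYb
  -- Uniform boundedness for `t ≥ 0` lets strong limits be multiplied, so the trivial identity `U
  -- (-t) G t G (-t) U t = 1` survives in the limit.
  have prod : ∀ (X : ℝ → E →L[ℂ] E) (K : ℝ) (y : ℝ → E) (y₀ z : E),
      (∀ t, 0 ≤ t → ∀ f, ‖X t f‖ ≤ K * ‖f‖) → Tendsto y atTop (𝓝 y₀) →
      Tendsto (fun t => X t y₀) atTop (𝓝 z) → Tendsto (fun t => X t (y t)) atTop (𝓝 z) := by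
    intro X K y y₀ z hK hy hz
    have h1 : Tendsto (fun t => X t (y t - y₀)) atTop (𝓝 0) := by
      have h2 : Tendsto (fun t => K * ‖y t - y₀‖) atTop (𝓝 (K * ‖y₀ - y₀‖)) :=
        ((hy.sub_const y₀).norm).const_mul K
      rw [sub_self, norm_zero, mul_zero] at h2
      exact squeeze_zero_norm' ((eventually_ge_atTop 0).mono fun t ht => hK t ht _) h2
    simpa using h1.add hz
  refine ⟨S, S', fun f => by rw [hS]; exact hΩ f, fun f => by rw [hS']; exact hΩ' f, fun f => ?_,
    fun f => ?_, fun s f => ?_⟩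
  · rw [hS, hS']
    have h1 := prod (fun t => (U (-t)).comp (G t)) _ _ _ _ hXb (hΩ' f) (hΩ (Ω' f))
    refine tendsto_nhds_unique h1 (tendsto_const_nhds.congr fun t => ?_)
    simp only [ContinuousLinearMap.comp_apply]
    rw [hG.isC0Group.apply_neg_apply, hU.isC0Group.neg_apply_apply]
  · rw [hS, hS']
    have h1 := prod (fun t => (G (-t)).comp (U t)) _ _ _ _ hYb (hΩ f) (hΩ' (Ω f))
    refine tendsto_nhds_unique h1 (tendsto_const_nhds.congr fun t => ?_)
    simp only [ContinuousLinearMap.comp_apply]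
    rw [hU.isC0Group.apply_neg_apply, hG.isC0Group.neg_apply_apply]
  · rw [hS, hS]
    have h1 : Tendsto (fun t => U s (U (-t) (G t f))) atTop (𝓝 (U s (Ω f))) :=
      ((U s).continuous.tendsto _).comp (hΩ f)
    -- The shift `t ↦ t - s` does not affect the limit; comparing it with `h1` gives the
    -- intertwining relation.
    have h2 : Tendsto (fun t => U (-(t - s)) (G (t - s) (G s f))) atTop (𝓝 (Ω (G s f))) :=
      (hΩ (G s f)).comp (tendsto_atTop_add_const_right _ (-s) tendsto_id)
    refine tendsto_nhds_unique h1 (h2.congr fun t => ?_)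
    rw [← hG.isC0Group.add_apply, ← hU.isC0Group.add_apply]
    congr 2
    · ring
    · rw [sub_add_cancel]

end Wave

/-! ### Stone's theorem through the bounded inverse of L + 1 -/

section Stone

variable {E : Type*} [NormedAddCommGroup E] [InnerProductSpace ℂ E] [CompleteSpace E]

lemma tendsto_zero_of_denseRange {α : Type*} {l : Filter α} {R : α → E →L[ℂ] E} {T : E →L[ℂ] E}
    (hT : DenseRange T) {M : ℝ} (hM : ∀ᶠ a in l, ∀ x, ‖R a x‖ ≤ M * ‖x‖)
    (h : ∀ x, Tendsto (fun a => R a (T x)) l (𝓝 0)) (x : E) :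
    Tendsto (fun a => R a x) l (𝓝 0) := by
  rw [Metric.tendsto_nhds]
  intro ε hε
  have hM0 : 0 < |M| + 1 := by positivity
  obtain ⟨y, hy⟩ := Metric.denseRange_iff.1 hT x (ε / (2 * (|M| + 1))) (by positivity)
  filter_upwards [hM, Metric.tendsto_nhds.1 (h y) (ε / 2) (by positivity)] with a ha hb
  rw [dist_zero_right] at hb ⊢
  rw [dist_eq_norm, lt_div_iff₀ (by positivity)] at hy
  have h1 : R a x = R a (x - T y) + R a (T y) := by rw [← map_add, sub_add_cancel]
  have h2 := ha (x - T y)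
  have h3 : M * ‖x - T y‖ ≤ (|M| + 1) * ‖x - T y‖ := by
    gcongr
    linarith [le_abs_self M]
  calc ‖R a x‖ ≤ ‖R a (x - T y)‖ + ‖R a (T y)‖ := by rw [h1]; exact norm_add_le _ _
    _ < ε := by linarith

/-- The function `τ exp (i t (1/τ - 1))` of a real variable `τ = re z`. -/
def stoneSymbol (t : ℝ) (z : ℂ) : ℂ :=
  (z.re : ℂ) * Complex.exp (Complex.I * ((t * (1 / z.re - 1) : ℝ) : ℂ))

lemma norm_exp_I_mul (x : ℝ) : ‖Complex.exp (Complex.I * x)‖ = 1 := by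
  rw [mul_comm, Complex.norm_exp_ofReal_mul_I]

lemma norm_exp_I_mul_sub_one_sub_le (x : ℝ) :
    ‖Complex.exp (Complex.I * x) - 1 - Complex.I * x‖ ≤ 2 * x ^ 2 := by
  rcases le_total |x| 1 with hx | hx
  · have h1 : ‖Complex.I * (x : ℂ)‖ = |x| := by simp
    have := Complex.norm_exp_sub_one_sub_id_le (x := Complex.I * x) (by rwa [h1])
    rw [h1, sq_abs] at this
    nlinarith [sq_nonneg x]
  · have h1 : ‖Complex.exp (Complex.I * x) - 1‖ ≤ |x| := Real.norm_exp_I_mul_ofReal_sub_one_le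
    have h2 : ‖Complex.I * (x : ℂ)‖ = |x| := by simp
    have h3 := norm_sub_le (Complex.exp (Complex.I * x) - 1) (Complex.I * x)
    rw [h2] at h3
    nlinarith [sq_abs x]

lemma norm_stoneSymbol (t : ℝ) (z : ℂ) : ‖stoneSymbol t z‖ = |z.re| := by
  rw [stoneSymbol, norm_mul, norm_exp_I_mul, mul_one, Complex.norm_real, Real.norm_eq_abs]

/-- The exponential oscillates at `re z = 0`; the factor `re z` restores continuity there. This is
why `T exp (i t (T⁻¹ - 1))` lies within the continuous functional calculus although the exponential
alone does not. -/
lemma continuous_stoneSymbol (t : ℝ) : Continuous (stoneSymbol t) := by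
  refine continuous_iff_continuousAt.2 fun z => ?_
  by_cases hz : z.re = 0
  · have h0 : stoneSymbol t z = 0 := by simp [stoneSymbol, hz]
    rw [ContinuousAt, h0]
    refine squeeze_zero_norm (a := fun w : ℂ => |w.re|) (fun w => (norm_stoneSymbol t w).le) ?_
    have : Tendsto (fun w : ℂ => |w.re|) (𝓝 z) (𝓝 |z.re|) :=
      (Complex.continuous_re.abs).tendsto z
    simpa [hz] using this
  · have h1 : ContinuousAt (fun w : ℂ => t * (1 / w.re - 1)) z := by
      refine continuousAt_const.mul (ContinuousAt.sub (continuousAt_const.div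
        Complex.continuous_re.continuousAt hz) continuousAt_const)
    have h2 : ContinuousAt (fun w : ℂ => (w.re : ℂ)) z :=
      (Complex.continuous_ofReal.comp Complex.continuous_re).continuousAt
    exact h2.mul ((continuousAt_const.mul
      (Complex.continuous_ofReal.continuousAt.comp h1)).cexp)

lemma stoneSymbol_mul (s t : ℝ) (z : ℂ) :
    stoneSymbol s z * stoneSymbol t z = stoneSymbol (s + t) z * (z.re : ℂ) := by
  have : Complex.exp (Complex.I * ((s + t) * (1 / z.re - 1) : ℝ)) =
      Complex.exp (Complex.I * ((s * (1 / z.re - 1) : ℝ) : ℂ)) *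
        Complex.exp (Complex.I * ((t * (1 / z.re - 1) : ℝ) : ℂ)) := by
    rw [← Complex.exp_add]
    push_cast
    ring_nf
  simp only [stoneSymbol]
  rw [this]
  ring

lemma star_stoneSymbol_mul (t : ℝ) (z : ℂ) :
    star (stoneSymbol t z) * stoneSymbol t z = (z.re : ℂ) * z.re := by
  have h := Complex.normSq_eq_conj_mul_self (z := stoneSymbol t z)
  rw [Complex.normSq_eq_norm_sq, sq, norm_stoneSymbol, abs_mul_abs_self] at h
  rw [Complex.star_def, ← h]
  push_cast
  ring

lemma stoneSymbol_zero (z : ℂ) : stoneSymbol 0 z = z.re := by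
  simp [stoneSymbol]

lemma norm_stoneSymbol_sub_le (t : ℝ) (z : ℂ) :
    ‖stoneSymbol t z - z.re‖ ≤ |t| * (1 + ‖z‖) := by
  by_cases hz : z.re = 0
  · simp only [stoneSymbol, hz, Complex.ofReal_zero, zero_mul, sub_zero, norm_zero]
    positivity
  · have h1 : stoneSymbol t z - z.re = (z.re : ℂ) *
        (Complex.exp (Complex.I * ((t * (1 / z.re - 1) : ℝ) : ℂ)) - 1) := by
      rw [stoneSymbol]
      ring
    rw [h1, norm_mul, Complex.norm_real, Real.norm_eq_abs]
    calc |z.re| * _ ≤ |z.re| * |t * (1 / z.re - 1)| := by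
          gcongr
          exact Real.norm_exp_I_mul_ofReal_sub_one_le
      _ = |t| * |1 - z.re| := by
          rw [← abs_mul, ← abs_mul]
          field_simp
      _ ≤ |t| * (1 + ‖z‖) := by
          gcongr
          have := abs_sub (1 : ℝ) z.re
          rw [abs_one] at this
          linarith [Complex.abs_re_le_norm z]

/-- The second factor `re z` compensates the square of `x = t (1/re z - 1)` in the Taylor remainder,
because `re z · x = t (1 - re z)` is bounded. -/
lemma norm_stoneSymbol_sub_sub_le (t : ℝ) (z : ℂ) :
    ‖(stoneSymbol t z - z.re - (t : ℂ) * (Complex.I * (1 - z.re))) * z.re‖ ≤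
      2 * t ^ 2 * (1 + ‖z‖) ^ 2 := by
  by_cases hz : z.re = 0
  · simp only [hz, Complex.ofReal_zero, mul_zero, norm_zero]
    positivity
  · have hz' : (z.re : ℂ) ≠ 0 := by exact_mod_cast hz
    have h1 : (stoneSymbol t z - z.re - (t : ℂ) * (Complex.I * (1 - z.re))) * z.re =
        (z.re : ℂ) * z.re *
        (Complex.exp (Complex.I * ((t * (1 / z.re - 1) : ℝ) : ℂ)) - 1 -
          Complex.I * ((t * (1 / z.re - 1) : ℝ) : ℂ)) := by
      rw [stoneSymbol]
      push_cast
      field_simp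
    rw [h1, norm_mul, norm_mul, Complex.norm_real, Real.norm_eq_abs, abs_mul_abs_self]
    calc z.re * z.re * _ ≤ z.re * z.re * (2 * (t * (1 / z.re - 1)) ^ 2) := by
          gcongr
          · exact mul_self_nonneg _
          · exact norm_exp_I_mul_sub_one_sub_le _
      _ = 2 * t ^ 2 * |1 - z.re| ^ 2 := by
          rw [sq_abs]
          field_simp
      _ ≤ 2 * t ^ 2 * (1 + ‖z‖) ^ 2 := by
          gcongr
          have := abs_sub (1 : ℝ) z.re
          rw [abs_one] at this
          linarith [Complex.abs_re_le_norm z]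

section SelfAdjoint

variable {T : E →L[ℂ] E}

/-- The operator `T exp (i t (T⁻¹ - 1))`. -/
def stoneOp (T : E →L[ℂ] E) (t : ℝ) : E →L[ℂ] E := cfc (stoneSymbol t) T

lemma cfc_re (hT : IsSelfAdjoint T) : cfc (fun z : ℂ => (z.re : ℂ)) T = T := by
  have hn : IsStarNormal T := hT.isStarNormal
  conv_rhs => rw [← cfc_id ℂ T]
  exact cfc_congr fun z hz => (hT.mem_spectrum_eq_re hz).symm

lemma norm_cfc_le_of_le (f : ℂ → ℂ) {c : ℝ → ℝ} (hc : Monotone c) (hc0 : ∀ r, 0 ≤ r → 0 ≤ c r)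
    (h : ∀ z, ‖f z‖ ≤ c ‖z‖) : ‖cfc f T‖ ≤ c (‖T‖ * ‖(1 : E →L[ℂ] E)‖) :=
  norm_cfc_le (hc0 _ (by positivity)) fun z hz =>
    (h z).trans (hc (spectrum.norm_le_norm_mul_of_mem hz))

lemma stoneOp_mul (hT : IsSelfAdjoint T) (s t : ℝ) :
    stoneOp T s * stoneOp T t = stoneOp T (s + t) * T := by
  have hs := (continuous_stoneSymbol s).continuousOn (s := spectrum ℂ T)
  have ht := (continuous_stoneSymbol t).continuousOn (s := spectrum ℂ T)
  have hst := (continuous_stoneSymbol (s + t)).continuousOn (s := spectrum ℂ T)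
  have hr : ContinuousOn (fun z : ℂ => (z.re : ℂ)) (spectrum ℂ T) :=
    (Complex.continuous_ofReal.comp Complex.continuous_re).continuousOn
  have h1 : stoneOp T (s + t) * T = stoneOp T (s + t) * cfc (fun z : ℂ => (z.re : ℂ)) T := by
    rw [cfc_re hT]
  rw [h1, stoneOp, stoneOp, stoneOp, ← cfc_mul _ _ T hs ht, ← cfc_mul _ _ T hst hr]
  simp only [stoneSymbol_mul]

lemma stoneOp_comm (hT : IsSelfAdjoint T) (t : ℝ) : stoneOp T t * T = T * stoneOp T t := by
  have ht := (continuous_stoneSymbol t).continuousOn (s := spectrum ℂ T)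
  have hr : ContinuousOn (fun z : ℂ => (z.re : ℂ)) (spectrum ℂ T) :=
    (Complex.continuous_ofReal.comp Complex.continuous_re).continuousOn
  have h1 : stoneOp T t * cfc (fun z : ℂ => (z.re : ℂ)) T =
      cfc (fun z : ℂ => (z.re : ℂ)) T * stoneOp T t := by
    rw [stoneOp, ← cfc_mul _ _ T ht hr, ← cfc_mul _ _ T hr ht]
    simp only [mul_comm]
  rwa [cfc_re hT] at h1

lemma stoneOp_zero (hT : IsSelfAdjoint T) : stoneOp T 0 = T := by
  rw [stoneOp]
  conv_rhs => rw [← cfc_re hT]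
  simp only [funext stoneSymbol_zero]

/-- This makes `T x ↦ stoneOp T t x` a well-defined isometry on the range of `T`. -/
lemma norm_stoneOp_apply (hT : IsSelfAdjoint T) (t : ℝ) (x : E) : ‖stoneOp T t x‖ = ‖T x‖ := by
  have ht := (continuous_stoneSymbol t).continuousOn (s := spectrum ℂ T)
  have hr : ContinuousOn (fun z : ℂ => (z.re : ℂ)) (spectrum ℂ T) :=
    (Complex.continuous_ofReal.comp Complex.continuous_re).continuousOn
  have h1 : star (stoneOp T t) * stoneOp T t = star T * T := by
    rw [hT.star_eq]
    have h2 : T * T = cfc (fun z : ℂ => (z.re : ℂ)) T * cfc (fun z : ℂ => (z.re : ℂ)) T := by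
      rw [cfc_re hT]
    rw [h2, stoneOp, ← cfc_star, ← cfc_mul _ _ T ht.star ht, ← cfc_mul _ _ T hr hr]
    simp only [star_stoneSymbol_mul]
  have h2 : ∀ S : E →L[ℂ] E, ‖S x‖ ^ 2 = (inner ℂ ((star S * S) x) x).re := by
    intro S
    rw [mul_apply_eq_comp, ContinuousLinearMap.star_eq_adjoint,
      ContinuousLinearMap.adjoint_inner_left, inner_self_eq_norm_sq_to_K]
    exact (Complex.ofReal_re _).symm.trans (by push_cast; rfl)
  have h3 := h2 (stoneOp T t)
  rw [h1, ← h2 T] at h3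
  exact (sq_eq_sq₀ (norm_nonneg _) (norm_nonneg _)).1 h3

lemma norm_stoneOp_sub_le (hT : IsSelfAdjoint T) :
    ∃ M : ℝ, 0 ≤ M ∧ (∀ t, ‖stoneOp T t - T‖ ≤ |t| * M) ∧
      ∀ t : ℝ, ‖(stoneOp T t - T - (t : ℂ) • (Complex.I • (1 - T))) * T‖ ≤ 2 * t ^ 2 * M := by
  have hn : IsStarNormal T := hT.isStarNormal
  set r := ‖T‖ * ‖(1 : E →L[ℂ] E)‖ with hr0
  have hr0 : 0 ≤ r := by positivity
  have hr : ContinuousOn (fun z : ℂ => (z.re : ℂ)) (spectrum ℂ T) :=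
    (Complex.continuous_ofReal.comp Complex.continuous_re).continuousOn
  have e1 : ∀ t, cfc (fun z => stoneSymbol t z - z.re) T = stoneOp T t - T := by
    intro t
    have ht := (continuous_stoneSymbol t).continuousOn (s := spectrum ℂ T)
    rw [cfc_sub _ _ T ht hr, cfc_re hT, stoneOp]
  have e2 : ∀ t : ℝ, cfc (fun z : ℂ => (stoneSymbol t z - z.re -
      (t : ℂ) * (Complex.I * (1 - z.re))) * z.re) T =
      (stoneOp T t - T - (t : ℂ) • (Complex.I • (1 - T))) * T := by
    intro t
    have ht := (continuous_stoneSymbol t).continuousOn (s := spectrum ℂ T)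
    have h1 : ContinuousOn (fun z : ℂ => 1 - (z.re : ℂ)) (spectrum ℂ T) :=
      continuousOn_const.sub hr
    have h2 : ContinuousOn (fun z : ℂ => Complex.I * (1 - (z.re : ℂ))) (spectrum ℂ T) :=
      continuousOn_const.mul h1
    have h3 : ContinuousOn (fun z : ℂ => (t : ℂ) * (Complex.I * (1 - (z.re : ℂ))))
      (spectrum ℂ T) := continuousOn_const.mul h2
    have h4 : ContinuousOn (fun z : ℂ => stoneSymbol t z - z.re) (spectrum ℂ T) := ht.sub hr
    have h5 : ContinuousOn (fun z : ℂ => stoneSymbol t z - z.re -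
      (t : ℂ) * (Complex.I * (1 - z.re))) (spectrum ℂ T) := h4.sub h3
    rw [cfc_mul _ _ T h5 hr, cfc_sub _ _ T h4 h3, e1,
      cfc_const_mul _ _ T h2, cfc_const_mul _ _ T h1, cfc_sub _ _ T continuousOn_const hr,
      cfc_re hT, cfc_const (1 : ℂ) T, map_one]
  refine ⟨(1 + r) ^ 2, by positivity, fun t => ?_, fun t => ?_⟩
  · rw [← e1]
    refine (norm_cfc_le_of_le (c := fun r => |t| * (1 + r)) _
      (fun a b hab => by dsimp only; gcongr) (fun r hr => by positivity)
      (norm_stoneSymbol_sub_le t)).trans ?_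
    gcongr
    nlinarith
  · rw [← e2]
    have hmono : Monotone fun r : ℝ => 2 * t ^ 2 * (1 + max r 0) ^ 2 := by
      intro a b hab
      dsimp only
      gcongr
    refine (norm_cfc_le_of_le (c := fun r => 2 * t ^ 2 * (1 + max r 0) ^ 2) _ hmono
      (fun r hr => by positivity) (fun z => ?_)).trans ?_
    · rw [max_eq_left (norm_nonneg z)]
      exact norm_stoneSymbol_sub_sub_le t z
    · rw [max_eq_left hr0]

end SelfAdjoint

/-- A symmetric operator `L` with `L + 1` onto generates a unitary group `exp (i t L)`. -/
theorem exists_unitaryGroup (L : E →ₗ.[ℂ] E)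
    (hsymm : ∀ f h f' h', (f, h) ∈ L.graph → (f', h') ∈ L.graph → inner ℂ h f' = inner ℂ f h')
    (hsurj : ∀ g, ∃ f h, (f, h) ∈ L.graph ∧ f + h = g) :
    ∃ G : ℝ → E →L[ℂ] E, IsUnitaryGroup G ∧
      ∀ f h, (f, h) ∈ L.graph ↔ HasDerivAt (fun t => G t f) (Complex.I • h) 0 := by
  -- A vector in the kernel of `L + 1` is orthogonal to the range of `L + 1`, which is everything.
  have hinj : ∀ f h, (f, h) ∈ L.graph → f + h = 0 → f = 0 := by
    intro f h hfh h0
    obtain ⟨f', h', hf', hg⟩ := hsurj f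
    have h1 : inner ℂ f f = (0 : ℂ) := by
      nth_rw 2 [← hg]
      rw [inner_add_right, ← hsymm f h f' h' hfh hf', ← inner_add_left, h0, inner_zero_left]
    exact inner_self_eq_zero.1 h1
  have huniq : ∀ f h f' h', (f, h) ∈ L.graph → (f', h') ∈ L.graph → f + h = f' + h' → f = f' := by
    intro f h f' h' hf hf' he
    have h1 := L.graph.sub_mem hf hf'
    refine sub_eq_zero.1 (hinj _ _ h1 ?_)
    rw [sub_add_sub_comm, he, sub_self]
  choose τ η hτ hτη using hsurj
  have hη : ∀ g, η g = g - τ g := fun g => eq_sub_of_add_eq' (hτη g)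
  let T₀ : E →ₗ[ℂ] E :=
    { toFun := τ
      map_add' := fun x y => by
        refine huniq _ _ _ _ (hτ (x + y)) (L.graph.add_mem (hτ x) (hτ y)) ?_
        rw [hτη]
        change x + y = τ x + τ y + (η x + η y)
        rw [add_add_add_comm, hτη, hτη]
      map_smul' := fun c x => by
        refine huniq _ _ _ _ (hτ (c • x)) (L.graph.smul_mem c (hτ x)) ?_
        rw [hτη]
        change c • x = c • τ x + c • η x
        rw [← smul_add, hτη] }
  have hT₀ : T₀.IsSymmetric := by
    intro x y
    change inner ℂ (τ x) y = inner ℂ x (τ y)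
    calc inner ℂ (τ x) y = inner ℂ (τ x) (τ y + η y) := by rw [hτη]
      _ = inner ℂ (τ x + η x) (τ y) := by
        rw [inner_add_left, inner_add_right, hsymm _ _ _ _ (hτ x) (hτ y)]
      _ = inner ℂ x (τ y) := by rw [hτη]
  -- `T = (L + 1)⁻¹` is symmetric and everywhere defined, hence bounded by Hellinger–Toeplitz.
  set T : E →L[ℂ] E := ⟨T₀, hT₀.continuous⟩ with hTdef
  have hT : IsSelfAdjoint T := ContinuousLinearMap.isSelfAdjoint_iff_isSymmetric.mpr hT₀
  have hTg : ∀ x, (T x, x - T x) ∈ L.graph := fun x => by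
    have := hτ x
    rwa [hη] at this
  have hTs : ∀ x y, inner ℂ (T x) y = inner ℂ x (T y) := hT₀
  -- The orthogonal complement of the range is the kernel of `T`, and `T x = 0` puts `(0, x)` in the
  -- graph of `L`.
  have hdense : DenseRange T := by
    have h1 : (LinearMap.range (T : E →ₗ[ℂ] E)).topologicalClosure = ⊤ := by
      rw [Submodule.topologicalClosure_eq_top_iff, Submodule.eq_bot_iff]
      intro x hx
      have h2 : T x = 0 := by
        rw [← inner_self_eq_zero (𝕜 := ℂ), hTs]
        exact Submodule.inner_left_of_mem_orthogonal (K := LinearMap.range (T : E →ₗ[ℂ] E))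
          ⟨T x, rfl⟩ hx
      have h3 := hTg x
      rw [h2, sub_zero] at h3
      exact L.graph_fst_eq_zero_snd h3 rfl
    have h2 := Submodule.dense_iff_topologicalClosure_eq_top.2 h1
    exact h2
  let G : ℝ → E →L[ℂ] E := fun t => (stoneOp T t : E →ₗ[ℂ] E).extendOfNorm (T : E →ₗ[ℂ] E)
  have hGT : ∀ t x, G t (T x) = stoneOp T t x := fun t x =>
    LinearMap.extendOfNorm_eq (f := (stoneOp T t : E →ₗ[ℂ] E)) (e := (T : E →ₗ[ℂ] E)) hdense
      ⟨1, fun x => by simpa using (norm_stoneOp_apply hT t x).le⟩ x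
  have hnorm : ∀ t x, ‖G t x‖ = ‖x‖ := by
    intro t x
    refine hdense.induction_on (p := fun x => ‖G t x‖ = ‖x‖) x
      (isClosed_eq (by fun_prop) (by fun_prop)) fun y => ?_
    rw [hGT, norm_stoneOp_apply hT]
  have hzero : G 0 = ContinuousLinearMap.id ℂ E := by
    ext x
    refine hdense.induction_on (p := fun x => G 0 x = ContinuousLinearMap.id ℂ E x) x
      (isClosed_eq (by fun_prop) (by fun_prop)) fun y => ?_
    rw [hGT, stoneOp_zero hT]
    rfl
  have hadd : ∀ s t, G (s + t) = (G s).comp (G t) := by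
    intro s t
    ext x
    refine hdense.induction_on (p := fun x => G (s + t) x = (G s).comp (G t) x) x
      (isClosed_eq (by fun_prop) (by fun_prop)) fun y => ?_
    refine hdense.induction_on (p := fun y => G (s + t) (T y) = (G s).comp (G t) (T y)) y
      (isClosed_eq (by fun_prop) (by fun_prop)) fun z => ?_
    have h1 := congrArg (fun S : E →L[ℂ] E => S z) (stoneOp_mul hT s t)
    have h2 := congrArg (fun S : E →L[ℂ] E => S z) (stoneOp_comm hT t)
    simp only [mul_apply_eq_comp] at h1 h2
    rw [ContinuousLinearMap.comp_apply, hGT, hGT, h2, hGT, h1]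
  obtain ⟨M, hM, hM1, hM2⟩ := norm_stoneOp_sub_le hT
  have hcont0 : ∀ x, Tendsto (fun t => G t x) (𝓝 0) (𝓝 x) := by
    intro x
    have h1 := tendsto_zero_of_denseRange (l := 𝓝 (0 : ℝ))
      (R := fun t => G t - ContinuousLinearMap.id ℂ E) hdense (M := 2)
      (Eventually.of_forall fun t x => ?_) (fun y => ?_) x
    · simpa using h1.add_const x
    · refine (norm_sub_le _ _).trans ?_
      change ‖G t x‖ + ‖x‖ ≤ 2 * ‖x‖
      rw [hnorm, two_mul]
    · refine squeeze_zero_norm (a := fun t : ℝ => |t| * M * ‖y‖) (fun t => ?_) ?_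
      · have := (stoneOp T t - T).le_of_opNorm_le (hM1 t) y
        simpa [hGT] using this
      · have : Continuous fun t : ℝ => |t| * M * ‖y‖ := by fun_prop
        simpa using this.tendsto 0
  have hG : IsUnitaryGroup G := by
    refine ⟨hzero, hadd, fun f => continuous_iff_continuousAt.2 fun t => ?_, hnorm⟩
    have h1 : Tendsto (fun s : ℝ => G t (G (s - t) f)) (𝓝 t) (𝓝 (G t f)) := by
      refine ((G t).continuous.tendsto f).comp ((hcont0 f).comp ?_)
      have : Tendsto (fun s : ℝ => s - t) (𝓝 t) (𝓝 (t - t)) := tendsto_id.sub_const t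
      rwa [sub_self] at this
    refine h1.congr fun s => ?_
    rw [← ContinuousLinearMap.comp_apply, ← hadd, add_sub_cancel]
  have hderiv : ∀ x, HasDerivAt (fun t => G t (T x)) (Complex.I • (x - T x)) 0 := by
    intro x
    rw [hasDerivAt_iff_tendsto_slope_zero]
    -- The difference quotients of `stoneOp T t` are bounded uniformly in `t`, while the quadratic
    -- remainder estimate needs one more factor `T`. Density of the range of `T` then gives
    -- convergence at every `x`.
    have h1 := tendsto_zero_of_denseRange (l := 𝓝[≠] (0 : ℝ))
      (R := fun t : ℝ => (t⁻¹ : ℂ) • (stoneOp T t - T) - Complex.I • (1 - T)) hdense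
      (M := M + ‖Complex.I • (1 - T)‖) (eventually_mem_nhdsWithin.mono fun t ht x => ?_)
      (fun y => ?_) x
    · have h2 := h1.add_const (Complex.I • (x - T x))
      rw [zero_add] at h2
      refine h2.congr fun t => ?_
      have e1 : (t⁻¹ : ℂ) = ((t⁻¹ : ℝ) : ℂ) := by push_cast; rfl
      rw [zero_add, hGT, hzero, ContinuousLinearMap.id_apply]
      simp only [sub_apply, smul_apply,
        one_apply_eq_self, sub_add_cancel]
      rw [e1, Complex.coe_smul]
    · have ht' : (t : ℝ) ≠ 0 := ht
      refine ContinuousLinearMap.le_of_opNorm_le _ ((norm_sub_le _ _).trans ?_) x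
      gcongr
      rw [norm_smul, norm_inv, Complex.norm_real, Real.norm_eq_abs]
      calc |t|⁻¹ * _ ≤ |t|⁻¹ * (|t| * M) := by
            gcongr
            exact hM1 t
        _ = M := by
            have := abs_ne_zero.2 ht'
            field_simp
    · refine squeeze_zero_norm' (a := fun t : ℝ => 2 * |t| * M * ‖y‖)
        (eventually_mem_nhdsWithin.mono fun t ht => ?_) ?_
      · have ht' : (t : ℝ) ≠ 0 := ht
        have ht'' : (t : ℂ) ≠ 0 := by exact_mod_cast ht'
        have e1 : ((t⁻¹ : ℂ) • (stoneOp T t - T) - Complex.I • (1 - T)) (T y) = (t⁻¹ : ℂ) •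
            (((stoneOp T t - T - (t : ℂ) • (Complex.I • (1 - T))) * T) y) := by
          have e2 : ∀ (P Q : E →L[ℂ] E) (z : E), ((t⁻¹ : ℂ) • P - Q) z =
              (t⁻¹ : ℂ) • ((P - (t : ℂ) • Q) z) := by
            intro P Q z
            rw [sub_apply, sub_apply, smul_sub, smul_apply, smul_apply, smul_smul,
              inv_mul_cancel₀ ht'', one_smul]
          rw [e2, mul_apply_eq_comp]
        rw [e1, norm_smul, norm_inv, Complex.norm_real, Real.norm_eq_abs]
        have h2 := ContinuousLinearMap.le_of_opNorm_le _ (hM2 t) y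
        calc |t|⁻¹ * _ ≤ |t|⁻¹ * (2 * t ^ 2 * M * ‖y‖) := by gcongr
          _ = _ := by
            rw [← sq_abs]
            have := abs_ne_zero.2 ht'
            field_simp
      · have : Continuous fun t : ℝ => 2 * |t| * M * ‖y‖ := by fun_prop
        have := this.tendsto 0
        simp only [abs_zero, mul_zero, zero_mul] at this
        exact this.mono_left nhdsWithin_le_nhds
  have hgraph : ∀ f h, (f, h) ∈ L.graph → T (f + h) = f ∧ f + h - T (f + h) = h := by
    intro f h hfh
    have h1 : T (f + h) = f :=
      huniq _ _ _ _ (hTg (f + h)) hfh (by rw [add_sub_cancel])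
    exact ⟨h1, by rw [h1, add_sub_cancel_left]⟩
  refine ⟨G, hG, fun f h => ⟨fun hfh => ?_, fun hd => ?_⟩⟩
  · obtain ⟨h1, h2⟩ := hgraph f h hfh
    have := hderiv (f + h)
    rwa [h2, h1] at this
  -- The generator is no larger than `L`: `f - f'` would satisfy `L (f - f') = -(f - f')` in the
  -- generator sense, and skew-symmetry against `T (f - f')` forces it to vanish.
  · set f' := T (f + h) with hf'
    have hd' := hderiv (f + h)
    have hw : HasDerivAt (fun t => G t (f - f')) (-(Complex.I • (f - f'))) 0 := by
      refine ((hd.sub hd').congr_of_eventuallyEq (Eventually.of_forall fun t => ?_)).congr_deriv ?_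
      · simp [hf']
      · rw [← smul_sub, ← smul_neg]
        congr 1
        rw [← hf']
        abel
    have hz : f - f' = 0 := by
      rw [← inner_self_eq_zero (𝕜 := ℂ)]
      have h1 := hG.inner_generator hw (hderiv (f - f'))
      simp only [inner_smul_right, inner_sub_right, inner_neg_left, inner_smul_left,
        Complex.conj_I] at h1
      have h2 : Complex.I * inner ℂ (f - f') (f - f') = 0 := by
        rw [inner_sub_right]
        linear_combination h1
      exact (mul_eq_zero.1 h2).resolve_left Complex.I_ne_zero
    have h1 : f = f' := sub_eq_zero.1 hz
    have h2 := hTg (f + h)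
    rw [← hf', ← h1, add_sub_cancel_left] at h2
    exact h2

end Stone

/-! ### Calculus of primitives of locally integrable functions -/

section Primitive

open scoped ComplexConjugate

lemma absolutelyContinuousOnInterval_integral {f : ℝ → ℂ} {a b : ℝ}
    (hf : IntervalIntegrable f volume a b) :
    AbsolutelyContinuousOnInterval (fun x => ∫ t in a..x, f t) a b := by
  have hn := hf.norm.absolutelyContinuousOnInterval_intervalIntegral (c := a) left_mem_uIcc
  rw [absolutelyContinuousOnInterval_iff] at hn ⊢
  intro ε hε
  obtain ⟨δ, hδ, H⟩ := hn ε hε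
  refine ⟨δ, hδ, fun E hE hl => lt_of_le_of_lt (Finset.sum_le_sum fun i hi => ?_) (H E hE hl)⟩
  obtain ⟨h1, h2⟩ := hE.1 i hi
  have i1 : IntervalIntegrable f volume a (E.2 i).1 :=
    hf.mono_set (uIcc_subset_uIcc_left h1)
  have i2 : IntervalIntegrable f volume a (E.2 i).2 :=
    hf.mono_set (uIcc_subset_uIcc_left h2)
  rw [dist_eq_norm, Real.dist_eq, intervalIntegral.integral_interval_sub_left i1 i2,
    intervalIntegral.integral_interval_sub_left i1.norm i2.norm]
  exact intervalIntegral.norm_integral_le_abs_integral_norm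

/-- `f` is a primitive of the locally integrable function `f'` on `[0, ∞)`. -/
structure IsPrimitive (f f' : ℝ → ℂ) : Prop where
  intervalIntegrable : ∀ R, 0 ≤ R → IntervalIntegrable f' volume 0 R
  eq : ∀ x, 0 ≤ x → f x = f 0 + ∫ t in (0 : ℝ)..x, f' t

namespace IsPrimitive

variable {f f' g g' : ℝ → ℂ}

lemma const (c : ℂ) : IsPrimitive (fun _ => c) fun _ => 0 :=
  ⟨fun R _ => _root_.intervalIntegrable_const, fun x _ => by simp⟩

lemma add (hf : IsPrimitive f f') (hg : IsPrimitive g g') :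
    IsPrimitive (fun x => f x + g x) fun x => f' x + g' x := by
  refine ⟨fun R hR => (hf.1 R hR).add (hg.1 R hR), fun x hx => ?_⟩
  rw [intervalIntegral.integral_add (hf.1 x hx) (hg.1 x hx), hf.2 x hx, hg.2 x hx]
  ring

lemma sub (hf : IsPrimitive f f') (hg : IsPrimitive g g') :
    IsPrimitive (fun x => f x - g x) fun x => f' x - g' x := by
  refine ⟨fun R hR => (hf.1 R hR).sub (hg.1 R hR), fun x hx => ?_⟩
  rw [intervalIntegral.integral_sub (hf.1 x hx) (hg.1 x hx), hf.2 x hx, hg.2 x hx]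
  ring

lemma star (hf : IsPrimitive f f') :
    IsPrimitive (fun x => conj (f x)) fun x => conj (f' x) := by
  refine ⟨fun R hR => ?_, fun x hx => ?_⟩
  · have := hf.1 R hR
    rw [intervalIntegrable_iff] at this ⊢
    exact (Complex.conjCLE.toContinuousLinearMap.integrable_comp this)
  · rw [intervalIntegral.integral_of_le hx, integral_conj, ← intervalIntegral.integral_of_le hx,
      ← map_add, ← hf.2 x hx]

lemma continuousOn (hf : IsPrimitive f f') : ContinuousOn f (Ici 0) := by
  intro x hx
  have hx' : (0 : ℝ) ≤ x := hx
  have h1 := hf.1 (x + 1) (by linarith)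
  have h2 := intervalIntegral.continuousOn_primitive_interval' h1 left_mem_uIcc
  rw [uIcc_of_le (by linarith)] at h2
  have h3 : ContinuousWithinAt (fun y => f 0 + ∫ t in (0 : ℝ)..y, f' t) (Ici 0) x := by
    refine (continuousWithinAt_const.add (h2 x ⟨hx', by linarith⟩)).mono_of_mem_nhdsWithin ?_
    filter_upwards [self_mem_nhdsWithin,
      mem_nhdsWithin_of_mem_nhds (Iio_mem_nhds (show x < x + 1 by linarith))] with y hy hy'
    exact ⟨hy, le_of_lt hy'⟩
  exact h3.congr (fun y hy => hf.2 y hy) (hf.2 x hx')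

/-- Derivatives exist only almost everywhere here. The product minus the integral of the claimed
derivative is absolutely continuous with derivative zero almost everywhere, hence constant. -/
lemma mul (hf : IsPrimitive f f') (hg : IsPrimitive g g') :
    IsPrimitive (fun x => f x * g x) fun x => f' x * g x + f x * g' x := by
  have hi : ∀ R, 0 ≤ R →
      IntervalIntegrable (fun x => f' x * g x + f x * g' x) volume 0 R := by
    intro R hR
    refine IntervalIntegrable.add ?_ ?_
    · exact (hf.1 R hR).mul_continuousOn
        (hg.continuousOn.mono (by rw [uIcc_of_le hR]; exact Icc_subset_Ici_self))
    · exact (hg.1 R hR).continuousOn_mul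
        (hf.continuousOn.mono (by rw [uIcc_of_le hR]; exact Icc_subset_Ici_self))
  refine ⟨hi, fun R hR => ?_⟩
  have hconst : ∀ c : ℂ, AbsolutelyContinuousOnInterval (fun _ : ℝ => c) 0 R := fun c => by
    rw [absolutelyContinuousOnInterval_iff]
    exact fun ε hε => ⟨1, one_pos, fun E _ _ => by simpa using hε⟩
  have aF := (hconst (f 0)).add (absolutelyContinuousOnInterval_integral (hf.1 R hR))
  have aG := (hconst (g 0)).add (absolutelyContinuousOnInterval_integral (hg.1 R hR))
  have aP := (aF.smul aG).sub (absolutelyContinuousOnInterval_integral (hi R hR))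
  obtain ⟨C, hC⟩ := aP.const_of_ae_hasDerivAt_zero (by
    have hne0 : ∀ᵐ x : ℝ, x ≠ 0 := by simp [ae_iff, measure_singleton]
    filter_upwards [(hf.1 R hR).ae_hasDerivAt_integral, (hg.1 R hR).ae_hasDerivAt_integral,
      (hi R hR).ae_hasDerivAt_integral, hne0] with x h1 h2 h3 h0 hx
    have d1 := ((h1 hx 0 left_mem_uIcc).const_add (f 0))
    have d2 := ((h2 hx 0 left_mem_uIcc).const_add (g 0))
    have d3 := h3 hx 0 left_mem_uIcc
    rw [uIcc_of_le hR] at hx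
    have := (d1.mul d2).sub d3
    rw [← hf.2 x hx.1, ← hg.2 x hx.1, sub_self] at this
    exact this)
  have e0 := hC 0 left_mem_uIcc
  have eR := hC R right_mem_uIcc
  simp only [Pi.sub_apply, smul_eq_mul, Pi.mul_apply, Pi.add_apply,
    intervalIntegral.integral_same, add_zero, sub_zero] at e0 eR
  rw [← hf.2 R hR, ← hg.2 R hR, ← e0] at eR
  linear_combination eR

lemma of_hasDerivWithinAt (hd : ∀ x, 0 ≤ x → HasDerivWithinAt f (f' x) (Ici 0) x)
    (hc : ContinuousOn f' (Ici 0)) : IsPrimitive f f' := by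
  have hi : ∀ R, 0 ≤ R → IntervalIntegrable f' volume 0 R := fun R hR =>
    (hc.mono (by rw [uIcc_of_le hR]; exact Icc_subset_Ici_self)).intervalIntegrable
  refine ⟨hi, fun x hx => ?_⟩
  rw [intervalIntegral.integral_eq_sub_of_hasDeriv_right_of_le hx
    (fun y hy => (hd y hy.1).continuousWithinAt.mono Icc_subset_Ici_self)
    (fun y hy => ((hd y hy.1.le).hasDerivAt (Ici_mem_nhds hy.1)).hasDerivWithinAt) (hi x hx)]
  ring

lemma hasDerivWithinAt (hf : IsPrimitive f f') (hc : ContinuousOn f' (Ici 0)) {x : ℝ}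
    (hx : 0 ≤ x) : HasDerivWithinAt f (f' x) (Ici 0) x := by
  have hsub : HasDerivWithinAt (fun y => f 0 + ∫ t in (0 : ℝ)..y, f' t) (f' x) (Ici 0) x := by
    -- A continuous extension to the left of 0, so that the endpoint needs no separate treatment.
    set φ : ℝ → ℂ := fun t => f' (max t 0) with hφ
    have hcφ : Continuous φ := by
      refine hc.comp_continuous (by fun_prop) fun t => mem_Ici.2 (le_max_right _ _)
    have h1 : HasDerivAt (fun y => f 0 + ∫ t in (0 : ℝ)..y, φ t) (φ x) x :=
      (intervalIntegral.integral_hasDerivAt_right (hcφ.intervalIntegrable _ _)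
        (hcφ.stronglyMeasurableAtFilter _ _) hcφ.continuousAt).const_add _
    have h2 : φ x = f' x := by simp [hφ, hx]
    rw [h2] at h1
    have h3 : ∀ y, 0 ≤ y → ∫ t in (0 : ℝ)..y, f' t = ∫ t in (0 : ℝ)..y, φ t := fun y hy =>
      intervalIntegral.integral_congr fun t ht => by
        rw [uIcc_of_le hy] at ht
        simp [hφ, ht.1]
    exact h1.hasDerivWithinAt.congr (fun y hy => by rw [h3 y hy]) (by rw [h3 x hx])
  exact hsub.congr (fun y hy => hf.2 y hy) (hf.2 x hx)

lemma congr_deriv (hf : IsPrimitive f f') (h : ∀ x, 0 ≤ x → f' x = g' x) :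
    IsPrimitive f g' := by
  refine ⟨fun R hR => (hf.1 R hR).congr fun x hx => ?_, fun x hx => ?_⟩
  · rw [uIoc_of_le hR] at hx
    exact h x hx.1.le
  · rw [hf.2 x hx]
    congr 1
    exact intervalIntegral.integral_congr fun t ht => h t (by rw [uIcc_of_le hx] at ht; exact ht.1)

lemma congr_deriv_ae (hf : IsPrimitive f f') (h : f' =ᵐ[halfLine] g') :
    IsPrimitive f g' := by
  refine ⟨fun R hR => (hf.1 R hR).congr_ae ?_, fun x hx => ?_⟩
  · rw [uIoc_of_le hR]
    exact ae_mono (Measure.restrict_mono Ioc_subset_Ioi_self le_rfl) h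
  · rw [hf.2 x hx, integral_congr_coe h hx]

lemma congr_left (hf : IsPrimitive f f') (h : ∀ x, 0 ≤ x → f x = g x) : IsPrimitive g f' :=
  ⟨hf.1, fun x hx => by rw [← h x hx, ← h 0 le_rfl, hf.2 x hx]⟩

lemma const_mul (hf : IsPrimitive f f') (c : ℂ) :
    IsPrimitive (fun x => c * f x) fun x => c * f' x := by
  simpa using (IsPrimitive.const c).mul hf

end IsPrimitive

end Primitive

/-! ### The Dirichlet Laplacian is symmetric and L₀ + 1 is onto -/

section DirichletLaplacian

open scoped ComplexConjugate

lemma not_integrableOn_of_le {φ : ℝ → ℝ} {c R : ℝ} (hc : 0 < c) (hφ : IntegrableOn φ (Ioi 0))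
    (hR : 0 ≤ R) (h : ∀ x, R ≤ x → c ≤ φ x) : False := by
  have h1 : IntegrableOn φ (Ioi R) := hφ.mono_set (Ioi_subset_Ioi hR)
  have h2 : IntegrableOn (fun _ : ℝ => c) (Ioi R) := by
    refine Integrable.mono' h1 aestronglyMeasurable_const ?_
    filter_upwards [ae_restrict_mem measurableSet_Ioi] with x hx
    rw [Real.norm_of_nonneg hc.le]
    exact h x (le_of_lt hx)
  rw [integrableOn_const_iff] at h2
  simp [hc.ne'] at h2

lemma tendsto_intervalIntegral_Ioi {E : Type*} [NormedAddCommGroup E] [NormedSpace ℝ E]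
    {φ : ℝ → E} (hφ : IntegrableOn φ (Ioi 0)) :
    Tendsto (fun R : ℝ => ∫ t in (0 : ℝ)..R, φ t) atTop (𝓝 (∫ t in Ioi 0, φ t)) :=
  intervalIntegral_tendsto_integral_Ioi 0 hφ tendsto_id

lemma integrableOn_Ioi_of_intervalIntegral_le {φ : ℝ → ℝ} (h0 : ∀ x, 0 ≤ φ x)
    (hi : ∀ R, 0 ≤ R → IntervalIntegrable φ volume 0 R) {M : ℝ}
    (hM : ∀ R, 0 ≤ R → ∫ t in (0 : ℝ)..R, φ t ≤ M) : IntegrableOn φ (Ioi 0) := by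
  refine integrableOn_Ioi_of_intervalIntegral_norm_bounded (l := atTop) (b := fun R : ℝ => R) M 0
    (fun R => ?_) tendsto_id ?_
  · rcases le_total 0 R with hR | hR
    · exact (intervalIntegrable_iff_integrableOn_Ioc_of_le hR).1 (hi R hR)
    · simp [Ioc_eq_empty_of_le hR]
  · filter_upwards [eventually_ge_atTop 0] with R hR
    simpa [abs_of_nonneg (h0 _)] using hM R hR

namespace IsPrimitive

variable {f f' g g' : ℝ → ℂ}

lemma re_eq (hf : IsPrimitive f f') {x : ℝ} (hx : 0 ≤ x) :
    (f x).re = (f 0).re + ∫ t in (0 : ℝ)..x, (f' t).re := by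
  have h := congrArg Complex.re (hf.2 x hx)
  rw [Complex.add_re] at h
  rw [h]
  congr 1
  exact (Complex.reCLM.intervalIntegral_comp_comm (hf.1 x hx)).symm

lemma intervalIntegrable_re (hf : IsPrimitive f f') {x : ℝ} (hx : 0 ≤ x) :
    IntervalIntegrable (fun t => (f' t).re) volume 0 x := by
  have := hf.1 x hx
  rw [intervalIntegrable_iff] at this ⊢
  exact this.re

lemma normSq_eq (hf : IsPrimitive f f') {x : ℝ} (hx : 0 ≤ x) :
    ‖f x‖ ^ 2 = ‖f 0‖ ^ 2 + ∫ t in (0 : ℝ)..x, 2 * (conj (f t) * f' t).re := by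
  have h := (hf.star.mul hf).re_eq hx
  have e : ∀ z : ℂ, (conj z * z).re = ‖z‖ ^ 2 := fun z => by
    rw [← Complex.normSq_eq_conj_mul_self, Complex.ofReal_re, Complex.normSq_eq_norm_sq]
  rw [e, e] at h
  rw [h]
  congr 2
  ext t
  simp only [Complex.add_re, Complex.mul_re, Complex.conj_re, Complex.conj_im]
  ring

lemma intervalIntegrable_normSq (hf : IsPrimitive f f') {x : ℝ} (hx : 0 ≤ x) :
    IntervalIntegrable (fun t => ‖f t‖ ^ 2) volume 0 x :=
  (ContinuousOn.mono (hf.continuousOn.norm.pow 2)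
    (by rw [uIcc_of_le hx]; exact Icc_subset_Ici_self)).intervalIntegrable

lemma aestronglyMeasurable (hf : IsPrimitive f f') : AEStronglyMeasurable f halfLine :=
  (hf.continuousOn.mono Ioi_subset_Ici_self).aestronglyMeasurable measurableSet_Ioi

lemma memLp_two (hf : IsPrimitive f f') {M : ℝ}
    (hM : ∀ R, 0 ≤ R → ∫ t in (0 : ℝ)..R, ‖f t‖ ^ 2 ≤ M) : MemLp f 2 halfLine := by
  rw [memLp_two_iff_integrable_sq_norm hf.aestronglyMeasurable]
  exact integrableOn_Ioi_of_intervalIntegral_le (fun x => by positivity)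
    (fun R hR => hf.intervalIntegrable_normSq hR) hM

/-- Integrability of `f'` gives a limit, and integrability of `f` excludes a nonzero one. -/
lemma tendsto_zero (hf : IsPrimitive f f') (hi : IntegrableOn f (Ioi 0))
    (hi' : IntegrableOn f' (Ioi 0)) : Tendsto f atTop (𝓝 0) := by
  have h1 : Tendsto f atTop (𝓝 (f 0 + ∫ t in Ioi 0, f' t)) := by
    refine ((tendsto_intervalIntegral_Ioi hi').const_add (f 0)).congr' ?_
    filter_upwards [eventually_ge_atTop 0] with R hR
    exact (hf.2 R hR).symm
  set L := f 0 + ∫ t in Ioi 0, f' t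
  by_cases hL : L = 0
  · rwa [hL] at h1
  · exfalso
    have hL' : 0 < ‖L‖ := norm_pos_iff.2 hL
    have h2 := h1.norm.eventually (eventually_gt_nhds (show ‖L‖ / 2 < ‖L‖ by linarith))
    obtain ⟨R, hR⟩ := eventually_atTop.1 h2
    exact not_integrableOn_of_le (half_pos hL') hi.norm (le_max_right R 0)
      fun x hx => (hR x ((le_max_left _ _).trans hx)).le

end IsPrimitive

lemma integrable_mul_of_memLp_two {f g : ℝ → ℂ} (hf : MemLp f 2 halfLine)
    (hg : MemLp g 2 halfLine) : Integrable (fun x => f x * g x) halfLine :=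
  hf.integrable_mul hg

lemma memLp_conj {f : ℝ → ℂ} (hf : MemLp f 2 halfLine) :
    MemLp (fun x => conj (f x)) 2 halfLine := hf.star

/-- If `u` and `u''` are square integrable on the half-line, then so is `u'`. -/
lemma memLp_deriv {u v w : ℝ → ℂ} (hu : IsPrimitive u v) (hv : IsPrimitive v w)
    (hu2 : MemLp u 2 halfLine) (hw2 : MemLp w 2 halfLine) : MemLp v 2 halfLine := by
  have hp := hu.star.mul hv
  have hk := integrable_mul_of_memLp_two (memLp_conj hu2) hw2
  set K := ∫ t in Ioi 0, ‖conj (u t) * w t‖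
  set I : ℝ → ℝ := fun R => ∫ t in (0 : ℝ)..R, ‖v t‖ ^ 2 with hI
  have hmono : ∀ R R', 0 ≤ R → R ≤ R' → I R ≤ I R' := fun R R' hR hRR' => by
    refine intervalIntegral.integral_mono_interval le_rfl hR hRR' ?_
      (hv.intervalIntegrable_normSq (hR.trans hRR'))
    exact ae_of_all _ fun t => by positivity
  have key : ∀ R, 0 ≤ R → I R ≤ (conj (u R) * v R).re - (conj (u 0) * v 0).re + K := by
    intro R hR
    have h1 := hp.re_eq hR
    have i2 : IntervalIntegrable (fun t => conj (u t) * w t) volume 0 R :=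
      (intervalIntegrable_iff_integrableOn_Ioc_of_le hR).2 (hk.mono_measure
        (Measure.restrict_mono Ioc_subset_Ioi_self le_rfl))
    have h2 : -K ≤ ∫ t in (0 : ℝ)..R, (conj (u t) * w t).re := by
      have h3 : |∫ t in (0 : ℝ)..R, (conj (u t) * w t).re| ≤ K := by
        rw [← Real.norm_eq_abs]
        refine (intervalIntegral.norm_integral_le_of_norm_le hR (ae_of_all _ fun t _ => ?_)
          i2.norm).trans ?_
        · exact Complex.abs_re_le_norm _
        · rw [intervalIntegral.integral_of_le hR]
          exact setIntegral_mono_set hk.norm (ae_of_all _ fun t => norm_nonneg _)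
            (LE.le.eventuallyLE Ioc_subset_Ioi_self)
      exact (abs_le.1 h3).1
    have h4 : ∫ t in (0 : ℝ)..R, (conj (v t) * v t + conj (u t) * w t).re =
        I R + ∫ t in (0 : ℝ)..R, (conj (u t) * w t).re := by
      rw [hI, ← intervalIntegral.integral_add (hv.intervalIntegrable_normSq hR)]
      · refine intervalIntegral.integral_congr fun t _ => ?_
        simp only [Complex.add_re]
        rw [← Complex.normSq_eq_conj_mul_self, Complex.ofReal_re, Complex.normSq_eq_norm_sq]
      · rw [intervalIntegrable_iff] at i2 ⊢
        exact i2.re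
    rw [h4] at h1
    linarith
  -- If `∫ |v|²` were unbounded, `key` would make `Re (conj u · v) ≥ 1` from some point on. Then
  -- `|u|²` would grow at least linearly, against `u ∈ L²`.
  have hbdd : ∃ M, ∀ R, 0 ≤ R → I R ≤ M := by
    by_contra hcon
    push Not at hcon
    obtain ⟨R₀, hR₀, hIR₀⟩ := hcon (K - (conj (u 0) * v 0).re + 1)
    have h5 : ∀ R, R₀ ≤ R → 1 ≤ (conj (u R) * v R).re := fun R hR => by
      have := key R (hR₀.trans hR)
      have := hmono R₀ R hR₀ hR
      linarith
    have hu2' : IntegrableOn (fun t => ‖u t‖ ^ 2) (Ioi 0) :=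
      (memLp_two_iff_integrable_sq_norm hu.aestronglyMeasurable).1 hu2
    have hre : ∀ R, 0 ≤ R → IntervalIntegrable (fun t => 2 * (conj (u t) * v t).re) volume 0 R := by
      intro R hR
      refine ContinuousOn.intervalIntegrable ?_
      rw [uIcc_of_le hR]
      refine ContinuousOn.mono ?_ Icc_subset_Ici_self
      exact continuousOn_const.mul (Complex.continuous_re.comp_continuousOn hp.continuousOn)
    refine not_integrableOn_of_le one_pos hu2' (R := R₀ + 1) (by linarith) fun R hR => ?_
    have h6 := hu.normSq_eq (show 0 ≤ R by linarith)
    have h7 := hu.normSq_eq hR₀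
    rw [← intervalIntegral.integral_add_adjacent_intervals (hre R₀ hR₀)
      ((hre R₀ hR₀).symm.trans (hre R (by linarith)))] at h6
    have h8 : ∫ t in R₀..R, (1 : ℝ) ≤ ∫ t in R₀..R, 2 * (conj (u t) * v t).re := by
      refine intervalIntegral.integral_mono_on (by linarith) (by simp)
        ((hre R₀ hR₀).symm.trans (hre R (by linarith))) fun t ht => ?_
      have := h5 t ht.1
      linarith
    simp only [intervalIntegral.integral_const, smul_eq_mul, mul_one] at h8
    have : 0 ≤ ‖u R₀‖ ^ 2 := by positivity
    linarith
  obtain ⟨M, hM⟩ := hbdd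
  exact hv.memLp_two hM

lemma IsDirichletPair.exists_primitive {f h : H} (hp : IsDirichletPair f h) :
    ∃ u v : ℝ → ℂ, (f : ℝ → ℂ) =ᵐ[halfLine] u ∧ u 0 = 0 ∧ IsPrimitive u v ∧
      IsPrimitive v fun t => -h t := by
  obtain ⟨u, v, e, e0, d, i⟩ := hp
  have hv : IsPrimitive v fun t => -h t :=
    ⟨fun R hR => (intervalIntegrable_coe h hR).neg, fun x hx => by
      rw [intervalIntegral.integral_neg, i x hx, sub_eq_add_neg]⟩
  exact ⟨u, v, e, e0, .of_hasDerivWithinAt d hv.continuousOn, hv⟩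

lemma isDirichletPair_of_primitive {f h : H} {u v w : ℝ → ℂ} (e : (f : ℝ → ℂ) =ᵐ[halfLine] u)
    (e0 : u 0 = 0) (hu : IsPrimitive u v) (hv : IsPrimitive v w)
    (hw : (h : ℝ → ℂ) =ᵐ[halfLine] fun t => -w t) : IsDirichletPair f h := by
  refine ⟨u, v, e, e0, fun x hx => hu.hasDerivWithinAt hv.continuousOn hx, fun x hx => ?_⟩
  rw [integral_congr_coe hw hx, intervalIntegral.integral_neg, sub_neg_eq_add, hv.2 x hx]

lemma dirichletLaplacian_symm {f h f' h' : H} (hp : (f, h) ∈ dirichletLaplacian.graph)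
    (hp' : (f', h') ∈ dirichletLaplacian.graph) : inner ℂ h f' = inner ℂ f h' := by
  obtain ⟨u, v, e, e0, hu, hv⟩ := ((mem_graph_dirichletLaplacian _ _).1 hp).exists_primitive
  obtain ⟨u', v', e', e0', hu', hv'⟩ := ((mem_graph_dirichletLaplacian _ _).1 hp').exists_primitive
  have mu : MemLp u 2 halfLine := (memLp_congr_ae e).1 (Lp.memLp f)
  have mu' : MemLp u' 2 halfLine := (memLp_congr_ae e').1 (Lp.memLp f')
  have mh := Lp.memLp h
  have mh' := Lp.memLp h'
  have mv := memLp_deriv hu hv mu mh.neg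
  have mv' := memLp_deriv hu' hv' mu' mh'.neg
  have hB := (hv.star.mul hu').sub (hu.star.mul hv')
  have i1 := integrable_mul_of_memLp_two (memLp_conj mh) mu'
  have i2 := integrable_mul_of_memLp_two (memLp_conj mu) mh'
  have hB' : IsPrimitive (fun x => conj (v x) * u' x - conj (u x) * v' x)
      fun x => conj (u x) * h' x - conj (h x) * u' x :=
    hB.congr_deriv fun x _ => by
      rw [map_neg]
      ring
  -- The boundary form vanishes at infinity: it is integrable because `u'` is in L² by
  -- `memLp_deriv`, and so is its derivative. At 0 it vanishes by the Dirichlet condition.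
  have lim := hB'.tendsto_zero ((integrable_mul_of_memLp_two (memLp_conj mv) mu').sub
    (integrable_mul_of_memLp_two (memLp_conj mu) mv')) (i2.sub i1)
  have lim2 : Tendsto (fun R : ℝ => ∫ t in (0 : ℝ)..R, (conj (u t) * h' t - conj (h t) * u' t))
      atTop (𝓝 0) := by
    refine lim.congr' ?_
    filter_upwards [eventually_ge_atTop 0] with R hR
    rw [hB'.2 R hR, e0, e0']
    simp
  have hz := tendsto_nhds_unique lim2 (tendsto_intervalIntegral_Ioi (i2.sub i1))
  rw [integral_sub i2 i1, eq_comm, sub_eq_zero] at hz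
  rw [L2.inner_def, L2.inner_def]
  calc ∫ t, inner ℂ (h t) (f' t) ∂halfLine = ∫ t in Ioi 0, conj (h t) * u' t := by
        refine integral_congr_ae ?_
        filter_upwards [e'] with t ht
        rw [ht, RCLike.inner_apply, mul_comm]
    _ = ∫ t in Ioi 0, conj (u t) * h' t := hz.symm
    _ = ∫ t, inner ℂ (f t) (h' t) ∂halfLine := by
        refine integral_congr_ae ?_
        filter_upwards [e] with t ht
        rw [ht, RCLike.inner_apply, mul_comm]

lemma isPrimitive_ofReal_exp (c : ℝ) :
    IsPrimitive (fun x => (Real.exp (c * x) : ℂ)) fun x => (c * Real.exp (c * x) : ℂ) := by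
  refine .of_hasDerivWithinAt (fun x _ => ?_) (by fun_prop)
  have h := ((hasDerivAt_id x).const_mul c).exp.ofReal_comp
  simp only [id, mul_one, Complex.ofReal_mul] at h
  rw [mul_comm]
  exact h.hasDerivWithinAt

lemma normSq_coe_integrable (g : H) : IntegrableOn (fun t => ‖g t‖ ^ 2) (Ioi 0) :=
  (memLp_two_iff_integrable_sq_norm (Lp.memLp g).1).1 (Lp.memLp g)

/-- Every square integrable `g` has the form `v - v'` with `v` square integrable. -/
lemma exists_sub_deriv_eq (g : H) : ∃ v : ℝ → ℂ, MemLp v 2 halfLine ∧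
    IsPrimitive v fun t => v t - g t := by
  have hm : MemLp (fun t => (Real.exp (-1 * t) : ℂ)) 2 halfLine := by
    rw [memLp_two_iff_integrable_sq_norm (isPrimitive_ofReal_exp (-1)).aestronglyMeasurable]
    have : IntegrableOn (fun t : ℝ => Real.exp (-2 * t)) (Ioi 0) :=
      integrableOn_exp_mul_Ioi (by norm_num) 0
    refine this.congr (ae_of_all _ fun t => ?_)
    simp only [Complex.norm_real, Real.norm_eq_abs, Real.abs_exp, ← Real.exp_nat_mul]
    congr 1
    push_cast
    ring
  have hi := integrable_mul_of_memLp_two hm (Lp.memLp g)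
  set φ : ℝ → ℂ := fun t => Real.exp (-1 * t) * g t with hφ
  have hiR : ∀ R, 0 ≤ R → IntervalIntegrable φ volume 0 R := fun R hR =>
    (intervalIntegrable_iff_integrableOn_Ioc_of_le hR).2 (hi.mono_measure
        (Measure.restrict_mono Ioc_subset_Ioi_self le_rfl))
  have hψ : IsPrimitive (fun x => (∫ t in Ioi 0, φ t) - ∫ t in (0 : ℝ)..x, φ t) fun t => -φ t := by
    refine ⟨fun R hR => (hiR R hR).neg, fun x _ => ?_⟩
    simp [intervalIntegral.integral_neg, sub_eq_add_neg]
  have hv : IsPrimitive (fun x => (Real.exp (1 * x) : ℂ) *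
      ((∫ t in Ioi 0, φ t) - ∫ t in (0 : ℝ)..x, φ t)) fun x => (Real.exp (1 * x) : ℂ) *
      ((∫ t in Ioi 0, φ t) - ∫ t in (0 : ℝ)..x, φ t) - g x := by
    refine ((isPrimitive_ofReal_exp 1).mul hψ).congr_deriv fun x _ => ?_
    have : (Real.exp (1 * x) : ℂ) * Real.exp (-1 * x) = 1 := by
      rw [← Complex.ofReal_mul, ← Real.exp_add]
      simp
    simp only [hφ, Complex.ofReal_one, one_mul] at this ⊢
    linear_combination -g x * this
  set v : ℝ → ℂ := fun x => (Real.exp (1 * x) : ℂ) *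
      ((∫ t in Ioi 0, φ t) - ∫ t in (0 : ℝ)..x, φ t) with hvdef
  set N := ∫ t in Ioi 0, ‖g t‖ ^ 2 with hN
  -- Here `v x = ∫_x^∞ e^{x-t} g t dt`, and `ab ≤ (a² + b²)/2` with `∫_x^∞ e^{2(x-t)} dt = 1/2`
  -- produces the constant.
  have hb : ∀ x, 0 ≤ x → ‖v x‖ ≤ 1 / 4 + N / 2 := by
    intro x hx
    have hix : IntegrableOn φ (Ioi x) := hi.mono_measure (Measure.restrict_mono
      (Ioi_subset_Ioi hx) le_rfl)
    have h1 : (∫ t in Ioi 0, φ t) - ∫ t in (0 : ℝ)..x, φ t = ∫ t in Ioi x, φ t := by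
      rw [sub_eq_iff_eq_add, ← intervalIntegral.integral_interval_add_Ioi hi hix]
      ring
    have hex : IntegrableOn (fun t : ℝ => Real.exp (-2 * t)) (Ioi x) :=
      integrableOn_exp_mul_Ioi (by norm_num) x
    have hgx : IntegrableOn (fun t => ‖g t‖ ^ 2) (Ioi x) :=
      (normSq_coe_integrable g).mono_set (Ioi_subset_Ioi hx)
    have h2 : v x = ∫ t in Ioi x, (Real.exp (1 * x) : ℂ) * φ t := by
      rw [hvdef]
      simp only
      rw [h1, integral_const_mul]
    rw [h2]
    calc ‖∫ t in Ioi x, (Real.exp (1 * x) : ℂ) * φ t‖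
        ≤ ∫ t in Ioi x, (Real.exp (2 * x) / 2 * Real.exp (-2 * t) + 1 / 2 * ‖g t‖ ^ 2) := by
          refine norm_integral_le_of_norm_le ((hex.const_mul _).add (hgx.const_mul _))
            (ae_of_all _ fun t => ?_)
          simp only [hφ, norm_mul, Complex.norm_real, Real.norm_eq_abs, Real.abs_exp]
          have e2 : Real.exp (2 * x) * Real.exp (-2 * t) =
              (Real.exp (1 * x) * Real.exp (-1 * t)) ^ 2 := by
            rw [← Real.exp_add, ← Real.exp_add, ← Real.exp_nat_mul]
            congr 1
            push_cast
            ring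
          nlinarith [sq_nonneg (Real.exp (1 * x) * Real.exp (-1 * t) - ‖g t‖)]
      _ = 1 / 4 + 1 / 2 * ∫ t in Ioi x, ‖g t‖ ^ 2 := by
          rw [integral_add (hex.const_mul _) (hgx.const_mul _), integral_const_mul,
            integral_const_mul, integral_exp_mul_Ioi (by norm_num)]
          have : Real.exp (2 * x) * Real.exp (-2 * x) = 1 := by
            rw [← Real.exp_add]
            simp
          linear_combination this / 4
      _ ≤ 1 / 4 + N / 2 := by
          have : ∫ t in Ioi x, ‖g t‖ ^ 2 ≤ N :=
            setIntegral_mono_set (normSq_coe_integrable g) (ae_of_all _ fun t => by positivity)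
              (LE.le.eventuallyLE (Ioi_subset_Ioi hx))
          linarith
  refine ⟨v, hv.memLp_two (M := (1 / 4 + N / 2) ^ 2 + N) fun R hR => ?_, hv⟩
  have h1 := hv.normSq_eq hR
  have hvi := hv.intervalIntegrable_normSq hR
  have hgi : IntervalIntegrable (fun t => ‖g t‖ ^ 2) volume 0 R :=
    (intervalIntegrable_iff_integrableOn_Ioc_of_le hR).2
      ((normSq_coe_integrable g).mono_set Ioc_subset_Ioi_self)
  -- Energy estimate: `(|v|²)' = 2 Re (conj v · (v - g)) ≥ |v|² - |g|²`, so `∫ |v|²` is bounded by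
  -- `|v R|² + ∫ |g|²`.
  have h2 : ∫ t in (0 : ℝ)..R, (‖v t‖ ^ 2 - ‖g t‖ ^ 2) ≤
      ∫ t in (0 : ℝ)..R, 2 * (conj (v t) * (v t - g t)).re := by
    refine intervalIntegral.integral_mono_on hR (hvi.sub hgi)
      ((hv.star.mul hv).intervalIntegrable_re hR |>.congr fun t _ => ?_) fun t _ => ?_
    · simp only [Complex.add_re, Complex.mul_re, Complex.conj_re, Complex.conj_im]
      ring
    · have h3 : (conj (v t) * (v t - g t)).re = ‖v t‖ ^ 2 - (conj (v t) * g t).re := by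
        rw [mul_sub, Complex.sub_re, ← Complex.normSq_eq_conj_mul_self, Complex.ofReal_re,
          Complex.normSq_eq_norm_sq]
      have h4 := Complex.re_le_norm (conj (v t) * g t)
      rw [norm_mul, RCLike.norm_conj] at h4
      nlinarith [sq_nonneg (‖v t‖ - ‖g t‖)]
  rw [intervalIntegral.integral_sub hvi hgi] at h2
  have h5 : ∫ t in (0 : ℝ)..R, ‖g t‖ ^ 2 ≤ N := by
    rw [intervalIntegral.integral_of_le hR]
    exact setIntegral_mono_set (normSq_coe_integrable g) (ae_of_all _ fun t => by positivity)
      (LE.le.eventuallyLE Ioc_subset_Ioi_self)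
  have h6 : ‖v R‖ ^ 2 ≤ (1 / 4 + N / 2) ^ 2 := pow_le_pow_left₀ (norm_nonneg _) (hb R hR) 2
  have h7 : 0 ≤ ‖v 0‖ ^ 2 := by positivity
  linarith

/-- Every square integrable primitive `v` has the form `u + u'` with `u` square integrable and
`u 0 = 0`. -/
lemma exists_add_deriv_eq {v v' : ℝ → ℂ} (hv : IsPrimitive v v') (hv2 : MemLp v 2 halfLine) :
    ∃ u : ℝ → ℂ, MemLp u 2 halfLine ∧ u 0 = 0 ∧ IsPrimitive u fun t => v t - u t := by
  have hψ : IsPrimitive (fun x => ∫ t in (0 : ℝ)..x, (Real.exp (1 * t) : ℂ) * v t)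
      fun t => (Real.exp (1 * t) : ℂ) * v t :=
    ⟨fun R hR => (((isPrimitive_ofReal_exp 1).mul hv).continuousOn.mono
      (by rw [uIcc_of_le hR]; exact Icc_subset_Ici_self)).intervalIntegrable,
      fun x _ => by simp⟩
  have hu : IsPrimitive (fun x => (Real.exp (-1 * x) : ℂ) *
      ∫ t in (0 : ℝ)..x, (Real.exp (1 * t) : ℂ) * v t) fun x => v x - (Real.exp (-1 * x) : ℂ) *
      ∫ t in (0 : ℝ)..x, (Real.exp (1 * t) : ℂ) * v t := by
    refine ((isPrimitive_ofReal_exp (-1)).mul hψ).congr_deriv fun x _ => ?_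
    have : (Real.exp (-1 * x) : ℂ) * Real.exp (1 * x) = 1 := by
      rw [← Complex.ofReal_mul, ← Real.exp_add]
      simp
    simp only [Complex.ofReal_neg, Complex.ofReal_one] at this ⊢
    linear_combination v x * this
  set u : ℝ → ℂ := fun x => (Real.exp (-1 * x) : ℂ) *
      ∫ t in (0 : ℝ)..x, (Real.exp (1 * t) : ℂ) * v t with hudef
  have hv2' : IntegrableOn (fun t => ‖v t‖ ^ 2) (Ioi 0) :=
    (memLp_two_iff_integrable_sq_norm hv.aestronglyMeasurable).1 hv2
  have u0 : u 0 = 0 := by simp [hudef]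
  refine ⟨u, hu.memLp_two (M := ∫ t in Ioi 0, ‖v t‖ ^ 2) fun R hR => ?_, u0, hu⟩
  have h1 := hu.normSq_eq hR
  have hvi := hv.intervalIntegrable_normSq hR
  have hui := hu.intervalIntegrable_normSq hR
  have h2 : ∫ t in (0 : ℝ)..R, 2 * (conj (u t) * (v t - u t)).re ≤
      ∫ t in (0 : ℝ)..R, (‖v t‖ ^ 2 - ‖u t‖ ^ 2) := by
    refine intervalIntegral.integral_mono_on hR
      ((hu.star.mul hu).intervalIntegrable_re hR |>.congr fun t _ => ?_) (hvi.sub hui) fun t _ => ?_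
    · simp only [Complex.add_re, Complex.mul_re, Complex.conj_re, Complex.conj_im]
      ring
    · have h3 : (conj (u t) * (v t - u t)).re = (conj (u t) * v t).re - ‖u t‖ ^ 2 := by
        rw [mul_sub, Complex.sub_re, ← Complex.normSq_eq_conj_mul_self, Complex.ofReal_re,
          Complex.normSq_eq_norm_sq]
      have h4 := Complex.re_le_norm (conj (u t) * v t)
      rw [norm_mul, RCLike.norm_conj] at h4
      nlinarith [sq_nonneg (‖v t‖ - ‖u t‖)]
  rw [intervalIntegral.integral_sub hvi hui] at h2
  have h5 : ∫ t in (0 : ℝ)..R, ‖v t‖ ^ 2 ≤ ∫ t in Ioi 0, ‖v t‖ ^ 2 := by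
    rw [intervalIntegral.integral_of_le hR]
    exact setIntegral_mono_set hv2' (ae_of_all _ fun t => by positivity)
      (LE.le.eventuallyLE Ioc_subset_Ioi_self)
  have h6 : 0 ≤ ‖u R‖ ^ 2 := by positivity
  rw [u0] at h1
  simp only [norm_zero, ne_eq, OfNat.ofNat_ne_zero, not_false_eq_true, zero_pow, zero_add] at h1
  linarith

/-- Factor `1 - d²/dx² = (1 - d/dx)(1 + d/dx)` and invert one first-order factor at a time, from
infinity and from 0 respectively. -/
lemma dirichletLaplacian_add_one_surjective (g : H) :
    ∃ f h, (f, h) ∈ dirichletLaplacian.graph ∧ f + h = g := by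
  obtain ⟨v, mv, hv⟩ := exists_sub_deriv_eq g
  obtain ⟨u, mu, u0, hu⟩ := exists_add_deriv_eq hv mv
  refine ⟨mu.toLp u, g - mu.toLp u, ?_, by abel⟩
  rw [mem_graph_dirichletLaplacian]
  refine isDirichletPair_of_primitive mu.coeFn_toLp u0 hu (hv.sub hu) ?_
  filter_upwards [Lp.coeFn_sub g (mu.toLp u), mu.coeFn_toLp] with t h1 h2
  rw [h1, Pi.sub_apply, h2]
  ring

/-- The unitary group `exp (i t L₀)`. -/
lemma exists_free_propagator : ∃ G : ℝ → H →L[ℂ] H, IsUnitaryGroup G ∧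
    ∀ f h, (f, h) ∈ dirichletLaplacian.graph ↔
      HasDerivAt (fun t => G t f) (Complex.I • h) 0 :=
  exists_unitaryGroup dirichletLaplacian (fun _ _ _ _ => dirichletLaplacian_symm)
    dirichletLaplacian_add_one_surjective

end DirichletLaplacian

/-! ### Volterra equations and the kernel of the Jost integral equation -/

section Volterra

open scoped BoundedContinuousFunction NNReal

lemma absolutelyContinuousOnInterval_comp {f φ : ℝ → ℝ} {a b : ℝ} {s : Set ℝ} {K : ℝ≥0}
    (hφ : LipschitzOnWith K φ s) (hf : AbsolutelyContinuousOnInterval f a b)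
    (hs : ∀ x ∈ uIcc a b, f x ∈ s) : AbsolutelyContinuousOnInterval (fun x => φ (f x)) a b := by
  rw [absolutelyContinuousOnInterval_iff] at hf ⊢
  intro ε hε
  obtain ⟨δ, hδ, H⟩ := hf (ε / (K + 1)) (by positivity)
  refine ⟨δ, hδ, fun E hE hl => ?_⟩
  have h1 := H E hE hl
  calc ∑ i ∈ Finset.range E.1, dist (φ (f (E.2 i).1)) (φ (f (E.2 i).2))
      ≤ ∑ i ∈ Finset.range E.1, (K + 1) * dist (f (E.2 i).1) (f (E.2 i).2) := by
        refine Finset.sum_le_sum fun i hi => ?_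
        obtain ⟨h2, h3⟩ := hE.1 i hi
        refine (hφ.dist_le_mul _ (hs _ h2) _ (hs _ h3)).trans ?_
        gcongr
        linarith
    _ = (K + 1) * ∑ i ∈ Finset.range E.1, dist (f (E.2 i).1) (f (E.2 i).2) :=
        (Finset.mul_sum _ _ _).symm
    _ < (K + 1) * (ε / (K + 1)) := by gcongr
    _ = ε := by field_simp

/-- `W` is only integrable, so the fundamental theorem is used through absolute continuity of the
exponential of its primitive. These exponentials serve as weights for the Volterra equations. -/
lemma integral_mul_exp_primitive {W : ℝ → ℝ} (hW : Integrable W) (c : ℝ) {a b : ℝ} (ha : 0 ≤ a)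
    (hab : a ≤ b) :
    ∫ x in a..b, c * W x * Real.exp (c * ∫ t in (0 : ℝ)..x, W t) =
      Real.exp (c * ∫ t in (0 : ℝ)..b, W t) - Real.exp (c * ∫ t in (0 : ℝ)..a, W t) := by
  set τ : ℝ → ℝ := fun x => ∫ t in (0 : ℝ)..x, W t with hτ
  have hW' : IntervalIntegrable W volume 0 b := hW.intervalIntegrable
  have hsub : uIcc a b ⊆ uIcc 0 b := by
    rw [uIcc_of_le hab, uIcc_of_le (ha.trans hab)]
    exact Icc_subset_Icc_left ha
  have hAC : AbsolutelyContinuousOnInterval τ a b :=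
    (hW'.absolutelyContinuousOnInterval_intervalIntegral left_mem_uIcc).mono hsub
  have hcpt : IsCompact (τ '' uIcc a b) := isCompact_uIcc.image_of_continuousOn hAC.continuousOn
  obtain ⟨B, hB⟩ := hcpt.isBounded.exists_norm_le
  have hlip : LipschitzOnWith (Real.toNNReal (|c| * Real.exp (|c| * B)))
      (fun y => Real.exp (c * y)) (Metric.closedBall 0 B) := by
    refine Convex.lipschitzOnWith_of_nnnorm_hasDerivWithin_le (convex_closedBall _ _)
      (f' := fun y => Real.exp (c * y) * (c * 1))
      (fun y _ => (((hasDerivAt_id y).const_mul c).exp).hasDerivWithinAt) fun y hy => ?_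
    rw [← NNReal.coe_le_coe, coe_nnnorm, Real.coe_toNNReal _ (by positivity), norm_mul, mul_one,
      Real.norm_eq_abs, Real.abs_exp, Real.norm_eq_abs, mul_comm]
    rw [mem_closedBall_zero_iff, Real.norm_eq_abs] at hy
    refine mul_le_mul_of_nonneg_left (Real.exp_le_exp.2 ?_) (abs_nonneg c)
    exact (le_abs_self _).trans (by rw [abs_mul]; gcongr)
  have hAC' := absolutelyContinuousOnInterval_comp hlip hAC
    fun x hx => mem_closedBall_zero_iff.2 (hB _ (mem_image_of_mem _ hx))
  rw [← hAC'.integral_deriv_eq_sub]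
  refine intervalIntegral.integral_congr_ae ?_
  filter_upwards [hW'.ae_hasDerivAt_integral] with x hx hx'
  have h1 := hx (hsub (uIoc_subset_uIcc hx')) 0 left_mem_uIcc
  rw [(h1.const_mul c).exp.deriv]
  ring

/-- `Φ` halves the weighted norm, which is equivalent to the sup norm as `1 ≤ ω ≤ M`. Hence some
power `Φ ^ n` is a strict contraction, and `(1 - Φ) ∑_{i<n} Φ ^ i = 1 - Φ ^ n` gives the solution.
-/
lemma exists_sub_apply_eq {X : Type*} [TopologicalSpace X] (Φ : (X →ᵇ ℂ) →L[ℂ] (X →ᵇ ℂ))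
    {ω : X → ℝ} {M : ℝ} (h1 : ∀ x, 1 ≤ ω x) (hM : ∀ x, ω x ≤ M)
    (h : ∀ (f : X →ᵇ ℂ) C, 0 ≤ C → (∀ x, ‖f x‖ ≤ C * ω x) → ∀ x, ‖Φ f x‖ ≤ C / 2 * ω x)
    (g : X →ᵇ ℂ) : ∃ f, f - Φ f = g := by
  have hM' : ∀ n f, ‖(Φ ^ n) f‖ ≤ M * (1 / 2) ^ n * ‖f‖ := by
    intro n f
    rcases isEmpty_or_nonempty X with hX | ⟨⟨x₀⟩⟩
    · have : (Φ ^ n) f = 0 := by ext x; exact hX.elim x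
      have e : f = 0 := by ext x; exact hX.elim x
      rw [this, e]
      simp
    have hM0 : 0 ≤ M := zero_le_one.trans ((h1 x₀).trans (hM x₀))
    have : ∀ n x, ‖(Φ ^ n) f x‖ ≤ ‖f‖ * (1 / 2) ^ n * ω x := by
      intro n
      induction n with
      | zero =>
        intro x
        simp only [pow_zero, one_apply_eq_self, mul_one]
        exact (f.norm_coe_le_norm x).trans (le_mul_of_one_le_right (norm_nonneg _) (h1 x))
      | succ n ih =>
        intro x
        rw [pow_succ', mul_apply_eq_comp]
        refine (h _ _ (by positivity) ih x).trans (le_of_eq ?_)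
        rw [pow_succ]
        ring
    rw [BoundedContinuousFunction.norm_le (by positivity)]
    intro x
    refine (this n x).trans ?_
    calc ‖f‖ * (1 / 2) ^ n * ω x ≤ ‖f‖ * (1 / 2) ^ n * M := by gcongr; exact hM x
      _ = _ := by ring
  obtain ⟨n, hn⟩ : ∃ n : ℕ, |M| * (1 / 2) ^ n < 1 := by
    have : Tendsto (fun n : ℕ => |M| * (1 / 2 : ℝ) ^ n) atTop (𝓝 (|M| * 0)) :=
      (tendsto_pow_atTop_nhds_zero_of_lt_one (by norm_num) (by norm_num)).const_mul _
    rw [mul_zero] at this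
    exact (this.eventually (gt_mem_nhds one_pos)).exists
  have hΦ : ‖Φ ^ n‖ < 1 := by
    refine lt_of_le_of_lt (ContinuousLinearMap.opNorm_le_bound _ (by positivity) fun f => ?_) hn
    refine (hM' n f).trans ?_
    gcongr
    exact le_abs_self M
  obtain ⟨Ψ, hΨ⟩ := exists_rightInverse_one_sub hΦ
  refine ⟨(∑ i ∈ Finset.range n, Φ ^ i) (Ψ g), ?_⟩
  have h2 := congrArg (fun T : (X →ᵇ ℂ) →L[ℂ] (X →ᵇ ℂ) => T (Ψ g)) (mul_neg_geom_sum Φ n)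
  simp only [mul_apply_eq_comp, sub_apply, one_apply_eq_self] at h2
  rw [h2, hΨ]

/-- Solvability of linear integral equations on the half-line with a parameter, for kernels that
contract a weight `ω` by the factor `1 / 2`. -/
lemma exists_volterra {V : ℝ → ℂ} {W ω : ℝ → ℝ} {M : ℝ} {κ : ℝ × ℂ → ℝ → ℂ}
    (hV : AEStronglyMeasurable V halfLine) (hW : IntegrableOn W (Ioi 0))
    (hκ : Continuous (Function.uncurry κ)) (hκW : ∀ p t, 0 < t → ‖κ p t‖ * ‖V t‖ ≤ W t)
    (hω : Continuous ω) (h1 : ∀ x, 1 ≤ ω x) (hM : ∀ x, ω x ≤ M)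
    (h : ∀ p, ∫ t in Ioi 0, ‖κ p t‖ * ‖V t‖ * ω t ≤ ω p.1 / 2) (g : (ℝ × ℂ) →ᵇ ℂ) :
    ∃ f : (ℝ × ℂ) →ᵇ ℂ, ∀ p, f p = g p + ∫ t in Ioi 0, κ p t * (V t * f (t, p.2)) := by
  have hκp : ∀ p, Continuous (κ p) := fun p => hκ.comp (by fun_prop : Continuous fun t => (p, t))
  have hmeas : ∀ (f : (ℝ × ℂ) →ᵇ ℂ) p, AEStronglyMeasurable
      (fun t => κ p t * (V t * f (t, p.2))) halfLine := fun f p =>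
    (hκp p).aestronglyMeasurable.mul (hV.mul
      (f.continuous.comp (by fun_prop : Continuous fun t : ℝ => (t, p.2))).aestronglyMeasurable)
  have hbound : ∀ (f : (ℝ × ℂ) →ᵇ ℂ) p, ∀ᵐ t ∂halfLine,
      ‖κ p t * (V t * f (t, p.2))‖ ≤ ‖f‖ * W t := fun f p => by
    filter_upwards [ae_restrict_mem measurableSet_Ioi] with t ht
    rw [norm_mul, norm_mul, ← mul_assoc, mul_comm]
    exact mul_le_mul (f.norm_coe_le_norm _) (hκW p t ht) (by positivity) (norm_nonneg _)
  have hint : ∀ (f : (ℝ × ℂ) →ᵇ ℂ) p, Integrable (fun t => κ p t * (V t * f (t, p.2))) halfLine :=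
    fun f p => Integrable.mono' (hW.const_mul _) (hmeas f p) (hbound f p)
  have hcont : ∀ f : (ℝ × ℂ) →ᵇ ℂ,
      Continuous fun p : ℝ × ℂ => ∫ t in Ioi 0, κ p t * (V t * f (t, p.2)) := fun f => by
    refine continuous_of_dominated (hmeas f) (hbound f) (hW.const_mul _) (ae_of_all _ fun t => ?_)
    have h1 : Continuous fun p => κ p t := hκ.comp (by fun_prop : Continuous fun p => (p, t))
    have h2 : Continuous fun p : ℝ × ℂ => f (t, p.2) := f.continuous.comp (by fun_prop)
    exact h1.mul (continuous_const.mul h2)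
  have hW0 : 0 ≤ ∫ t in Ioi 0, W t := setIntegral_nonneg measurableSet_Ioi fun t ht =>
    le_trans (by positivity) (hκW 0 t ht)
  have hnorm : ∀ (f : (ℝ × ℂ) →ᵇ ℂ) p,
      ‖∫ t in Ioi 0, κ p t * (V t * f (t, p.2))‖ ≤ (∫ t in Ioi 0, W t) * ‖f‖ := fun f p => by
    refine (norm_integral_le_of_norm_le (hW.const_mul _) (hbound f p)).trans (le_of_eq ?_)
    rw [integral_const_mul, mul_comm]
  -- The unknown is a function of the pair `(x, k)`, so joint continuity in the spectral parameter
  -- comes with the fixed point.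
  let Φ : ((ℝ × ℂ) →ᵇ ℂ) →L[ℂ] ((ℝ × ℂ) →ᵇ ℂ) := LinearMap.mkContinuous
    { toFun := fun f => BoundedContinuousFunction.ofNormedAddCommGroup _ (hcont f) _ (hnorm f)
      map_add' := by
        intro f f'
        ext p
        simp only [BoundedContinuousFunction.coe_ofNormedAddCommGroup,
          BoundedContinuousFunction.coe_add, Pi.add_apply]
        rw [← integral_add (hint f p) (hint f' p)]
        congr 1
        ext t
        ring
      map_smul' := by
        intro c f
        ext p
        simp only [BoundedContinuousFunction.coe_ofNormedAddCommGroup,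
          BoundedContinuousFunction.coe_smul, RingHom.id_apply, smul_eq_mul]
        rw [← integral_const_mul]
        congr 1
        ext t
        ring } (∫ t in Ioi 0, W t)
    fun f => (BoundedContinuousFunction.norm_le (by positivity)).2 (hnorm f)
  have hΦ : ∀ f p, Φ f p = ∫ t in Ioi 0, κ p t * (V t * f (t, p.2)) := fun _ _ => rfl
  obtain ⟨f, hf⟩ := exists_sub_apply_eq Φ (ω := fun p => ω p.1) (fun p => h1 p.1)
    (fun p => hM p.1) (fun f C hC hfC p => by
      rw [hΦ]
      have hiω : IntegrableOn (fun t => ‖κ p t‖ * ‖V t‖ * ω t) (Ioi 0) := by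
        refine Integrable.mono' (hW.mul_const M) (((hκp p).norm.aestronglyMeasurable.mul
          hV.norm).mul hω.aestronglyMeasurable) ?_
        filter_upwards [ae_restrict_mem measurableSet_Ioi] with t ht
        have := zero_le_one.trans (h1 t)
        rw [Real.norm_of_nonneg (by positivity)]
        exact mul_le_mul (hκW p t ht) (hM t) this (le_trans (by positivity) (hκW p t ht))
      calc ‖∫ t in Ioi 0, κ p t * (V t * f (t, p.2))‖
          ≤ ∫ t in Ioi 0, C * (‖κ p t‖ * ‖V t‖ * ω t) := by
            refine norm_integral_le_of_norm_le (hiω.const_mul _) (ae_of_all _ fun t => ?_)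
            rw [norm_mul, norm_mul]
            calc ‖κ p t‖ * (‖V t‖ * ‖f (t, p.2)‖) ≤ ‖κ p t‖ * (‖V t‖ * (C * ω t)) := by
                  gcongr
                  exact hfC (t, p.2)
              _ = _ := by ring
        _ ≤ C / 2 * ω p.1 := by
            rw [integral_const_mul]
            calc _ ≤ C * (ω p.1 / 2) := by gcongr; exact h p
              _ = _ := by ring) g
  refine ⟨f, fun p => ?_⟩
  have := congrArg (fun F : (ℝ × ℂ) →ᵇ ℂ => F p) hf
  simp only [BoundedContinuousFunction.coe_sub, Pi.sub_apply, hΦ] at this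
  rw [← this]
  ring

/-- `oscKernel z s = (exp (2 i z s) - 1) / (2 i z)`, with its continuous extension to `z = 0`. -/
def oscKernel (z : ℂ) (s : ℝ) : ℂ := ∫ r in (0 : ℝ)..s, Complex.exp (2 * Complex.I * z * r)

lemma norm_exp_two_I_mul (z : ℂ) (r : ℝ) :
    ‖Complex.exp (2 * Complex.I * z * r)‖ = Real.exp (-(2 * z.im * r)) := by
  rw [Complex.norm_exp]
  congr 1
  simp

lemma continuous_oscKernel : Continuous (Function.uncurry oscKernel) := by
  exact intervalIntegral.continuous_parametric_intervalIntegral_of_continuous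
    (f := fun (p : ℂ × ℝ) r => Complex.exp (2 * Complex.I * p.1 * r)) (by fun_prop) (by fun_prop)

lemma oscKernel_zero (z : ℂ) : oscKernel z 0 = 0 := by simp [oscKernel]

lemma hasDerivAt_oscKernel (z : ℂ) (s : ℝ) :
    HasDerivAt (oscKernel z) (Complex.exp (2 * Complex.I * z * s)) s := by
  have hc : Continuous fun r : ℝ => Complex.exp (2 * Complex.I * z * r) := by fun_prop
  exact intervalIntegral.integral_hasDerivAt_right (hc.intervalIntegrable _ _)
    (hc.stronglyMeasurableAtFilter _ _) hc.continuousAt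

lemma norm_oscKernel_sub_le {z : ℂ} (hz : 0 ≤ z.im) {s s' : ℝ} (hs : 0 ≤ s) (hs' : 0 ≤ s') :
    ‖oscKernel z s - oscKernel z s'‖ ≤ |s - s'| := by
  refine ((convex_Ici (0 : ℝ)).norm_image_sub_le_of_norm_hasDerivWithin_le (C := 1)
    (fun x _ => (hasDerivAt_oscKernel z x).hasDerivWithinAt) (fun x hx => ?_) hs' hs).trans
    (by rw [one_mul, Real.norm_eq_abs])
  rw [norm_exp_two_I_mul, Real.exp_le_one_iff]
  have := mul_nonneg hz (mem_Ici.1 hx)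
  linarith

lemma norm_oscKernel_le {z : ℂ} (hz : 0 ≤ z.im) {s : ℝ} (hs : 0 ≤ s) : ‖oscKernel z s‖ ≤ s := by
  simpa [oscKernel_zero, abs_of_nonneg hs] using norm_oscKernel_sub_le hz hs le_rfl

/-- Complements `norm_oscKernel_le`, which is uniform down to `z = 0`: this bound gives decay for
large `z`, and with it the limit 1 of the Jost function at infinity. -/
lemma norm_mul_norm_oscKernel_le {z : ℂ} (hz : 0 ≤ z.im) {s : ℝ} (hs : 0 ≤ s) :
    ‖z‖ * ‖oscKernel z s‖ ≤ 1 := by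
  have h1 : Complex.exp (2 * Complex.I * z * s) - 1 = 2 * Complex.I * z * oscKernel z s := by
    rw [oscKernel, ← intervalIntegral.integral_const_mul,
      intervalIntegral.integral_eq_sub_of_hasDerivAt
        (f := fun r : ℝ => Complex.exp (2 * Complex.I * z * r))]
    · simp
    · intro r _
      have := ((hasDerivAt_id (r : ℂ)).const_mul (2 * Complex.I * z)).cexp.comp_ofReal
      simpa [mul_comm] using this
    · exact (by fun_prop : Continuous fun r : ℝ =>
        2 * Complex.I * z * Complex.exp (2 * Complex.I * z * r)).intervalIntegrable _ _
  have h2 : ‖Complex.exp (2 * Complex.I * z * s) - 1‖ ≤ 2 := by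
    refine (norm_sub_le _ _).trans ?_
    rw [norm_exp_two_I_mul, norm_one]
    have : Real.exp (-(2 * z.im * s)) ≤ 1 := by
      rw [Real.exp_le_one_iff]
      have := mul_nonneg hz hs
      linarith
    linarith
  rw [h1] at h2
  simp only [norm_mul, Complex.norm_ofNat, Complex.norm_I, mul_one] at h2
  linarith

lemma isPrimitive_cexp (w : ℂ) :
    IsPrimitive (fun x => Complex.exp (w * x)) fun x => w * Complex.exp (w * x) := by
  refine .of_hasDerivWithinAt (fun x _ => ?_) (by fun_prop)
  have := ((hasDerivAt_id (x : ℂ)).const_mul w).cexp.comp_ofReal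
  simp only [id, mul_one] at this
  rw [mul_comm]
  exact this.hasDerivWithinAt

lemma integrable_halfLine_intervalIntegrable {b : ℝ → ℂ} (hb : Integrable b halfLine) {R : ℝ}
    (hR : 0 ≤ R) : IntervalIntegrable b volume 0 R :=
  (intervalIntegrable_iff_integrableOn_Ioc_of_le hR).2 (hb.mono_measure
    (Measure.restrict_mono Ioc_subset_Ioi_self le_rfl))

lemma isPrimitive_cexp_mul {b : ℝ → ℂ} (hb : Integrable b halfLine) (w c : ℂ) :
    IsPrimitive (fun x => Complex.exp (w * x) * (c + ∫ t in (0 : ℝ)..x, Complex.exp (-w * t) * b t))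
      fun x => b x + w * (Complex.exp (w * x) *
        (c + ∫ t in (0 : ℝ)..x, Complex.exp (-w * t) * b t)) := by
  have hψ : IsPrimitive (fun x => c + ∫ t in (0 : ℝ)..x, Complex.exp (-w * t) * b t)
      fun t => Complex.exp (-w * t) * b t :=
    ⟨fun R hR => (integrable_halfLine_intervalIntegrable hb hR).continuousOn_mul
      (by fun_prop), fun x _ => by simp⟩
  refine ((isPrimitive_cexp w).mul hψ).congr_deriv fun x _ => ?_
  have : Complex.exp (w * x) * Complex.exp (-w * x) = 1 := by
    rw [← Complex.exp_add]
    simp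
  linear_combination b x * this

lemma IsPrimitive.of_hasDerivAt {f f' : ℝ → ℂ} (hf : ContinuousOn f (Ici 0))
    (hd : ∀ x, 0 < x → HasDerivAt f (f' x) x) (hi : ∀ R, 0 ≤ R → IntervalIntegrable f' volume 0 R) :
    IsPrimitive f f' := by
  refine ⟨hi, fun x hx => ?_⟩
  rw [intervalIntegral.integral_eq_sub_of_hasDeriv_right_of_le hx (hf.mono Icc_subset_Ici_self)
    (fun y hy => (hd y hy.1).hasDerivWithinAt) (hi x hx)]
  ring

/-- The truncation by `max · 0` turns a variable limit of integration into a Lipschitz kernel, so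
one may differentiate under the integral sign; the kink at `t = x` is a null set. The signs `ε = ±1`
serve the Jost and the regular solution. -/
lemma hasDerivAt_integral_oscKernel {b : ℝ → ℂ} (hb : Integrable b halfLine) {z : ℂ}
    (hz : 0 ≤ z.im) (ε : ℝ) (hε : |ε| = 1) (x : ℝ)
    (hi : Integrable (fun t => oscKernel z (max (ε * (x - t)) 0) * b t) halfLine) :
    HasDerivAt (fun y => ∫ t in Ioi 0, oscKernel z (max (ε * (y - t)) 0) * b t)
      (∫ t in Ioi 0, (if 0 < ε * (x - t) then
        ε * Complex.exp (2 * Complex.I * z * (ε * (x - t) : ℝ)) else 0) * b t) x := by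
  have hcont : ∀ y, Continuous fun t => oscKernel z (max (ε * (y - t)) 0) := fun y =>
    continuous_oscKernel.comp (by fun_prop : Continuous fun t => (z, max (ε * (y - t)) 0))
  have hlip : ∀ t y y', ‖oscKernel z (max (ε * (y - t)) 0) - oscKernel z (max (ε * (y' - t)) 0)‖ ≤
      |y - y'| := fun t y y' => by
    refine (norm_oscKernel_sub_le hz (le_max_right _ _) (le_max_right _ _)).trans ?_
    refine (abs_max_sub_max_le_abs _ _ _).trans (le_of_eq ?_)
    rw [← mul_sub, abs_mul, hε, one_mul]
    congr 1
    ring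
  have hε0 : ε ≠ 0 := by
    rintro rfl
    simp at hε
  refine (hasDerivAt_integral_of_dominated_loc_of_lip (s := univ) (bound := fun t => ‖b t‖)
    univ_mem (Eventually.of_forall fun y => (hcont y).aestronglyMeasurable.mul hb.1) hi ?_
    (ae_of_all _ fun t => ?_) hb.norm ?_).2
  · refine AEStronglyMeasurable.mul (Measurable.aestronglyMeasurable ?_) hb.1
    refine Measurable.ite (measurableSet_lt measurable_const (by fun_prop)) ?_ measurable_const
    fun_prop
  · refine LipschitzOnWith.of_dist_le_mul fun y _ y' _ => ?_
    simp only [Pi.mul_apply]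
    rw [dist_eq_norm, ← sub_mul, norm_mul, Real.dist_eq, mul_comm]
    simp only [Real.coe_nnabs, abs_norm]
    gcongr
    exact hlip t y y'
  · have hne : ∀ᵐ t ∂halfLine, t ≠ x := by
      refine ae_restrict_of_ae ?_
      simp [ae_iff, measure_singleton]
    filter_upwards [hne] with t ht
    refine HasDerivAt.mul_const ?_ _
    have hx : HasDerivAt (fun y : ℝ => ε * (y - t)) ε x := by
      simpa using ((hasDerivAt_id x).sub_const t).const_mul ε
    split_ifs with h
    · have h1 : HasDerivAt (fun y => oscKernel z (ε * (y - t)))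
          (ε • Complex.exp (2 * Complex.I * z * (ε * (x - t) : ℝ))) x :=
        (hasDerivAt_oscKernel z _).scomp x hx
      rw [Complex.real_smul] at h1
      refine h1.congr_of_eventuallyEq ?_
      filter_upwards [hx.continuousAt.eventually (lt_mem_nhds h)] with y hy
      rw [max_eq_left hy.le]
    · have h2 : ε * (x - t) < 0 := lt_of_le_of_ne (not_lt.1 h)
        (mul_ne_zero hε0 (sub_ne_zero.2 (Ne.symm ht)))
      refine (hasDerivAt_const x (0 : ℂ)).congr_of_eventuallyEq ?_
      filter_upwards [hx.continuousAt.eventually (gt_mem_nhds h2)] with y hy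
      rw [max_eq_right hy.le, oscKernel_zero]

/-- The derivative is `n x = -∫_x^∞ e^{2iz(t-x)} b t dt`, which solves a first-order linear
equation. Together these say that the integral is a particular solution of `q'' + 2 i z q' = b`. -/
lemma exists_primitive_integral_oscKernel_right {b : ℝ → ℂ} (hb : Integrable b halfLine)
    (hb' : Integrable (fun t => t * b t) halfLine) {z : ℂ} (hz : 0 ≤ z.im) :
    ∃ n, IsPrimitive (fun x => ∫ t in Ioi 0, oscKernel z (max (t - x) 0) * b t) n ∧
      IsPrimitive n (fun x => b x - 2 * Complex.I * z * n x) ∧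
      ∀ x, 0 ≤ x → ‖n x‖ ≤ ∫ t in Ioi 0, ‖b t‖ := by
  set w := -(2 * Complex.I * z) with hw
  have hexp : ∀ t, 0 < t → ‖Complex.exp (-w * (t : ℝ))‖ ≤ 1 := fun t ht => by
    rw [hw, neg_neg, norm_exp_two_I_mul, Real.exp_le_one_iff]
    have := mul_nonneg hz ht.le
    linarith
  have hβ : Integrable (fun t : ℝ => Complex.exp (-w * t) * b t) halfLine := by
    refine Integrable.mono' hb.norm (AEStronglyMeasurable.mul (by fun_prop) hb.1) ?_
    filter_upwards [ae_restrict_mem measurableSet_Ioi] with t ht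
    rw [norm_mul]
    exact mul_le_of_le_one_left (norm_nonneg _) (hexp t ht)
  have hn := isPrimitive_cexp_mul hb w (-∫ t in Ioi (0 : ℝ), Complex.exp (-w * (t : ℝ)) * b t)
  set n : ℝ → ℂ := fun x => Complex.exp (w * x) * (-(∫ t in Ioi (0 : ℝ), Complex.exp (-w * (t : ℝ)) * b t) +
    ∫ t in (0 : ℝ)..x, Complex.exp (-w * t) * b t) with hndef
  have hnx : ∀ x, 0 ≤ x → n x = -∫ t in Ioi x, Complex.exp (2 * Complex.I * z * (t - x : ℝ)) * b t := by
    intro x hx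
    have hix : IntegrableOn (fun t : ℝ => Complex.exp (-w * t) * b t) (Ioi x) :=
      hβ.mono_measure (Measure.restrict_mono (Ioi_subset_Ioi hx) le_rfl)
    have h1 : -(∫ t in Ioi (0 : ℝ), Complex.exp (-w * (t : ℝ)) * b t) +
        ∫ t in (0 : ℝ)..x, Complex.exp (-w * t) * b t =
        -∫ t in Ioi x, Complex.exp (-w * (t : ℝ)) * b t := by
      rw [← intervalIntegral.integral_interval_add_Ioi hβ hix]
      ring
    rw [hndef]
    simp only
    rw [h1, mul_neg, ← integral_const_mul]
    congr 2
    ext t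
    rw [← mul_assoc, ← Complex.exp_add]
    congr 2
    push_cast
    rw [hw]
    ring
  refine ⟨n, ?_, hn.congr_deriv fun x _ => by rw [hw]; ring, fun x hx => ?_⟩
  · have hd : ∀ x, 0 ≤ x → HasDerivAt
        (fun y => ∫ t in Ioi 0, oscKernel z (max (t - y) 0) * b t) (n x) x := by
      intro x hx
      have h := hasDerivAt_integral_oscKernel hb hz (-1) (by simp) x (by
        have hc : Continuous fun t => oscKernel z (max (-1 * (x - t)) 0) :=
          continuous_oscKernel.comp (by fun_prop : Continuous fun t => (z, max (-1 * (x - t)) 0))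
        refine Integrable.mono' hb'.norm (hc.aestronglyMeasurable.mul hb.1) ?_
        filter_upwards [ae_restrict_mem measurableSet_Ioi] with t ht
        rw [norm_mul, norm_mul]
        gcongr
        refine (norm_oscKernel_le hz (le_max_right _ _)).trans ?_
        rw [Complex.norm_real, Real.norm_of_nonneg (le_of_lt ht)]
        exact max_le (by linarith) (le_of_lt ht))
      simp only [neg_mul, one_mul, neg_sub, sub_pos] at h
      convert h using 1
      rw [hnx x hx, ← integral_neg, ← integral_indicator measurableSet_Ioi,
        ← integral_indicator measurableSet_Ioi]
      congr 1
      ext t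
      by_cases h1 : x < t
      · rw [indicator_of_mem (mem_Ioi.2 h1), indicator_of_mem (mem_Ioi.2 (hx.trans_lt h1)), if_pos h1]
        push_cast
        ring
      · rw [indicator_of_notMem (by simpa using h1)]
        simp [h1, indicator]
    exact .of_hasDerivAt (fun x hx => (hd x hx).continuousAt.continuousWithinAt)
      (fun x hx => hd x hx.le)
      fun R hR => (hn.continuousOn.mono (by rw [uIcc_of_le hR]; exact Icc_subset_Ici_self)
        |>.intervalIntegrable)
  · rw [hnx x hx, norm_neg]
    calc _ ≤ ∫ t in Ioi x, ‖b t‖ := by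
          refine norm_integral_le_of_norm_le (IntegrableOn.mono_set hb.norm (Ioi_subset_Ioi hx)) ?_
          filter_upwards [ae_restrict_mem measurableSet_Ioi] with t ht
          rw [norm_mul]
          refine mul_le_of_le_one_left (norm_nonneg _) ?_
          rw [norm_exp_two_I_mul, Real.exp_le_one_iff]
          have := mul_nonneg hz (sub_nonneg.2 (le_of_lt (mem_Ioi.1 ht)))
          linarith
      _ ≤ _ := setIntegral_mono_set hb.norm (ae_of_all _ fun t => norm_nonneg _)
            (LE.le.eventuallyLE (Ioi_subset_Ioi hx))

lemma exists_primitive_integral_oscKernel_left {b : ℝ → ℂ} (hb : Integrable b halfLine)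
    {z : ℂ} (hz : 0 ≤ z.im) :
    ∃ n, IsPrimitive (fun x => ∫ t in Ioi 0, oscKernel z (max (x - t) 0) * b t) n ∧
      IsPrimitive n (fun x => b x + 2 * Complex.I * z * n x) ∧ n 0 = 0 := by
  set w := 2 * Complex.I * z with hw
  have hn := isPrimitive_cexp_mul hb w 0
  set n : ℝ → ℂ := fun x => Complex.exp (w * x) * (0 +
    ∫ t in (0 : ℝ)..x, Complex.exp (-w * t) * b t) with hndef
  refine ⟨n, ?_, hn, by simp [hndef]⟩
  have hd : ∀ x, 0 ≤ x → HasDerivAt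
      (fun y => ∫ t in Ioi 0, oscKernel z (max (y - t) 0) * b t) (n x) x := by
    intro x hx
    have h := hasDerivAt_integral_oscKernel hb hz 1 (by simp) x (by
      have hc : Continuous fun t => oscKernel z (max (1 * (x - t)) 0) :=
        continuous_oscKernel.comp (by fun_prop : Continuous fun t => (z, max (1 * (x - t)) 0))
      refine Integrable.mono' (hb.norm.const_mul x) (hc.aestronglyMeasurable.mul hb.1) ?_
      filter_upwards [ae_restrict_mem measurableSet_Ioi] with t ht
      rw [norm_mul]
      gcongr
      refine (norm_oscKernel_le hz (le_max_right _ _)).trans ?_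
      have := mem_Ioi.1 ht
      exact max_le (by linarith) hx)
    simp only [one_mul, sub_pos] at h
    convert h using 1
    rw [hndef]
    simp only
    rw [zero_add, intervalIntegral.integral_of_le hx, integral_Ioc_eq_integral_Ioo,
      ← integral_const_mul, ← integral_indicator measurableSet_Ioo,
      ← integral_indicator measurableSet_Ioi]
    congr 1
    ext t
    by_cases h1 : 0 < t
    · by_cases h2 : t < x
      · rw [indicator_of_mem (mem_Ioo.2 ⟨h1, h2⟩), indicator_of_mem (mem_Ioi.2 h1), if_pos h2,
          ← mul_assoc, ← Complex.exp_add]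
        push_cast
        rw [one_mul]
        congr 2
        ring
      · rw [indicator_of_notMem (by simp [h2])]
        simp [h2, indicator]
    · rw [indicator_of_notMem (by simp [h1]), indicator_of_notMem (by simpa using h1)]
  exact .of_hasDerivAt (fun x hx => (hd x hx).continuousAt.continuousWithinAt)
    (fun x hx => hd x hx.le)
    fun R hR => (hn.continuousOn.mono (by rw [uIcc_of_le hR]; exact Icc_subset_Ici_self)
      |>.intervalIntegrable)

end Volterra

/-! ### Amplitudes of the Jost and of the regular solution -/

section Amplitudes

open scoped BoundedContinuousFunction

lemma continuous_primitive_of_integrable {W : ℝ → ℝ} (hW : Integrable W) :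
    Continuous fun x => ∫ t in (0 : ℝ)..x, W t :=
  intervalIntegral.continuous_primitive (fun _ _ => hW.intervalIntegrable) 0

lemma primitive_nonneg {W : ℝ → ℝ} (h0 : ∀ x, 0 ≤ W x) (hz : ∀ x, x ≤ 0 → W x = 0) (x : ℝ) :
    0 ≤ ∫ t in (0 : ℝ)..x, W t := by
  rcases le_total 0 x with hx | hx
  · exact intervalIntegral.integral_nonneg hx fun t _ => h0 t
  · rw [intervalIntegral.integral_congr (g := fun _ => (0 : ℝ))]
    · simp
    · intro t ht
      rw [uIcc_of_ge hx] at ht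
      exact hz t ht.2

lemma primitive_le {W : ℝ → ℝ} (hW : Integrable W) (h0 : ∀ x, 0 ≤ W x) (hz : ∀ x, x ≤ 0 → W x = 0)
    (x : ℝ) : ∫ t in (0 : ℝ)..x, W t ≤ ∫ t, W t := by
  rcases le_total 0 x with hx | hx
  · rw [intervalIntegral.integral_of_le hx]
    exact setIntegral_le_integral hW (ae_of_all _ h0)
  · rw [intervalIntegral.integral_congr (g := fun _ => (0 : ℝ))]
    · simpa using integral_nonneg h0
    · intro t ht
      rw [uIcc_of_ge hx] at ht
      exact hz t ht.2

lemma primitive_max {W : ℝ → ℝ} (hz : ∀ x, x ≤ 0 → W x = 0) (x : ℝ) :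
    ∫ t in (0 : ℝ)..(max x 0), W t = ∫ t in (0 : ℝ)..x, W t := by
  rcases le_total 0 x with hx | hx
  · rw [max_eq_left hx]
  · rw [max_eq_right hx, intervalIntegral.integral_congr (a := 0) (b := x) (g := fun _ => (0 : ℝ))]
    · simp
    · intro t ht
      rw [uIcc_of_ge hx] at ht
      exact hz t ht.2

lemma intervalIntegral_mul_exp_le {W : ℝ → ℝ} (hW : Integrable W) {x : ℝ} (hx : 0 ≤ x) :
    ∫ t in (0 : ℝ)..x, W t * Real.exp (2 * ∫ s in (0 : ℝ)..t, W s) ≤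
      Real.exp (2 * ∫ s in (0 : ℝ)..x, W s) / 2 := by
  have h := integral_mul_exp_primitive hW 2 le_rfl hx
  simp only [mul_assoc] at h
  rw [intervalIntegral.integral_const_mul] at h
  have := Real.exp_pos (2 * ∫ t in (0 : ℝ)..0, W t)
  linarith

lemma integral_Ioi_mul_exp_le {W : ℝ → ℝ} (hW : Integrable W) (h0 : ∀ x, 0 ≤ W x)
    (hz : ∀ x, x ≤ 0 → W x = 0) {x : ℝ} (hx : 0 ≤ x) :
    ∫ t in Ioi x, W t * Real.exp (2 * -∫ s in (0 : ℝ)..t, W s) ≤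
      Real.exp (2 * -∫ s in (0 : ℝ)..x, W s) / 2 := by
  have hc := continuous_primitive_of_integrable hW
  have hi : Integrable fun t => W t * Real.exp (2 * -∫ s in (0 : ℝ)..t, W s) := by
    refine Integrable.mono' hW (hW.1.mul (by fun_prop)) (ae_of_all _ fun t => ?_)
    rw [norm_mul, Real.norm_of_nonneg (h0 t), Real.norm_eq_abs, Real.abs_exp]
    refine mul_le_of_le_one_right (h0 t) (Real.exp_le_one_iff.2 ?_)
    have := primitive_nonneg h0 hz t
    linarith
  refine le_of_tendsto (intervalIntegral_tendsto_integral_Ioi x hi.integrableOn tendsto_id) ?_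
  filter_upwards [eventually_ge_atTop x] with R hR
  have h := integral_mul_exp_primitive hW (-2) hx hR
  simp only [mul_assoc] at h
  rw [intervalIntegral.integral_const_mul] at h
  simp only [neg_mul, mul_neg, id] at h ⊢
  have := Real.exp_pos (-(2 * ∫ t in (0 : ℝ)..R, W t))
  linarith

/-- The retraction of the plane onto the closed upper half-plane. -/
def clampIm (k : ℂ) : ℂ := ⟨k.re, max k.im 0⟩

lemma continuous_clampIm : Continuous clampIm := by
  have : clampIm = fun k : ℂ => (k.re : ℂ) + (max k.im 0 : ℝ) * Complex.I := by
    funext k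
    apply Complex.ext <;> simp [clampIm]
  rw [this]
  fun_prop

lemma clampIm_im (k : ℂ) : 0 ≤ (clampIm k).im := le_max_right _ _

lemma clampIm_of_nonneg {k : ℂ} (hk : 0 ≤ k.im) : clampIm k = k := by
  simp [clampIm, hk]

variable {V : ℝ → ℂ}

lemma exists_jost_amplitude (hV : AEStronglyMeasurable V halfLine)
    (hW : IntegrableOn (fun t => (1 + t) * ‖V t‖) (Ioi 0)) :
    ∃ m : (ℝ × ℂ) →ᵇ ℂ, ∀ (x : ℝ) (k : ℂ), 0 ≤ x → 0 ≤ k.im →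
      m (x, k) = 1 + ∫ t in Ioi 0, oscKernel k (max (t - x) 0) * (V t * m (t, k)) := by
  set W : ℝ → ℝ := indicator (Ioi 0) fun t => (1 + t) * ‖V t‖ with hWdef
  have hWi : Integrable W := (integrable_indicator_iff measurableSet_Ioi).2 hW
  have h0 : ∀ x, 0 ≤ W x := indicator_nonneg fun t ht => by
    have := mem_Ioi.1 ht
    positivity
  have hz : ∀ x, x ≤ 0 → W x = 0 := fun x hx => indicator_of_notMem (by simpa using hx) _
  set τ : ℝ → ℝ := fun x => ∫ t in (0 : ℝ)..x, W t with hτ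
  have hc : Continuous τ := continuous_primitive_of_integrable hWi
  have hτS := primitive_le hWi h0 hz
  have hτ0 := primitive_nonneg h0 hz
  set S := ∫ t, W t
  have hκ1 : ∀ (p : ℝ × ℂ) t, 0 < t →
      ‖oscKernel (clampIm p.2) (max (t - max p.1 0) 0)‖ ≤ t := fun p t ht => by
    refine (norm_oscKernel_le (clampIm_im _) (le_max_right _ _)).trans (max_le ?_ ht.le)
    have := le_max_right p.1 0
    linarith
  have hκW : ∀ (p : ℝ × ℂ) t, 0 < t →
      ‖oscKernel (clampIm p.2) (max (t - max p.1 0) 0)‖ * ‖V t‖ ≤ W t := fun p t ht => by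
    rw [hWdef, indicator_of_mem (mem_Ioi.2 ht)]
    gcongr
    exact (hκ1 p t ht).trans (by linarith)
  -- Clamping `x` and `Im k` extends the kernel to all of `ℝ × ℂ`. The integral runs over `t > x`,
  -- so the weight `exp (2 (S - τ x))`, with `τ' = W`, decreases in `x`; integrating `W` times it
  -- over `(x, ∞)` returns at most half of it.
  obtain ⟨m, hm⟩ := exists_volterra (V := V) (W := W)
    (κ := fun p t => oscKernel (clampIm p.2) (max (t - max p.1 0) 0))
    (ω := fun x => Real.exp (2 * (S - τ x))) (M := Real.exp (2 * S)) hV hWi.integrableOn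
    (continuous_oscKernel.comp (f := fun q : (ℝ × ℂ) × ℝ => (clampIm q.1.2,
      max (q.2 - max q.1.1 0) 0)) (Continuous.prodMk (continuous_clampIm.comp (by fun_prop))
        (by fun_prop)))
    hκW (by fun_prop)
    (fun x => Real.one_le_exp (by have : τ x ≤ S := hτS x; linarith))
    (fun x => Real.exp_le_exp.2 (by have : 0 ≤ τ x := hτ0 x; linarith))
    (fun p => by
      have hx : 0 ≤ max p.1 0 := le_max_right _ _
      have hmul : ∀ t, W t * Real.exp (2 * (S - τ t)) =
          Real.exp (2 * S) * (W t * Real.exp (2 * -τ t)) := fun t => by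
        rw [mul_sub, sub_eq_add_neg, Real.exp_add, mul_neg]
        ring
      have hbd : ∀ t, 0 < t →
          ‖oscKernel (clampIm p.2) (max (t - max p.1 0) 0)‖ * ‖V t‖ * Real.exp (2 * (S - τ t)) ≤
          indicator (Ioi (max p.1 0)) (fun t => W t * Real.exp (2 * (S - τ t))) t := fun t ht => by
        by_cases h : max p.1 0 < t
        · rw [indicator_of_mem (mem_Ioi.2 h)]
          gcongr
          exact hκW p t ht
        · rw [indicator_of_notMem (by simpa using h), max_eq_right (by linarith [not_lt.1 h]),
            oscKernel_zero]
          simp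
      have hi : Integrable fun t => W t * Real.exp (2 * (S - τ t)) := by
        refine Integrable.mono' (hWi.mul_const (Real.exp (2 * S)))
          (hWi.1.mul (by fun_prop)) (ae_of_all _ fun t => ?_)
        rw [norm_mul, Real.norm_of_nonneg (h0 t), Real.norm_eq_abs, Real.abs_exp]
        refine mul_le_mul_of_nonneg_left (Real.exp_le_exp.2 ?_) (h0 t)
        have : 0 ≤ τ t := hτ0 t
        linarith
      calc ∫ t in Ioi 0, ‖oscKernel (clampIm p.2) (max (t - max p.1 0) 0)‖ * ‖V t‖ *
              Real.exp (2 * (S - τ t))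
          ≤ ∫ t in Ioi 0, indicator (Ioi (max p.1 0)) (fun t => W t * Real.exp (2 * (S - τ t))) t := by
            refine integral_mono_of_nonneg (ae_of_all _ fun t => by positivity)
              (hi.indicator measurableSet_Ioi).integrableOn ?_
            filter_upwards [ae_restrict_mem measurableSet_Ioi] with t ht using hbd t ht
        _ = ∫ t in Ioi (max p.1 0), W t * Real.exp (2 * (S - τ t)) := by
            rw [setIntegral_indicator measurableSet_Ioi, inter_eq_right.2 (Ioi_subset_Ioi hx)]
        _ = Real.exp (2 * S) * ∫ t in Ioi (max p.1 0), W t * Real.exp (2 * -τ t) := by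
            rw [← integral_const_mul]
            congr 1
            ext t
            exact hmul t
        _ ≤ Real.exp (2 * S) * (Real.exp (2 * -τ (max p.1 0)) / 2) := by
            gcongr
            exact integral_Ioi_mul_exp_le hWi h0 hz hx
        _ = Real.exp (2 * (S - τ p.1)) / 2 := by
            have : τ (max p.1 0) = τ p.1 := primitive_max hz p.1
            rw [this, mul_sub, sub_eq_add_neg (2 * S), Real.exp_add, mul_neg]
            ring)
    (BoundedContinuousFunction.const _ 1)
  refine ⟨m, fun x k hx hk => ?_⟩
  rw [hm (x, k)]
  simp only [BoundedContinuousFunction.const_apply, clampIm_of_nonneg hk, max_eq_left hx]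

lemma exists_regular_amplitude (hV : AEStronglyMeasurable V halfLine)
    (hW : IntegrableOn (fun t => (1 + t) * ‖V t‖) (Ioi 0)) :
    ∃ r : (ℝ × ℂ) →ᵇ ℂ, ∀ (x : ℝ) (k : ℂ), 0 ≤ x → 0 ≤ k.im →
      (1 + x) * r (x, k) = oscKernel k x +
        ∫ t in Ioi 0, oscKernel k (max (x - t) 0) * (V t * ((1 + t) * r (t, k))) := by
  set W : ℝ → ℝ := indicator (Ioi 0) fun t => (1 + t) * ‖V t‖ with hWdef
  have hWi : Integrable W := (integrable_indicator_iff measurableSet_Ioi).2 hW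
  have h0 : ∀ x, 0 ≤ W x := indicator_nonneg fun t ht => by
    have := mem_Ioi.1 ht
    positivity
  have hz : ∀ x, x ≤ 0 → W x = 0 := fun x hx => indicator_of_notMem (by simpa using hx) _
  set τ : ℝ → ℝ := fun x => ∫ t in (0 : ℝ)..x, W t with hτ
  have hc : Continuous τ := continuous_primitive_of_integrable hWi
  have hτS := primitive_le hWi h0 hz
  have hτ0 := primitive_nonneg h0 hz
  set S := ∫ t, W t
  have hpos : ∀ x : ℝ, 0 < 1 + max x 0 := fun x => by
    have := le_max_right x 0
    linarith
  have hposC : ∀ x : ℝ, (1 + (max x 0 : ℝ) : ℂ) ≠ 0 := fun x => by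
    exact_mod_cast (hpos x).ne'
  -- The regular solution grows linearly at `k = 0`, so the unknown is divided by `1 + x`. The
  -- quotient `(1 + t)/(1 + x)` absorbs the linear growth of `oscKernel` and leaves the majorant `(1
  -- + t)|V|`.
  set κ : ℝ × ℂ → ℝ → ℂ := fun p t =>
    oscKernel (clampIm p.2) (max (max p.1 0 - t) 0) * ((1 + (t : ℂ)) / (1 + (max p.1 0 : ℝ)))
    with hκdef
  have hκc : Continuous (Function.uncurry κ) := by
    refine Continuous.mul (continuous_oscKernel.comp (f := fun q : (ℝ × ℂ) × ℝ => (clampIm q.1.2,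
      max (max q.1.1 0 - q.2) 0)) (Continuous.prodMk (continuous_clampIm.comp (by fun_prop))
        (by fun_prop))) ?_
    refine Continuous.div (by fun_prop) (by fun_prop) fun q => hposC _
  have hκW : ∀ (p : ℝ × ℂ) t, 0 < t → ‖κ p t‖ * ‖V t‖ ≤ W t := fun p t ht => by
    rw [hWdef, indicator_of_mem (mem_Ioi.2 ht)]
    gcongr
    have e : ‖((1 + (t : ℂ)) / (1 + (max p.1 0 : ℝ)))‖ = (1 + t) / (1 + max p.1 0) := by
      rw [norm_div]
      norm_cast
      rw [Real.norm_of_nonneg (by linarith), Real.norm_of_nonneg (hpos _).le]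
    rw [hκdef]
    simp only
    rw [norm_mul, e, ← mul_div_assoc, div_le_iff₀ (hpos _), mul_comm]
    have h3 := le_max_right p.1 0
    gcongr
    refine (norm_oscKernel_le (clampIm_im _) (le_max_right _ _)).trans (max_le ?_ ?_) <;> linarith
  have hgc : Continuous fun p : ℝ × ℂ =>
      oscKernel (clampIm p.2) (max p.1 0) / (1 + (max p.1 0 : ℝ)) := by
    refine Continuous.div (continuous_oscKernel.comp (f := fun q : ℝ × ℂ => (clampIm q.2,
      max q.1 0)) (Continuous.prodMk (continuous_clampIm.comp (by fun_prop))
        (by fun_prop))) (by fun_prop) fun q => hposC _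
  have hg1 : ∀ p : ℝ × ℂ, ‖oscKernel (clampIm p.2) (max p.1 0) / (1 + (max p.1 0 : ℝ))‖ ≤ 1 := by
    intro p
    have e : ‖(1 + (max p.1 0 : ℝ) : ℂ)‖ = 1 + max p.1 0 := by
      norm_cast
      rw [Real.norm_of_nonneg (hpos _).le]
    rw [norm_div, e, div_le_one (hpos _)]
    exact (norm_oscKernel_le (clampIm_im _) (le_max_right _ _)).trans (by linarith)
  -- The integral now runs over `t < x`, so the weight `exp (2 τ x)` is increasing.
  obtain ⟨r, hr⟩ := exists_volterra (V := V) (W := W) (κ := κ)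
    (ω := fun x => Real.exp (2 * τ x)) (M := Real.exp (2 * S)) hV hWi.integrableOn hκc
    hκW (by fun_prop)
    (fun x => Real.one_le_exp (by have : 0 ≤ τ x := hτ0 x; linarith))
    (fun x => Real.exp_le_exp.2 (by have : τ x ≤ S := hτS x; linarith))
    (fun p => by
      have hx : 0 ≤ max p.1 0 := le_max_right _ _
      have hbd : ∀ t, 0 < t → ‖κ p t‖ * ‖V t‖ * Real.exp (2 * τ t) ≤
          indicator (Iic (max p.1 0)) (fun t => W t * Real.exp (2 * τ t)) t := fun t ht => by
        by_cases h : t ≤ max p.1 0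
        · rw [indicator_of_mem (mem_Iic.2 h)]
          gcongr
          exact hκW p t ht
        · rw [indicator_of_notMem (by simpa using h), hκdef]
          simp only
          rw [max_eq_right (b := 0) (by linarith [not_le.1 h]), oscKernel_zero]
          simp
      have hi : Integrable fun t => W t * Real.exp (2 * τ t) := by
        refine Integrable.mono' (hWi.mul_const (Real.exp (2 * S)))
          (hWi.1.mul (by fun_prop)) (ae_of_all _ fun t => ?_)
        rw [norm_mul, Real.norm_of_nonneg (h0 t), Real.norm_eq_abs, Real.abs_exp]
        refine mul_le_mul_of_nonneg_left (Real.exp_le_exp.2 ?_) (h0 t)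
        have : τ t ≤ S := hτS t
        linarith
      calc ∫ t in Ioi 0, ‖κ p t‖ * ‖V t‖ * Real.exp (2 * τ t)
          ≤ ∫ t in Ioi 0, indicator (Iic (max p.1 0)) (fun t => W t * Real.exp (2 * τ t)) t := by
            refine integral_mono_of_nonneg (ae_of_all _ fun t => by positivity)
              (hi.indicator measurableSet_Iic).integrableOn ?_
            filter_upwards [ae_restrict_mem measurableSet_Ioi] with t ht using hbd t ht
        _ = ∫ t in (0 : ℝ)..(max p.1 0), W t * Real.exp (2 * τ t) := by
            rw [setIntegral_indicator measurableSet_Iic, Ioi_inter_Iic,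
              intervalIntegral.integral_of_le hx]
        _ ≤ Real.exp (2 * τ (max p.1 0)) / 2 := intervalIntegral_mul_exp_le hWi hx
        _ = Real.exp (2 * τ p.1) / 2 := by
            have : τ (max p.1 0) = τ p.1 := primitive_max hz p.1
            rw [this])
    (BoundedContinuousFunction.ofNormedAddCommGroup _ hgc 1 hg1)
  refine ⟨r, fun x k hx hk => ?_⟩
  have hx1 : (1 + (x : ℂ)) ≠ 0 := by simpa [hx] using hposC x
  rw [hr (x, k)]
  simp only [BoundedContinuousFunction.coe_ofNormedAddCommGroup, hκdef, clampIm_of_nonneg hk,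
    max_eq_left hx]
  rw [mul_add, mul_div_cancel₀ _ hx1, ← integral_const_mul]
  congr 2
  ext t
  field_simp

end Amplitudes

/-! ### Jost and regular solutions, and nonvanishing of the Jost function -/

section Solutions

open scoped BoundedContinuousFunction ComplexConjugate

variable {V : ℝ → ℂ}

/-- `y`, with derivative `y'`, solves `-y'' + V y = k² y` on the half-line. -/
structure IsSolution (V : ℝ → ℂ) (k : ℂ) (y y' : ℝ → ℂ) : Prop where
  primitive : IsPrimitive y y'
  primitive_deriv : IsPrimitive y' fun t => (V t - k ^ 2) * y t

/-- Removing the factor `e^{wx}`, with `w = ± i k`, turns the Schrödinger equation into `q'' = V q -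
2 w q'`. -/
lemma isSolution_of_amplitude {k w : ℂ} (hw : w ^ 2 = -k ^ 2) {q n b : ℝ → ℂ} (hq : IsPrimitive q n)
    (hn : IsPrimitive n fun x => b x - 2 * w * n x) (hb : ∀ x, 0 ≤ x → b x = V x * q x) :
    IsSolution V k (fun x => Complex.exp (w * x) * q x)
      fun x => Complex.exp (w * x) * (w * q x + n x) := by
  refine ⟨((isPrimitive_cexp w).mul hq).congr_deriv fun x _ => by ring,
    ((isPrimitive_cexp w).mul ((hq.const_mul w).add hn)).congr_deriv fun x hx => ?_⟩
  linear_combination Complex.exp (w * x) * hb x hx + Complex.exp (w * x) * q x * hw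

lemma norm_exp_I_mul_mul (k : ℂ) (x : ℝ) :
    ‖Complex.exp (Complex.I * k * x)‖ = Real.exp (-(k.im * x)) := by
  rw [Complex.norm_exp]
  congr 1
  simp

lemma integrable_mul_amplitude {W : ℝ → ℝ} {b q : ℝ → ℂ} {C : ℝ} (hb : AEStronglyMeasurable b halfLine)
    (hW : IntegrableOn W (Ioi 0)) (hq : Continuous q) (hC : ∀ t, 0 < t → ‖b t‖ * ‖q t‖ ≤ C * W t) :
    Integrable (fun t => b t * q t) halfLine := by
  refine Integrable.mono' (hW.const_mul C) (hb.mul hq.aestronglyMeasurable) ?_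
  filter_upwards [ae_restrict_mem measurableSet_Ioi] with t ht
  rw [norm_mul]
  exact hC t ht

/-- The Jost solution attached to its amplitude. -/
lemma exists_jost_solution (hV : AEStronglyMeasurable V halfLine)
    (hW : IntegrableOn (fun t => (1 + t) * ‖V t‖) (Ioi 0)) {m : (ℝ × ℂ) →ᵇ ℂ} {k : ℂ}
    (hk : 0 ≤ k.im) (hm : ∀ x : ℝ, 0 ≤ x →
      m (x, k) = 1 + ∫ t in Ioi 0, oscKernel k (max (t - x) 0) * (V t * m (t, k))) :
    ∃ e e' : ℝ → ℂ, IsSolution V k e e' ∧ (∀ x, e x = Complex.exp (Complex.I * k * x) * m (x, k)) ∧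
      ∃ C, ∀ x, 0 ≤ x → ‖e' x‖ ≤ C * Real.exp (-(k.im * x)) := by
  have hmc : Continuous fun t => m (t, k) := m.continuous.comp (by fun_prop)
  have hb : Integrable (fun t => V t * m (t, k)) halfLine :=
    integrable_mul_amplitude (C := ‖m‖) hV hW hmc fun t ht => by
      have := m.norm_coe_le_norm (t, k)
      have h2 : ‖V t‖ ≤ (1 + t) * ‖V t‖ := le_mul_of_one_le_left (norm_nonneg _) (by linarith)
      nlinarith [norm_nonneg (V t), norm_nonneg m]
  have hb' : Integrable (fun t => t * (V t * m (t, k))) halfLine := by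
    simp only [← mul_assoc]
    refine integrable_mul_amplitude (C := ‖m‖) (Continuous.aestronglyMeasurable (by fun_prop) |>.mul
      hV) hW hmc fun t ht => ?_
    rw [norm_mul, Complex.norm_real, Real.norm_of_nonneg ht.le]
    have := m.norm_coe_le_norm (t, k)
    have h2 : t * ‖V t‖ ≤ (1 + t) * ‖V t‖ := by gcongr; linarith
    have h3 : 0 ≤ t * ‖V t‖ := by positivity
    nlinarith [norm_nonneg m]
  obtain ⟨n, hn, hn', hnb⟩ := exists_primitive_integral_oscKernel_right hb hb' hk
  have hq : IsPrimitive (fun x => m (x, k)) n := by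
    have := (IsPrimitive.const 1).add hn
    simp only [zero_add] at this
    exact this.congr_left fun x hx => (hm x hx).symm
  refine ⟨_, _, isSolution_of_amplitude (w := Complex.I * k) ?_ hq
    (hn'.congr_deriv fun x _ => by ring) (fun x _ => rfl), fun x => rfl,
    ‖k‖ * ‖m‖ + ∫ t in Ioi 0, ‖V t * m (t, k)‖, fun x hx => ?_⟩
  · rw [mul_pow, Complex.I_sq]
    ring
  · rw [norm_mul, norm_exp_I_mul_mul, mul_comm]
    gcongr
    refine (norm_add_le _ _).trans (add_le_add ?_ (hnb x hx))
    rw [norm_mul, norm_mul, Complex.norm_I, one_mul]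
    gcongr
    exact m.norm_coe_le_norm _

/-- The regular solution attached to its amplitude. -/
lemma exists_regular_solution (hV : AEStronglyMeasurable V halfLine)
    (hW : IntegrableOn (fun t => (1 + t) * ‖V t‖) (Ioi 0)) {r : (ℝ × ℂ) →ᵇ ℂ} {k : ℂ}
    (hk : 0 ≤ k.im) (hr : ∀ x : ℝ, 0 ≤ x → (1 + x) * r (x, k) = oscKernel k x +
        ∫ t in Ioi 0, oscKernel k (max (x - t) 0) * (V t * ((1 + t) * r (t, k)))) :
    ∃ φ φ' : ℝ → ℂ, IsSolution V k φ φ' ∧ φ 0 = 0 ∧ φ' 0 = 1 ∧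
      ∀ x, 0 ≤ x → ‖φ x‖ ≤ ‖r‖ * (1 + x) * Real.exp (k.im * x) := by
  have hrc : Continuous fun t => r (t, k) := r.continuous.comp (by fun_prop)
  have hb : Integrable (fun t : ℝ => V t * ((1 + t) * r (t, k))) halfLine := by
    refine integrable_mul_amplitude (C := ‖r‖) hV hW (by fun_prop) fun t ht => ?_
    have e : ‖(1 + (t : ℂ))‖ = 1 + t := by
      norm_cast
      rw [Real.norm_of_nonneg (by linarith)]
    rw [norm_mul, e]
    have := r.norm_coe_le_norm (t, k)
    have h3 : 0 ≤ (1 + t) * ‖V t‖ := by positivity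
    nlinarith
  obtain ⟨n, hn, hn', hn0⟩ := exists_primitive_integral_oscKernel_left hb hk
  have hosc : IsPrimitive (oscKernel k) fun x => Complex.exp (2 * Complex.I * k * x) :=
    .of_hasDerivWithinAt (fun x _ => (hasDerivAt_oscKernel k x).hasDerivWithinAt) (by fun_prop)
  have hq : IsPrimitive (fun x : ℝ => (1 + x) * r (x, k))
      fun x => Complex.exp (2 * Complex.I * k * x) + n x :=
    (hosc.add hn).congr_left fun x hx => (hr x hx).symm
  have hsol := isSolution_of_amplitude (V := V) (k := k) (w := -(Complex.I * k)) (by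
    rw [neg_sq, mul_pow, Complex.I_sq]
    ring) hq (((isPrimitive_cexp (2 * Complex.I * k)).add hn').congr_deriv
      (g' := fun x => V x * ((1 + x) * r (x, k)) - 2 * -(Complex.I * k) *
        (Complex.exp (2 * Complex.I * k * x) + n x)) fun x _ => by ring) (fun x _ => rfl)
  have hr0 : r (0, k) = 0 := by
    have := hr 0 le_rfl
    rw [oscKernel_zero] at this
    rw [setIntegral_congr_fun (g := fun _ => 0) measurableSet_Ioi (fun t ht => by
      have := mem_Ioi.1 ht
      simp only
      rw [max_eq_right (by linarith), oscKernel_zero, zero_mul])] at this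
    simpa using this
  refine ⟨_, _, hsol, by simp [hr0], by simp [hr0, hn0], fun x hx => ?_⟩
  have e : ‖(1 + (x : ℂ))‖ = 1 + x := by
    norm_cast
    rw [Real.norm_of_nonneg (by linarith)]
  have e2 : ‖Complex.exp (-(Complex.I * k) * x)‖ = Real.exp (k.im * x) := by
    rw [Complex.norm_exp]
    congr 1
    simp
  rw [norm_mul, norm_mul, e, e2, mul_comm]
  have := r.norm_coe_le_norm (x, k)
  gcongr ?_ * _
  rw [mul_comm]
  gcongr

/-- Potentials with a regular solution and a Jost solution obeying bounds that are uniform in the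
open upper half-plane, and whose Jost function is bounded away from zero. -/
def HasUniformSolutions (V : ℝ → ℂ) : Prop :=
  ∃ C c : ℝ, 0 ≤ C ∧ 0 < c ∧ ∀ k : ℂ, 0 < k.im → ∃ φ φ' e e' : ℝ → ℂ,
    IsSolution V k φ φ' ∧ φ 0 = 0 ∧ φ' 0 = 1 ∧
    (∀ x, 0 ≤ x → ‖φ x‖ ≤ C * (1 + x) * Real.exp (k.im * x)) ∧
    IsSolution V k e e' ∧ (∀ x, 0 ≤ x → ‖e x‖ ≤ C * Real.exp (-(k.im * x))) ∧
    (∃ C', ∀ x, 0 ≤ x → ‖e' x‖ ≤ C' * Real.exp (-(k.im * x))) ∧ c ≤ ‖e 0‖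

lemma IsSolution.star {k : ℂ} {y y' : ℝ → ℂ} (h : IsSolution V (-conj k) y y') :
    IsSolution (fun x => conj (V x)) k (fun x => conj (y x)) fun x => conj (y' x) :=
  ⟨h.1.star, h.2.star.congr_deriv fun x _ => by simp⟩

/-- Conjugating solutions at `-conj k` gives solutions at `k` for the conjugate potential, and `k ↦
-conj k` preserves the open upper half-plane. No separate hypothesis on the adjoint operator is
needed. -/
lemma HasUniformSolutions.star (h : HasUniformSolutions V) :
    HasUniformSolutions fun x => conj (V x) := by
  obtain ⟨C, c, hC, hc, H⟩ := h
  refine ⟨C, c, hC, hc, fun k hk => ?_⟩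
  have e : (-conj k).im = k.im := by simp
  obtain ⟨φ, φ', e, e', h1, h2, h3, h4, h5, h6, ⟨C', h7⟩, h8⟩ := H (-conj k) (by rwa [e])
  simp only [Complex.neg_im, Complex.conj_im, neg_neg] at h4 h6 h7
  exact ⟨_, _, _, _, h1.star, by simp [h2], by simp [h3], by simpa using h4, h5.star,
    by simpa using h6, ⟨C', by simpa using h7⟩, by simpa using h8⟩

/-- Uniform solutions exist if the Jost function has no zero in the closed upper half-plane. -/
lemma hasUniformSolutions_of_ne_zero (hV : AEStronglyMeasurable V halfLine)
    (hW : IntegrableOn (fun t => (1 + t) * ‖V t‖) (Ioi 0)) {m : (ℝ × ℂ) →ᵇ ℂ}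
    (hm : ∀ (x : ℝ) (k : ℂ), 0 ≤ x → 0 ≤ k.im →
      m (x, k) = 1 + ∫ t in Ioi 0, oscKernel k (max (t - x) 0) * (V t * m (t, k)))
    (hne : ∀ k : ℂ, 0 ≤ k.im → m (0, k) ≠ 0) : HasUniformSolutions V := by
  obtain ⟨r, hr⟩ := exists_regular_amplitude hV hW
  have hmc : Continuous fun k => m (0, k) := m.continuous.comp (by fun_prop)
  have hVi : IntegrableOn (fun t => ‖V t‖) (Ioi 0) := by
    refine Integrable.mono' hW hV.norm ?_
    filter_upwards [ae_restrict_mem measurableSet_Ioi] with t ht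
    rw [norm_norm]
    exact le_mul_of_one_le_left (norm_nonneg _) (by linarith [mem_Ioi.1 ht])
  set A := ‖m‖ * ∫ t in Ioi 0, ‖V t‖ with hA
  have hA0 : 0 ≤ A := mul_nonneg (norm_nonneg _) (integral_nonneg fun t => norm_nonneg _)
  have hlarge : ∀ k : ℂ, 0 ≤ k.im → ‖k‖ * ‖m (0, k) - 1‖ ≤ A := by
    intro k hk
    have h1 : k * (m (0, k) - 1) =
        ∫ t in Ioi 0, k * (oscKernel k (max (t - 0) 0) * (V t * m (t, k))) := by
      rw [integral_const_mul, hm 0 k le_rfl hk]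
      ring
    rw [← norm_mul, h1, hA, ← integral_const_mul]
    refine norm_integral_le_of_norm_le (hVi.const_mul _) (ae_of_all _ fun t => ?_)
    rw [← mul_assoc, norm_mul, norm_mul, norm_mul]
    have h2 := norm_mul_norm_oscKernel_le hk (le_max_right (t - 0) 0)
    have h3 := m.norm_coe_le_norm (t, k)
    calc _ ≤ 1 * (‖V t‖ * ‖m‖) := by gcongr
      _ = _ := by ring
  -- For `‖k‖ > 2A + 1` the bound `hlarge` keeps `m (0, k)` within `1/2` of 1; on the remaining
  -- half-disc compactness applies.
  obtain ⟨c, hc, hcm⟩ : ∃ c : ℝ, 0 < c ∧ ∀ k : ℂ, 0 ≤ k.im → c ≤ ‖m (0, k)‖ := by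
    set K : Set ℂ := Metric.closedBall 0 (2 * A + 1) ∩ {k | 0 ≤ k.im} with hK
    have hKc : IsCompact K := (isCompact_closedBall _ _).inter_right
      (isClosed_le continuous_const Complex.continuous_im)
    have hKne : K.Nonempty := ⟨0, by simp only [hK, mem_inter_iff, Metric.mem_closedBall, dist_self,
      mem_ofPred_eq, Complex.zero_im, le_refl, and_true]; positivity⟩
    obtain ⟨k₀, hk₀, hmin⟩ := hKc.exists_isMinOn hKne hmc.norm.continuousOn
    refine ⟨min ‖m (0, k₀)‖ (1 / 2), lt_min (norm_pos_iff.2 (hne k₀ hk₀.2)) (by norm_num),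
      fun k hk => ?_⟩
    by_cases hkK : k ∈ K
    · exact (min_le_left _ _).trans (hmin hkK)
    · refine (min_le_right _ _).trans ?_
      have h1 : 2 * A + 1 < ‖k‖ := by
        by_contra hcon
        exact hkK ⟨mem_closedBall_zero_iff.2 (not_lt.1 hcon), hk⟩
      have h2 := hlarge k hk
      have h3 : ‖m (0, k) - 1‖ ≤ 1 / 2 := by
        by_contra hcon
        push Not at hcon
        nlinarith [norm_nonneg (m (0, k) - 1)]
      have h4 := norm_sub_norm_le 1 (1 - m (0, k))
      rw [sub_sub_cancel, norm_one, norm_sub_rev] at h4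
      linarith
  refine ⟨max ‖r‖ ‖m‖, c, le_max_of_le_left (norm_nonneg _), hc, fun k hk => ?_⟩
  obtain ⟨φ, φ', h1, h2, h3, h4⟩ := exists_regular_solution hV hW hk.le fun x hx => hr x k hx hk.le
  obtain ⟨e, e', h5, h6, h7⟩ := exists_jost_solution hV hW hk.le fun x hx => hm x k hx hk.le
  refine ⟨φ, φ', e, e', h1, h2, h3, fun x hx => (h4 x hx).trans ?_, h5, fun x hx => ?_, h7, ?_⟩
  · gcongr
    exact le_max_left _ _
  · rw [h6, norm_mul, norm_exp_I_mul_mul, mul_comm]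
    gcongr
    exact (m.norm_coe_le_norm _).trans (le_max_right _ _)
  · rw [h6]
    simpa using hcm k hk.le

lemma hasUniformSolutions_zero : HasUniformSolutions fun _ => 0 := by
  have hW : IntegrableOn (fun t : ℝ => (1 + t) * ‖(0 : ℂ)‖) (Ioi 0) := by simp
  obtain ⟨m, hm⟩ := exists_jost_amplitude aestronglyMeasurable_const hW
  refine hasUniformSolutions_of_ne_zero aestronglyMeasurable_const hW hm fun k hk => ?_
  rw [hm 0 k le_rfl hk]
  simp

lemma tendsto_jost_amplitude (hV : AEStronglyMeasurable V halfLine)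
    (hW : IntegrableOn (fun t => (1 + t) * ‖V t‖) (Ioi 0)) {m : (ℝ × ℂ) →ᵇ ℂ} {k : ℂ}
    (hk : 0 ≤ k.im) (hm : ∀ x : ℝ, 0 ≤ x →
      m (x, k) = 1 + ∫ t in Ioi 0, oscKernel k (max (t - x) 0) * (V t * m (t, k))) :
    Tendsto (fun x => m (x, k)) atTop (𝓝 1) := by
  have hmc : Continuous fun t => m (t, k) := m.continuous.comp (by fun_prop)
  have h1 : Tendsto (fun x => ∫ t in Ioi 0, oscKernel k (max (t - x) 0) * (V t * m (t, k))) atTop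
      (𝓝 (∫ t in Ioi (0 : ℝ), (0 : ℂ))) := by
    refine tendsto_integral_filter_of_dominated_convergence (fun t => ((1 + t) * ‖V t‖) * ‖m‖)
      (Eventually.of_forall fun x => ?_) ?_ (hW.mul_const _) (ae_of_all _ fun t => ?_)
    · have hc : Continuous fun t => oscKernel k (max (t - x) 0) :=
        continuous_oscKernel.comp (by fun_prop : Continuous fun t => (k, max (t - x) 0))
      exact hc.aestronglyMeasurable.mul (hV.mul hmc.aestronglyMeasurable)
    · filter_upwards [eventually_ge_atTop 0] with x hx
      filter_upwards [ae_restrict_mem measurableSet_Ioi] with t ht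
      have ht' := mem_Ioi.1 ht
      rw [norm_mul, norm_mul, ← mul_assoc]
      gcongr
      · exact (norm_oscKernel_le hk (le_max_right _ _)).trans
          (max_le (by linarith) (by linarith))
      · exact m.norm_coe_le_norm _
    · refine tendsto_const_nhds.congr' ?_
      filter_upwards [eventually_ge_atTop t] with x hx
      rw [max_eq_right (by linarith), oscKernel_zero, zero_mul]
  rw [integral_zero] at h1
  have h2 := h1.const_add 1
  rw [add_zero] at h2
  refine h2.congr' ?_
  filter_upwards [eventually_ge_atTop 0] with x hx
  exact (hm x hx).symm

lemma mem_graph_schrodinger (hV : MemLp V ∞ halfLine) (f h : H) :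
    (f, h) ∈ (schrodinger hV).graph ↔ (f, h - mulOp hV f) ∈ dirichletLaplacian.graph := by
  have e : ∀ y : dirichletLaplacian.domain,
      schrodinger hV y = mulOp hV (y : H) + dirichletLaplacian y := fun _ => rfl
  rw [LinearPMap.mem_graph_iff, LinearPMap.mem_graph_iff]
  constructor
  · rintro ⟨y, h1, h2⟩
    have h1' : (y : H) = f := h1
    exact ⟨y, h1, eq_sub_of_add_eq' (h1' ▸ (e y).symm.trans h2)⟩
  · rintro ⟨y, h1, h2⟩
    refine ⟨y, h1, (e y).trans ?_⟩
    simp only at h1 h2 ⊢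
    rw [h2, h1, add_sub_cancel]

lemma IsSolution.isDirichletPair (hV : MemLp V ∞ halfLine) {k : ℂ} {y y' : ℝ → ℂ}
    (h : IsSolution V k y y') (h0 : y 0 = 0) (hy : MemLp y 2 halfLine) :
    (hy.toLp y, k ^ 2 • hy.toLp y) ∈ (schrodinger hV).graph := by
  rw [mem_graph_schrodinger, mem_graph_dirichletLaplacian]
  refine isDirichletPair_of_primitive hy.coeFn_toLp h0 h.1 h.2 ?_
  filter_upwards [Lp.coeFn_sub (k ^ 2 • hy.toLp y) (mulOp hV (hy.toLp y)),
    Lp.coeFn_smul (k ^ 2) (hy.toLp y), mulOp_coe hV (hy.toLp y), hy.coeFn_toLp] with t h1 h2 h3 h4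
  rw [h1, Pi.sub_apply, h2, Pi.smul_apply, h3, h4, smul_eq_mul]
  ring

lemma integrableOn_weight (hV : MemLp V ∞ halfLine)
    (hmom : IntegrableOn (fun x : ℝ => x * ‖V x‖) (Ioi 0)) :
    IntegrableOn (fun t => (1 + t) * ‖V t‖) (Ioi 0) := by
  have hmeas : AEStronglyMeasurable (fun t => (1 + t) * ‖V t‖) halfLine :=
    (by fun_prop : Continuous fun t : ℝ => 1 + t).aestronglyMeasurable.mul hV.1.norm
  rw [← Ioc_union_Ioi_eq_Ioi zero_le_one]
  refine IntegrableOn.union ?_ ?_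
  · have h1 : IntegrableOn (fun t => ‖V t‖) (Ioc 0 1) :=
      ((hV.mono_measure (Measure.restrict_mono Ioc_subset_Ioi_self le_rfl)).integrable le_top).norm
    refine Integrable.mono' (h1.const_mul 2) (hmeas.mono_measure
      (Measure.restrict_mono Ioc_subset_Ioi_self le_rfl)) ?_
    filter_upwards [ae_restrict_mem measurableSet_Ioc] with t ht
    rw [norm_mul, norm_norm, Real.norm_of_nonneg (by linarith [ht.1])]
    gcongr
    linarith [ht.2]
  · refine Integrable.mono' ((hmom.mono_set (Ioi_subset_Ioi zero_le_one)).const_mul 2)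
      (hmeas.mono_measure (Measure.restrict_mono (Ioi_subset_Ioi zero_le_one) le_rfl)) ?_
    filter_upwards [ae_restrict_mem measurableSet_Ioi] with t ht
    have := mem_Ioi.1 ht
    rw [norm_mul, norm_norm, Real.norm_of_nonneg (by linarith), ← mul_assoc]
    gcongr
    linarith

/-- A potential without eigenvalues and spectral singularities has uniform solutions. -/
lemma hasUniformSolutions (hV : MemLp V ∞ halfLine)
    (hmom : IntegrableOn (fun x : ℝ => x * ‖V x‖) (Ioi 0))
    (heig : ∀ lam : ℂ, ¬ IsEigenvalue (schrodinger hV) lam)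
    (hsing : ∀ lam : ℝ, ¬ IsSpectralSingularity V lam) : HasUniformSolutions V := by
  have hW := integrableOn_weight hV hmom
  obtain ⟨m, hm⟩ := exists_jost_amplitude hV.1 hW
  refine hasUniformSolutions_of_ne_zero hV.1 hW hm fun k hk h0 => ?_
  obtain ⟨e, e', he, hem, -⟩ := exists_jost_solution hV.1 hW hk fun x hx => hm x k hx hk
  have hlim := tendsto_jost_amplitude hV.1 hW hk fun x hx => hm x k hx hk
  have e0 : e 0 = 0 := by simp [hem, h0]
  -- On the real axis a zero is a spectral singularity. Above it the Jost solution decays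
  -- exponentially and satisfies the Dirichlet condition, so it is an eigenfunction; it is nonzero
  -- because its amplitude tends to 1.
  rcases hk.eq_or_lt with hk0 | hk0
  · obtain ⟨κ, rfl⟩ : ∃ κ : ℝ, k = κ := ⟨k.re, Complex.ext rfl (by simp [← hk0])⟩
    refine hsing (κ ^ 2) ⟨κ, rfl, e, ⟨e', fun x hx =>
      he.1.hasDerivWithinAt he.2.continuousOn hx, he.2.2, hlim.congr fun x => ?_⟩, e0⟩
    rw [hem, mul_right_comm, ← Complex.exp_add]
    simp
  · have hmem : MemLp e 2 halfLine := by
      rw [memLp_two_iff_integrable_sq_norm he.1.aestronglyMeasurable]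
      have h1 : IntegrableOn (fun t => Real.exp (-(2 * k.im) * t)) (Ioi 0) :=
        integrableOn_exp_mul_Ioi (by linarith) 0
      refine Integrable.mono' (h1.const_mul (‖m‖ ^ 2)) (he.1.aestronglyMeasurable.norm.pow 2)
        (ae_of_all _ fun t => ?_)
      rw [Real.norm_of_nonneg (by positivity), hem, norm_mul, norm_exp_I_mul_mul, mul_pow,
        ← Real.exp_nat_mul, mul_comm]
      have h2 : ((2 : ℕ) : ℝ) * -(k.im * t) = -(2 * k.im) * t := by push_cast; ring
      rw [h2]
      gcongr
      exact m.norm_coe_le_norm _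
    have hg := he.isDirichletPair hV e0 hmem
    rw [LinearPMap.mem_graph_iff] at hg
    obtain ⟨f, hf, hLf⟩ := hg
    refine heig (k ^ 2) ⟨f, fun hf0 => ?_, by rw [hLf, hf]⟩
    have hz : e =ᵐ[volume.restrict (Ioi 0)] 0 := by
      refine hmem.coeFn_toLp.symm.trans ?_
      rw [show hmem.toLp e = 0 from hf.symm.trans hf0]
      exact Lp.coeFn_zero _ _ _
    have hz' : EqOn e 0 (Ioi 0) := Measure.eqOn_open_of_ae_eq hz isOpen_Ioi
      (he.1.continuousOn.mono Ioi_subset_Ici_self) continuousOn_const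
    have hm0 : ∀ᶠ x in atTop, m (x, k) = 0 := by
      filter_upwards [eventually_gt_atTop 0] with x hx
      have := hz' hx
      rw [hem] at this
      simpa using this
    exact zero_ne_one (tendsto_nhds_unique (tendsto_const_nhds.congr' (hm0.mono fun x hx => hx.symm))
      hlim)

end Solutions

/-! ### The uniform weighted resolvent estimate -/

section ResolventEstimate

open scoped ComplexConjugate

lemma IsPrimitive.exists_bound {u v : ℝ → ℂ} (hu : IsPrimitive u v) (hu2 : MemLp u 2 halfLine)
    (hv2 : MemLp v 2 halfLine) : ∃ B, ∀ x, 0 ≤ x → ‖u x‖ ≤ B := by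
  have hi := (integrable_mul_of_memLp_two (memLp_conj hu2) hv2).norm.const_mul 2
  set K := ∫ t in Ioi 0, 2 * ‖conj (u t) * v t‖ with hK
  have hK0 : 0 ≤ K := integral_nonneg fun t => by positivity
  refine ⟨Real.sqrt (‖u 0‖ ^ 2 + K), fun x hx => Real.le_sqrt_of_sq_le ?_⟩
  rw [hu.normSq_eq hx]
  gcongr
  refine (le_abs_self _).trans ?_
  rw [← Real.norm_eq_abs]
  have hix : IntervalIntegrable (fun t => 2 * ‖conj (u t) * v t‖) volume 0 x :=
    (intervalIntegrable_iff_integrableOn_Ioc_of_le hx).2 (hi.mono_measure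
      (Measure.restrict_mono Ioc_subset_Ioi_self le_rfl))
  refine (intervalIntegral.norm_integral_le_of_norm_le hx (ae_of_all _ fun t _ => ?_) hix).trans ?_
  · rw [norm_mul, Real.norm_ofNat]
    gcongr
    exact Complex.abs_re_le_norm _
  · rw [intervalIntegral.integral_of_le hx]
    exact setIntegral_mono_set hi (ae_of_all _ fun t => by positivity)
      (LE.le.eventuallyLE Ioc_subset_Ioi_self)

lemma memLp_of_le_exp {e : ℝ → ℂ} (hm : AEStronglyMeasurable e halfLine) {C η : ℝ} (hη : 0 < η)
    (he : ∀ x, 0 ≤ x → ‖e x‖ ≤ C * Real.exp (-(η * x))) : MemLp e 2 halfLine := by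
  rw [memLp_two_iff_integrable_sq_norm hm]
  have h1 : IntegrableOn (fun t => Real.exp (-(2 * η) * t)) (Ioi 0) :=
    integrableOn_exp_mul_Ioi (by linarith) 0
  refine Integrable.mono' (h1.const_mul (C ^ 2)) (hm.norm.pow 2) ?_
  filter_upwards [ae_restrict_mem measurableSet_Ioi] with t ht
  rw [Real.norm_of_nonneg (by positivity)]
  refine (pow_le_pow_left₀ (norm_nonneg _) (he t (le_of_lt ht)) 2).trans (le_of_eq ?_)
  rw [mul_pow, ← Real.exp_nat_mul]
  congr 2
  push_cast
  ring

lemma tendsto_zero_of_le_exp {e : ℝ → ℂ} {C η : ℝ} (hη : 0 < η)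
    (he : ∀ x, 0 ≤ x → ‖e x‖ ≤ C * Real.exp (-(η * x))) : Tendsto e atTop (𝓝 0) := by
  have h : Tendsto (fun x => C * Real.exp (-(η * x))) atTop (𝓝 (C * 0)) :=
    (Real.tendsto_exp_neg_atTop_nhds_zero.comp (tendsto_id.const_mul_atTop hη)).const_mul C
  rw [mul_zero] at h
  refine squeeze_zero_norm' ?_ h
  filter_upwards [eventually_ge_atTop 0] with x hx using he x hx

/-- The resolvent formula in terms of the regular solution and the Jost solution. -/
lemma jost_mul_eq {V g u v φ φ' e e' : ℝ → ℂ} {k : ℂ} {C C' η : ℝ} (hη : 0 < η)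
    (hu : IsPrimitive u v) (hv : IsPrimitive v fun t => (V t - k ^ 2) * u t - g t) (u0 : u 0 = 0)
    (hub : ∃ B, ∀ x, 0 ≤ x → ‖u x‖ ≤ B) (hvb : ∃ B, ∀ x, 0 ≤ x → ‖v x‖ ≤ B)
    (hg : MemLp g 2 halfLine) (hφ : IsSolution V k φ φ') (φ0 : φ 0 = 0) (φ0' : φ' 0 = 1)
    (he : IsSolution V k e e') (heb : ∀ x, 0 ≤ x → ‖e x‖ ≤ C * Real.exp (-(η * x)))
    (heb' : ∀ x, 0 ≤ x → ‖e' x‖ ≤ C' * Real.exp (-(η * x))) {x : ℝ} (hx : 0 ≤ x) :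
    e 0 * u x = e x * (∫ t in (0 : ℝ)..x, g t * φ t) + φ x * ∫ t in Ioi x, g t * e t := by
  have hA : IsPrimitive (fun x => u x * φ' x - v x * φ x) fun x => g x * φ x :=
    ((hu.mul hφ.2).sub (hv.mul hφ.1)).congr_deriv fun x _ => by ring
  have hB : IsPrimitive (fun x => u x * e' x - v x * e x) fun x => g x * e x :=
    ((hu.mul he.2).sub (hv.mul he.1)).congr_deriv fun x _ => by ring
  have hw : IsPrimitive (fun x => φ' x * e x - φ x * e' x) fun _ => 0 :=
    ((hφ.2.mul he.1).sub (hφ.1.mul he.2)).congr_deriv fun x _ => by ring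
  have hge := integrable_mul_of_memLp_two hg (memLp_of_le_exp he.1.aestronglyMeasurable hη heb)
  have hlim : Tendsto (fun x => u x * e' x - v x * e x) atTop (𝓝 0) := by
    obtain ⟨B, hB⟩ := hub
    obtain ⟨B', hB'⟩ := hvb
    have h1 : Tendsto (fun x => u x * e' x) atTop (𝓝 0) := by
      have h2 := (tendsto_zero_of_le_exp hη heb').norm.const_mul B
      rw [norm_zero, mul_zero] at h2
      refine squeeze_zero_norm' ?_ h2
      filter_upwards [eventually_ge_atTop 0] with x hx
      rw [norm_mul]
      gcongr
      exact hB x hx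
    have h3 : Tendsto (fun x => v x * e x) atTop (𝓝 0) := by
      have h2 := (tendsto_zero_of_le_exp hη heb).norm.const_mul B'
      rw [norm_zero, mul_zero] at h2
      refine squeeze_zero_norm' ?_ h2
      filter_upwards [eventually_ge_atTop 0] with x hx
      rw [norm_mul]
      gcongr
      exact hB' x hx
    simpa using h1.sub h3
  -- The decay of `e` and `e'` kills the Wronskian of `u` with `e` at infinity. With the Wronskian
  -- of `φ` and `e`, constantly `e 0`, this determines `u` by linear algebra.
  have hB0 : 0 = (u 0 * e' 0 - v 0 * e 0) + ∫ t in Ioi 0, g t * e t := by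
    refine tendsto_nhds_unique hlim (((tendsto_intervalIntegral_Ioi hge).const_add _).congr' ?_)
    filter_upwards [eventually_ge_atTop 0] with R hR
    exact (hB.2 R hR).symm
  have hsplit := intervalIntegral.integral_interval_add_Ioi hge
    (IntegrableOn.mono_set hge (Ioi_subset_Ioi hx))
  have eA := hA.2 x hx
  have eB := hB.2 x hx
  have ew := hw.2 x hx
  simp only [u0, φ0, φ0', zero_mul, mul_zero, sub_zero, zero_add, one_mul,
    intervalIntegral.integral_zero, add_zero] at eA ew hB0 eB
  linear_combination -(u x) * ew + e x * eA - φ x * eB - φ x * hsplit + φ x * hB0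

lemma integral_mul_norm_le {α : ℝ → ℝ} (hα : MemLp (fun t => (α t : ℂ)) 2 halfLine)
    (hα0 : ∀ t, 0 ≤ α t) (h : H) :
    IntegrableOn (fun t => α t * ‖h t‖) (Ioi 0) ∧
      ∫ t in Ioi 0, α t * ‖h t‖ ≤ ‖hα.toLp‖ * ‖h‖ := by
  have hn : MemLp (fun t => ((‖h t‖ : ℝ) : ℂ)) 2 halfLine :=
    (Lp.memLp h).norm.ofReal
  have hi := integrable_mul_of_memLp_two hα hn
  have e1 : (fun t => α t * ‖h t‖) = fun t => ‖(α t : ℂ) * ((‖h t‖ : ℝ) : ℂ)‖ := by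
    funext t
    rw [norm_mul, Complex.norm_real, Complex.norm_real, norm_norm, Real.norm_of_nonneg (hα0 t)]
  refine ⟨by rw [e1]; exact hi.norm, ?_⟩
  have h2 : ‖hn.toLp‖ = ‖h‖ := by
    rw [Lp.norm_toLp, Lp.norm_def]
    congr 1
    refine eLpNorm_congr_norm_ae (ae_of_all _ fun t => ?_)
    simp
  have h3 : inner ℂ hα.toLp hn.toLp = ((∫ t in Ioi 0, α t * ‖h t‖ : ℝ) : ℂ) := by
    rw [L2.inner_def, ← integral_complex_ofReal]
    refine integral_congr_ae ?_
    filter_upwards [hα.coeFn_toLp, hn.coeFn_toLp] with t h4 h5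
    rw [h4, h5, RCLike.inner_apply, Complex.conj_ofReal]
    push_cast
    ring
  have h6 := norm_inner_le_norm (𝕜 := ℂ) hα.toLp hn.toLp
  rw [h3, h2, Complex.norm_real] at h6
  exact (le_abs_self _).trans h6

/-- The weighted resolvent estimate for a potential with uniform solutions. -/
lemma HasUniformSolutions.exists_norm_le {V : ℝ → ℂ} (hV : MemLp V ∞ halfLine)
    (hS : HasUniformSolutions V) {a : ℝ → ℝ} (ha0 : ∀ t, 0 ≤ a t)
    (ha : MemLp (fun t => (a t : ℂ)) ∞ halfLine)
    (ha2 : IntegrableOn (fun t => (1 + t) * a t ^ 2) (Ioi 0)) :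
    ∃ C, 0 ≤ C ∧ ∀ k : ℂ, 0 < k.im → ∀ w g h : H,
      (w, k ^ 2 • w + g) ∈ (schrodinger hV).graph → (∀ᵐ t ∂halfLine, ‖g t‖ ≤ a t * ‖h t‖) →
      ‖mulOp ha w‖ ≤ C * ‖h‖ := by
  obtain ⟨C, c, hC, hc, H⟩ := hS
  -- The compressed kernel is dominated by the rank-one kernel `C²/c · α x · α t`, with `α` in L².
  -- Its norm `C²/c · N²` is the constant, free of `k`.
  set α : ℝ → ℝ := fun t => a t * Real.sqrt (1 + t) with hα
  have hα0 : ∀ t, 0 ≤ α t := fun t => mul_nonneg (ha0 t) (Real.sqrt_nonneg _)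
  have hαm : MemLp (fun t => (α t : ℂ)) 2 halfLine := by
    have hm : AEStronglyMeasurable (fun t => (α t : ℂ)) halfLine := by
      simp only [hα, Complex.ofReal_mul]
      exact ha.1.mul (by fun_prop)
    rw [memLp_two_iff_integrable_sq_norm hm]
    refine Integrable.congr ha2 ?_
    filter_upwards [ae_restrict_mem measurableSet_Ioi] with t ht
    rw [Complex.norm_real, Real.norm_of_nonneg (hα0 t), hα]
    simp only
    rw [mul_pow, Real.sq_sqrt (by linarith [mem_Ioi.1 ht])]
    ring
  set N := ‖hαm.toLp‖
  refine ⟨C ^ 2 / c * N * N, by positivity, fun k hk w g h hw hg => ?_⟩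
  obtain ⟨φ, φ', e, e', h1, h2, h3, h4, h5, h6, ⟨C', h7⟩, h8⟩ := H k hk
  rw [mem_graph_schrodinger, mem_graph_dirichletLaplacian] at hw
  obtain ⟨u, v, hwu, u0, hu, hv⟩ := hw.exists_primitive
  set q : HalfLine.H := k ^ 2 • w + g - mulOp hV w with hq
  have mu : MemLp u 2 halfLine := (memLp_congr_ae hwu).1 (Lp.memLp w)
  have mq : MemLp (fun t => -q t) 2 halfLine := (Lp.memLp q).neg
  have mv := memLp_deriv hu hv mu mq
  have hv' : IsPrimitive v fun t => (V t - k ^ 2) * u t - g t := by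
    refine hv.congr_deriv_ae ?_
    filter_upwards [Lp.coeFn_sub (k ^ 2 • w + g) (mulOp hV w), Lp.coeFn_add (k ^ 2 • w) g,
      Lp.coeFn_smul (k ^ 2) w, mulOp_coe hV w, hwu] with t e1 e2 e3 e4 e5
    rw [hq, e1, Pi.sub_apply, e2, Pi.add_apply, e3, Pi.smul_apply, e4, e5, smul_eq_mul]
    ring
  obtain ⟨hi, hM⟩ := integral_mul_norm_le hαm hα0 h
  set M := ∫ t in Ioi 0, α t * ‖h t‖ with hMdef
  -- In `φ` at the smaller point times `e` at the larger one the exponentials combine to at most 1,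
  -- and `1 + min x t ≤ √(1+x) √(1+t)`.
  have hbound : ∀ x, 0 ≤ x → ‖u x‖ ≤ C ^ 2 / c * M * Real.sqrt (1 + x) := by
    intro x hx
    have key := jost_mul_eq hk hu hv' u0 (hu.exists_bound mu mv) (hv.exists_bound mv mq)
      (Lp.memLp g) h1 h2 h3 h5 h6 h7 hx
    have hsx := Real.sqrt_nonneg (1 + x)
    have hix : IntegrableOn (fun t => α t * ‖h t‖) (Ioi x) := hi.mono_set (Ioi_subset_Ioi hx)
    have hi0 : IntervalIntegrable (fun t => α t * ‖h t‖) volume 0 x :=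
      (intervalIntegrable_iff_integrableOn_Ioc_of_le hx).2 (hi.mono_set Ioc_subset_Ioi_self)
    have b1 : ‖e x * ∫ t in (0 : ℝ)..x, g t * φ t‖ ≤
        C ^ 2 * Real.sqrt (1 + x) * ∫ t in (0 : ℝ)..x, α t * ‖h t‖ := by
      rw [← intervalIntegral.integral_const_mul, ← intervalIntegral.integral_const_mul]
      refine intervalIntegral.norm_integral_le_of_norm_le hx ?_ (hi0.const_mul _)
      rw [ae_restrict_iff' measurableSet_Ioi] at hg
      filter_upwards [hg] with t hgt ht
      have ht0 := ht.1
      have e1 : Real.exp (-(k.im * x)) * Real.exp (k.im * t) ≤ 1 := by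
        rw [← Real.exp_add, Real.exp_le_one_iff]
        nlinarith [ht.2]
      have e2 : 1 + t ≤ Real.sqrt (1 + x) * Real.sqrt (1 + t) := by
        calc 1 + t = Real.sqrt (1 + t) * Real.sqrt (1 + t) :=
              (Real.mul_self_sqrt (by linarith)).symm
          _ ≤ _ := by
              gcongr
              exact ht.2
      rw [norm_mul, norm_mul]
      calc ‖e x‖ * (‖g t‖ * ‖φ t‖) ≤ C * Real.exp (-(k.im * x)) * (a t * ‖h t‖ *
            (C * (1 + t) * Real.exp (k.im * t))) := by
            have := ha0 t
            gcongr
            · exact h6 x hx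
            · exact hgt ht0
            · exact h4 t ht0.le
        _ = C ^ 2 * (a t * ‖h t‖) * (1 + t) * (Real.exp (-(k.im * x)) * Real.exp (k.im * t)) := by
            ring
        _ ≤ C ^ 2 * (a t * ‖h t‖) * (Real.sqrt (1 + x) * Real.sqrt (1 + t)) * 1 := by
            have := ha0 t
            gcongr
        _ = C ^ 2 * Real.sqrt (1 + x) * (α t * ‖h t‖) := by
            rw [hα]
            ring
    have b2 : ‖φ x * ∫ t in Ioi x, g t * e t‖ ≤
        C ^ 2 * Real.sqrt (1 + x) * ∫ t in Ioi x, α t * ‖h t‖ := by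
      rw [← integral_const_mul, ← integral_const_mul]
      refine norm_integral_le_of_norm_le (hix.const_mul _) ?_
      have hg' := ae_mono (Measure.restrict_mono (Ioi_subset_Ioi hx) le_rfl) hg
      filter_upwards [hg', ae_restrict_mem measurableSet_Ioi] with t hgt ht
      have ht1 : x < t := ht
      have ht0 : 0 ≤ t := hx.trans ht1.le
      have e1 : Real.exp (k.im * x) * Real.exp (-(k.im * t)) ≤ 1 := by
        rw [← Real.exp_add, Real.exp_le_one_iff]
        nlinarith
      have e2 : 1 + x ≤ Real.sqrt (1 + x) * Real.sqrt (1 + t) := by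
        calc 1 + x = Real.sqrt (1 + x) * Real.sqrt (1 + x) :=
              (Real.mul_self_sqrt (by linarith)).symm
          _ ≤ _ := by
              gcongr
      rw [norm_mul, norm_mul]
      calc ‖φ x‖ * (‖g t‖ * ‖e t‖) ≤ C * (1 + x) * Real.exp (k.im * x) * (a t * ‖h t‖ *
            (C * Real.exp (-(k.im * t)))) := by
            have := ha0 t
            gcongr
            · exact h4 x hx
            · exact h6 t ht0
        _ = C ^ 2 * (a t * ‖h t‖) * (1 + x) * (Real.exp (k.im * x) * Real.exp (-(k.im * t))) := by
            ring
        _ ≤ C ^ 2 * (a t * ‖h t‖) * (Real.sqrt (1 + x) * Real.sqrt (1 + t)) * 1 := by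
            have := ha0 t
            gcongr
        _ = C ^ 2 * Real.sqrt (1 + x) * (α t * ‖h t‖) := by
            rw [hα]
            ring
    have hsum := intervalIntegral.integral_interval_add_Ioi hi hix
    have b3 : c * ‖u x‖ ≤ C ^ 2 * Real.sqrt (1 + x) * M := by
      calc c * ‖u x‖ ≤ ‖e 0‖ * ‖u x‖ := by gcongr
        _ = ‖e 0 * u x‖ := (norm_mul _ _).symm
        _ ≤ _ := by
          rw [key]
          refine (norm_add_le _ _).trans ((add_le_add b1 b2).trans (le_of_eq ?_))
          rw [← mul_add, hsum]
    rw [div_mul_eq_mul_div, div_mul_eq_mul_div, le_div_iff₀ hc]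
    linarith
  have hM0 : 0 ≤ M := setIntegral_nonneg measurableSet_Ioi fun t _ =>
    mul_nonneg (hα0 t) (norm_nonneg _)
  have hfin : ‖mulOp ha w‖ ≤ C ^ 2 / c * M * N := by
    refine Lp.norm_le_mul_norm_of_ae_le_mul ?_
    filter_upwards [mulOp_coe ha w, hwu, hαm.coeFn_toLp, ae_restrict_mem measurableSet_Ioi]
      with t e1 e2 e3 ht
    rw [e1, e2, e3, norm_mul, Complex.norm_real, Complex.norm_real, Real.norm_of_nonneg (ha0 t),
      Real.norm_of_nonneg (hα0 t)]
    calc a t * ‖u t‖ ≤ a t * (C ^ 2 / c * M * Real.sqrt (1 + t)) := by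
          have := ha0 t
          gcongr
          exact hbound t (le_of_lt ht)
      _ = _ := by
          rw [hα]
          ring
  calc ‖mulOp ha w‖ ≤ C ^ 2 / c * M * N := hfin
    _ ≤ C ^ 2 / c * (N * ‖h‖) * N := by gcongr
    _ = _ := by ring

lemma exists_sq_eq {z : ℂ} (hz : z.im ≠ 0) : ∃ k : ℂ, 0 < k.im ∧ k ^ 2 = z := by
  obtain ⟨k, hk⟩ := IsAlgClosed.exists_pow_nat_eq z (n := 2) (by norm_num)
  have h0 : k.im ≠ 0 := fun h => hz (by
    rw [← hk, pow_two, Complex.mul_im, h]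
    simp)
  rcases lt_or_gt_of_ne h0 with h | h
  · exact ⟨-k, by simpa using h, by rw [neg_sq, hk]⟩
  · exact ⟨k, h, hk⟩

end ResolventEstimate

/-! ### Application to the Schrödinger operator -/

section WaveOperators

open scoped ComplexConjugate

variable {V : ℝ → ℂ}

lemma memLp_conj_top (hV : MemLp V ∞ halfLine) : MemLp (fun t => conj (V t)) ∞ halfLine := hV.star

lemma inner_mulOp_left {W W' : ℝ → ℂ} (hW : MemLp W ∞ halfLine) (hW' : MemLp W' ∞ halfLine)
    (h : ∀ t, W' t = conj (W t)) (x y : H) :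
    inner ℂ (mulOp hW x) y = inner ℂ x (mulOp hW' y) := by
  rw [L2.inner_def, L2.inner_def]
  refine integral_congr_ae ?_
  filter_upwards [mulOp_coe hW x, mulOp_coe hW' y] with t h1 h2
  rw [h1, h2, h, RCLike.inner_apply, RCLike.inner_apply, map_mul]
  ring

/-- The square root of the modulus of a potential. -/
def sqrtNorm (V : ℝ → ℂ) (t : ℝ) : ℝ := Real.sqrt ‖V t‖

lemma sqrtNorm_nonneg (V : ℝ → ℂ) (t : ℝ) : 0 ≤ sqrtNorm V t := Real.sqrt_nonneg _

lemma sqrtNorm_mul_self (V : ℝ → ℂ) (t : ℝ) : sqrtNorm V t * sqrtNorm V t = ‖V t‖ :=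
  Real.mul_self_sqrt (norm_nonneg _)

lemma memLp_sqrtNorm (hV : MemLp V ∞ halfLine) :
    MemLp (fun t => (sqrtNorm V t : ℂ)) ∞ halfLine := by
  refine (hV.norm.add (memLp_top_const (1 : ℝ))).of_le ?_ (ae_of_all _ fun t => ?_)
  · exact (Complex.continuous_ofReal.comp Real.continuous_sqrt).comp_aestronglyMeasurable hV.1.norm
  · have h0 := norm_nonneg (V t)
    rw [Complex.norm_real, Real.norm_of_nonneg (sqrtNorm_nonneg V t), Pi.add_apply,
      Real.norm_of_nonneg (by positivity)]
    exact Real.sqrt_le_iff.2 ⟨by positivity, by nlinarith⟩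

lemma norm_inner_mulOp_le (hV : MemLp V ∞ halfLine) {V' : ℝ → ℂ} (hV' : MemLp V' ∞ halfLine)
    (h : ∀ t, ‖V' t‖ = ‖V t‖) (x y : H) :
    ‖inner ℂ y (mulOp hV' x)‖ ≤ ‖mulOp (memLp_sqrtNorm hV) x‖ * ‖mulOp (memLp_sqrtNorm hV) y‖ := by
  -- The phase of the potential, of modulus at most 1. Division by zero makes it 0 where the
  -- potential vanishes, which is harmless there.
  have hs : MemLp (fun t => V' t / ‖V' t‖) ∞ halfLine := by
    refine memLp_top_of_bound (hV'.1.mul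
      (hV'.1.norm.aemeasurable.inv.complex_ofReal.aestronglyMeasurable) |>.congr
        (ae_of_all _ fun t => ?_)) 1 (ae_of_all _ fun t => ?_)
    · simp [div_eq_mul_inv]
    · rw [norm_div, Complex.norm_real, norm_norm]
      exact div_self_le_one _
  set A := mulOp (memLp_sqrtNorm hV) with hA
  have h1 : mulOp hV' x = A (mulOp hs (A x)) := by
    refine Lp.ext ?_
    filter_upwards [mulOp_coe hV' x, mulOp_coe (memLp_sqrtNorm hV) (mulOp hs (A x)),
      mulOp_coe hs (A x), mulOp_coe (memLp_sqrtNorm hV) x] with t e1 e2 e3 e4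
    replace e4 : A x t = sqrtNorm V t * x t := e4
    replace e2 : A (mulOp hs (A x)) t = sqrtNorm V t * mulOp hs (A x) t := e2
    rw [e1, e2, e3, e4]
    have e5 : (sqrtNorm V t : ℂ) * sqrtNorm V t = ‖V' t‖ := by
      rw [← Complex.ofReal_mul, sqrtNorm_mul_self, h]
    have e6 : (‖V' t‖ : ℂ) * (V' t / ‖V' t‖) = V' t := by
      by_cases hz : V' t = 0
      · simp [hz]
      · have : (‖V' t‖ : ℂ) ≠ 0 := by simpa using hz
        field_simp
    linear_combination -(x t) * e6 - V' t / ‖V' t‖ * x t * e5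
  have h2 : ‖mulOp hs (A x)‖ ≤ ‖A x‖ := by
    refine Lp.norm_le_norm_of_ae_le ?_
    filter_upwards [mulOp_coe hs (A x)] with t e1
    rw [e1, norm_mul, norm_div, Complex.norm_real, norm_norm]
    exact mul_le_of_le_one_left (norm_nonneg _) (div_self_le_one _)
  rw [h1, ← inner_mulOp_left (memLp_sqrtNorm hV) (memLp_sqrtNorm hV) (fun t => by simp)]
  refine (norm_inner_le_norm _ _).trans ?_
  rw [mul_comm]
  gcongr

/-- Dictionary between generator and operator: for the generator `c L` the spectral point `p`
corresponds to `k² = -c p`. It is nonreal when `Re p > 0`, so its root can be taken in the upper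
half-plane. -/
lemma exists_sq_eq_neg_mul {c p : ℂ} (hc : c = Complex.I ∨ c = -Complex.I) (hp : 0 < p.re) :
    ∃ k : ℂ, 0 < k.im ∧ k ^ 2 = -c * p := by
  refine exists_sq_eq ?_
  rcases hc with rfl | rfl
  · simpa using hp.ne'
  · simpa using hp.ne'

variable {G U : ℝ → H →L[ℂ] H} {c : ℂ}

lemma norm_eq_one_of_I (hc : c = Complex.I ∨ c = -Complex.I) : ‖c‖ = 1 := by
  rcases hc with rfl | rfl <;> simp

lemma mul_self_of_I (hc : c = Complex.I ∨ c = -Complex.I) : c * c = -1 := by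
  rcases hc with rfl | rfl <;> simp

lemma free_resolvent_estimate (hV : MemLp V ∞ halfLine)
    (hW : IntegrableOn (fun t => (1 + t) * ‖V t‖) (Ioi 0)) (hc : c = Complex.I ∨ c = -Complex.I)
    (hgen : ∀ f h, (f, h) ∈ dirichletLaplacian.graph ↔ HasDerivAt (fun t => G t f) (c • h) 0) :
    ∃ C, 0 ≤ C ∧ ∀ p : ℂ, 0 < p.re → ∀ w h,
      HasDerivAt (fun t => G t w) (p • w - mulOp (memLp_sqrtNorm hV) h) 0 →
        ‖mulOp (memLp_sqrtNorm hV) w‖ ≤ C * ‖h‖ := by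
  have hz : MemLp (fun _ : ℝ => (0 : ℂ)) ∞ halfLine := memLp_top_const 0
  obtain ⟨C, hC, H⟩ := hasUniformSolutions_zero.exists_norm_le hz (sqrtNorm_nonneg V)
    (memLp_sqrtNorm hV) (by simpa only [pow_two, sqrtNorm_mul_self] using hW)
  refine ⟨C, hC, fun p hp w h hd => ?_⟩
  obtain ⟨k, hk, hk2⟩ := exists_sq_eq_neg_mul hc hp
  have hcc := mul_self_of_I hc
  refine H k hk w (c • mulOp (memLp_sqrtNorm hV) h) h ?_ ?_
  · have h0 : mulOp hz w = 0 := by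
      refine Lp.ext ?_
      filter_upwards [mulOp_coe hz w, Lp.coeFn_zero ℂ 2 halfLine] with t e1 e2
      rw [e1, e2]
      simp
    rw [mem_graph_schrodinger, h0, sub_zero, hgen]
    refine hd.congr_deriv ?_
    rw [hk2, smul_add, smul_smul, smul_smul, hcc, ← mul_assoc, mul_neg, hcc, neg_neg, one_mul,
      neg_one_smul, sub_eq_add_neg]
  · filter_upwards [Lp.coeFn_smul c (mulOp (memLp_sqrtNorm hV) h),
      mulOp_coe (memLp_sqrtNorm hV) h] with t e1 e2
    rw [e1, Pi.smul_apply, e2, norm_smul, norm_eq_one_of_I hc, one_mul, norm_mul,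
      Complex.norm_real, Real.norm_of_nonneg (sqrtNorm_nonneg V t)]

lemma IsPerturbation.mem_graph_schrodinger_iff {V' : ℝ → ℂ} (hV' : MemLp V' ∞ halfLine)
    (hG : IsUnitaryGroup G)
    (hgen : ∀ f h, (f, h) ∈ dirichletLaplacian.graph ↔ HasDerivAt (fun t => G t f) (c • h) 0)
    (hU : IsPerturbation G (c • mulOp hV') U) (f h : H) :
    (f, h) ∈ (schrodinger hV').graph ↔ HasDerivAt (fun t => U t f) (c • h) 0 := by
  rw [mem_graph_schrodinger, hgen, smul_sub]
  exact (hU.hasDerivAt_iff hG).symm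

lemma IsPerturbation.exists_isSmooth (hV : MemLp V ∞ halfLine)
    (hW : IntegrableOn (fun t => (1 + t) * ‖V t‖) (Ioi 0)) (hc : c = Complex.I ∨ c = -Complex.I)
    (hG : IsUnitaryGroup G)
    (hgen : ∀ f h, (f, h) ∈ dirichletLaplacian.graph ↔ HasDerivAt (fun t => G t f) (c • h) 0)
    {V' : ℝ → ℂ} (hV' : MemLp V' ∞ halfLine) (h : ∀ t, ‖V' t‖ = ‖V t‖)
    (hS : HasUniformSolutions V') (hU : IsPerturbation G (c • mulOp hV') U) :
    ∃ D, IsSmooth (mulOp (memLp_sqrtNorm hV)) U D := by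
  obtain ⟨C, hC, hres⟩ := free_resolvent_estimate hV hW hc hgen
  obtain ⟨C', hC', H⟩ := hS.exists_norm_le hV' (sqrtNorm_nonneg V)
    (memLp_sqrtNorm hV) (by simpa only [pow_two, sqrtNorm_mul_self] using hW)
  refine hU.exists_integral_sq_le hG hC
    (inner_mulOp_left (memLp_sqrtNorm hV) (memLp_sqrtNorm hV) fun t => by simp)
    (fun x y => ?_) hres hC' fun p hp w g hd => ?_
  · rw [smul_apply, inner_smul_right, norm_mul, norm_eq_one_of_I hc, one_mul]
    exact norm_inner_mulOp_le hV hV' h x y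
  · obtain ⟨k, hk, hk2⟩ := exists_sq_eq_neg_mul hc hp
    have hcc := mul_self_of_I hc
    refine H k hk w (-mulOp hV' g) (mulOp (memLp_sqrtNorm hV) g) ?_ ?_
    · rw [hU.mem_graph_schrodinger_iff hV' hG hgen]
      refine hd.congr_deriv ?_
      rw [hk2, smul_add, smul_smul, ← mul_assoc, mul_neg, hcc, neg_neg, one_mul, smul_neg,
        smul_apply, sub_eq_add_neg]
    · filter_upwards [Lp.coeFn_neg (mulOp hV' g), mulOp_coe hV' g,
        mulOp_coe (memLp_sqrtNorm hV) g] with t e1 e2 e3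
      rw [e1, Pi.neg_apply, norm_neg, e2, e3, norm_mul, norm_mul, Complex.norm_real,
        Real.norm_of_nonneg (sqrtNorm_nonneg V t), ← mul_assoc, sqrtNorm_mul_self, h]

lemma IsPerturbation.exists_schrodinger_wave_operators (hV : MemLp V ∞ halfLine)
    (hW : IntegrableOn (fun t => (1 + t) * ‖V t‖) (Ioi 0)) (hc : c = Complex.I ∨ c = -Complex.I)
    (hG : IsUnitaryGroup G)
    (hgen : ∀ f h, (f, h) ∈ dirichletLaplacian.graph ↔ HasDerivAt (fun t => G t f) (c • h) 0)
    (hS : HasUniformSolutions V) (hU : IsPerturbation G (c • mulOp hV) U) :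
    ∃ Ω Ω' : H →L[ℂ] H, (∀ f, Tendsto (fun t => U (-t) (G t f)) atTop (𝓝 (Ω f))) ∧
      (∀ f, Tendsto (fun t => G (-t) (U t f)) atTop (𝓝 (Ω' f))) ∧
      (∀ f, Ω (Ω' f) = f) ∧ (∀ f, Ω' (Ω f) = f) ∧ ∀ s f, U s (Ω f) = Ω (G s f) := by
  have hVc := memLp_conj_top hV
  obtain ⟨U', hU'⟩ := exists_perturbation (c • mulOp hVc) hG
  have hn : ∀ t, ‖conj (V t)‖ = ‖V t‖ := fun t => RCLike.norm_conj _
  obtain ⟨D, hD⟩ := hU.exists_isSmooth hV hW hc hG hgen hV (fun _ => rfl) hS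
  obtain ⟨D', hD'⟩ := hU'.exists_isSmooth hV hW hc hG hgen hVc hn hS.star
  obtain ⟨C, hC, hres⟩ := free_resolvent_estimate hV hW hc hgen
  have hA := inner_mulOp_left (memLp_sqrtNorm hV) (memLp_sqrtNorm hV) fun t => by simp
  have hD₀ : IsSmooth (mulOp (memLp_sqrtNorm hV)) G (2 * C) :=
    ⟨by positivity, fun b hb f => hG.integral_sq_le hC hA hres hb f⟩
  refine hU.exists_wave_operators hG hU' (fun x y => ?_) (fun x y => ?_) (fun x y => ?_) hD₀ hD hD'
  · rw [smul_apply, smul_apply, inner_smul_left, inner_smul_right,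
      inner_mulOp_left hVc hV (fun t => by simp)]
    rcases hc with rfl | rfl <;> simp
  · rw [smul_apply, inner_smul_right, norm_mul, norm_eq_one_of_I hc, one_mul]
    exact norm_inner_mulOp_le hV hV (fun _ => rfl) x y
  · rw [smul_apply, inner_smul_right, norm_mul, norm_eq_one_of_I hc, one_mul]
    exact norm_inner_mulOp_le hV hVc hn x y

lemma mem_graph_sandwich (W : H →L[ℂ] H) (L : H →ₗ.[ℂ] H) (W' : H →L[ℂ] H) (f h : H) :
    (f, h) ∈ (sandwich W L W').graph ↔ ∃ g, (W' f, g) ∈ L.graph ∧ W g = h := by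
  rw [LinearPMap.mem_graph_iff]
  constructor
  · rintro ⟨⟨y, hy⟩, rfl, h2⟩
    exact ⟨L ⟨W' y, hy⟩, L.mem_graph ⟨W' y, hy⟩, h2⟩
  · rintro ⟨g, hg, rfl⟩
    obtain ⟨⟨y, hy⟩, h1, h2⟩ := (LinearPMap.mem_graph_iff L).1 hg
    have h1' : y = W' f := h1
    subst h1'
    exact ⟨⟨f, hy⟩, rfl, congrArg W h2⟩

/-- Membership in a generator's graph is differentiability of the orbit at 0, and the intertwining
relations carry this across `W` and `W'` in both directions. Hence the graphs, and with them the
domains, coincide. -/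
lemma implementsSimilarity_of_intertwine {L L₀ : H →ₗ.[ℂ] H} {W W' : H →L[ℂ] H}
    (hL₀ : IsPropagator L₀ G) (hL : IsPropagator L U) (h1 : ∀ f, W (W' f) = f)
    (h2 : ∀ f, W' (W f) = f) (h : ∀ s f, U s (W f) = W (G s f)) :
    ImplementsSimilarity L W L₀ W' := by
  have hG' : ∀ s f, G s (W' f) = W' (U s f) := fun s f => by
    conv_rhs => rw [← h1 f, h, h2]
  refine ⟨by ext1 f; exact h1 f, by ext1 f; exact h2 f, LinearPMap.eq_of_eq_graph ?_⟩
  ext ⟨f, g⟩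
  rw [mem_graph_sandwich, hL.generator]
  constructor
  · intro hd
    refine ⟨W' g, (hL₀.generator _ _).2 ?_, h1 g⟩
    have := (W'.restrictScalars ℝ).hasFDerivAt.comp_hasDerivAt (0 : ℝ) hd
    simp only [ContinuousLinearMap.coe_restrictScalars', map_smul] at this
    exact this.congr_of_eventuallyEq (Eventually.of_forall fun s => hG' s f)
  · rintro ⟨q, hq, rfl⟩
    have := (W.restrictScalars ℝ).hasFDerivAt.comp_hasDerivAt (0 : ℝ) ((hL₀.generator _ _).1 hq)
    simp only [ContinuousLinearMap.coe_restrictScalars', map_smul] at this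
    refine this.congr_of_eventuallyEq (Eventually.of_forall fun s => ?_)
    simp only [Function.comp_apply]
    rw [← h, h1]

lemma hasDerivAt_zero_comp_neg {x : ℝ → H} {g : H} (h : HasDerivAt x g 0) :
    HasDerivAt (fun t => x (-t)) (-g) 0 := by
  have := HasDerivAt.scomp (h := fun s : ℝ => -s) (0 : ℝ) (by simpa using h) (hasDerivAt_neg 0)
  simpa [Function.comp_def] using this

end WaveOperators

end HalfLine

end

/-! ### The main theorem -/

theorem theorem2 (V : ℝ → ℂ) (hV : MemLp V ∞ HalfLine.halfLine)
    (hmom : IntegrableOn (fun x : ℝ => x * ‖V x‖) (Ioi 0))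
    (heig : ∀ lam : ℂ, ¬ HalfLine.IsEigenvalue (HalfLine.schrodinger hV) lam)
    (hsing : ∀ lam : ℝ, ¬ HalfLine.IsSpectralSingularity V lam) :
    ∃ U₀ U : ℝ → HalfLine.H →L[ℂ] HalfLine.H,
      HalfLine.IsPropagator HalfLine.dirichletLaplacian U₀ ∧
      HalfLine.IsPropagator (HalfLine.schrodinger hV) U ∧
      ∃ Ωp Ωm Ωp' Ωm' : HalfLine.H →L[ℂ] HalfLine.H,
        HalfLine.IsStrongLimit (fun t => (U t).comp (U₀ (-t))) atTop Ωp ∧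
        HalfLine.IsStrongLimit (fun t => (U t).comp (U₀ (-t))) atBot Ωm ∧
        HalfLine.IsStrongLimit (fun t => (U₀ t).comp (U (-t))) atTop Ωp' ∧
        HalfLine.IsStrongLimit (fun t => (U₀ t).comp (U (-t))) atBot Ωm' ∧
        HalfLine.ImplementsSimilarity (HalfLine.schrodinger hV) Ωp
          HalfLine.dirichletLaplacian Ωp' ∧
        HalfLine.ImplementsSimilarity (HalfLine.schrodinger hV) Ωm
          HalfLine.dirichletLaplacian Ωm' := by
  obtain ⟨G, hG, hgen⟩ := HalfLine.exists_free_propagator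
  have hW := HalfLine.integrableOn_weight hV hmom
  have hS := HalfLine.hasUniformSolutions hV hmom heig hsing
  obtain ⟨U, hU⟩ := HalfLine.exists_perturbation (Complex.I • HalfLine.mulOp hV) hG
  have pG : HalfLine.IsPropagator HalfLine.dirichletLaplacian G :=
    ⟨hG.zero, hG.add, hG.continuous, hgen⟩
  have pU : HalfLine.IsPropagator (HalfLine.schrodinger hV) U :=
    ⟨hU.isC0Group.zero, hU.isC0Group.add, hU.isC0Group.continuous,
      hU.mem_graph_schrodinger_iff hV hG hgen⟩
  -- The limit of `U (-t) G t` at `+∞` is that of `U t G (-t)` at `-∞`, so forward time supplies the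
  -- operators with index minus.
  obtain ⟨Ωm, Ωm', m1, m2, m3, m4, m5⟩ :=
    hU.exists_schrodinger_wave_operators hV hW (.inl rfl) hG hgen hS
  have hgen' : ∀ f h, (f, h) ∈ HalfLine.dirichletLaplacian.graph ↔
      HasDerivAt (fun t => G (-t) f) (-Complex.I • h) 0 := fun f h => by
    rw [hgen, neg_smul]
    refine ⟨HalfLine.hasDerivAt_zero_comp_neg, fun hd => ?_⟩
    simpa only [neg_neg] using HalfLine.hasDerivAt_zero_comp_neg hd
  -- The time-reversed groups have generators with `c = -I` and supply the operators with index
  -- plus.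
  have hU' := hU.comp_neg
  rw [← neg_smul] at hU'
  obtain ⟨Ωp, Ωp', p1, p2, p3, p4, p5⟩ :=
    hU'.exists_schrodinger_wave_operators hV hW (.inr rfl) hG.comp_neg hgen' hS
  simp only [neg_neg] at p1 p2
  refine ⟨G, U, pG, pU, Ωp, Ωm, Ωp', Ωm', p1, fun f => ?_, p2, fun f => ?_,
    HalfLine.implementsSimilarity_of_intertwine pG pU p3 p4 fun s f => by simpa using p5 (-s) f,
    HalfLine.implementsSimilarity_of_intertwine pG pU m3 m4 m5⟩
  · simpa [Function.comp_def] using (m1 f).comp tendsto_neg_atBot_atTop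
  · simpa [Function.comp_def] using (m2 f).comp tendsto_neg_atBot_atTop
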